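/- \textbf{Theorem.} Let $(M,g)$ be a smooth Lorentzian manifold of dimension $n+2$ ($n\ge 0$; either overall sign convention for $g$). On $T^*M$ let $\alpha$ be the tautological $1$-form, $\omega=d\alpha$, and $H(x,p)=\tfrac12 g^{-1}(p,p)$, with Hamiltonian vector field $X_H$ given by $\iota_{X_H}\omega=-dH$. Let $\Sigma=\{(x,p)\in T^*M: H(x,p)=0,\ p\neq 0\}$ be the nonzero null cone, with $T_\sigma\Sigma=\ker dH_\sigma$. Call a subset of $T^*M$ conic if it is invariant under the fiberwise dilations $(x,p)\mapsto(x,cp)$, $c>0$. Then every $\sigma_0\in\Sigma$ has arbitrarily small conic open neighbourhoods $W$ in $T^*M$ (that is, one inside every given conic open neighbourhood of $\sigma_0$) for which the following holds with $U=\Sigma\cap W$. (1) The quotient $\mathcal G$ of $U$ by the lifted null-geodesic flow (two points being identified if they lie on one integral curve of $X_H$ contained in $U$) is a smooth Hausdorff second countable manifold of dimension $2n+2$: there is a surjective submersion $\pi:U\to\mathcal G$, the restriction of a smooth map on $W$, whose fibers are the flow classes. It carries a symplectic form $\omega_{\mathcal G}$ with $\pi^*\omega_{\mathcal G}=\omega|_{T\Sigma}$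 on $U$. (2) The positive fiberwise dilations descend to $\mathcal G$, and the further quotient $\mathcal N$ of $\mathcal G$ by them is a smooth Hausdorff second countable manifold of dimension $2n+1$, with a smooth surjective submersion $q:\mathcal G\to\mathcal N$ whose fibers are the scaling classes. The points of $\mathcal N$ are the (oriented) unparametrized null geodesics in $U$: $\sigma,\tau\in U$ have the same image in $\mathcal N$ if and only if, up to positive scale, both occur as velocity covectors $g(\dot\gamma,\cdot)$ of one affinely parametrized geodesic $\gamma$ of $g$ all of whose velocity covectors lie in $U$. (3) $\mathcal N$ is a contact manifold: there is a contact distribution $\mathcal C\subset T\mathcal N$ such that $\mathcal C_{q(\pi(\sigma))}=d(q\circ\pi)_\sigma\bigl(\ker\alpha_\sigma\cap T_\sigma\Sigma\bigr)$ for all $\sigma\in U$. (4) Let $\theta$ be a contact form for $\mathcal C$ on an open set $V\subset\mathcal N$. Call $\theta$ positive if $\theta(d(q\circ\pi)v)>0$ for all $\sigma\in U$ over $V$ and all $v\in T_\sigma\Sigma$ with $\alpha(v)>0$. If $V$ is connected, then $\theta$ or $-\theta$ is positive. If $\theta$ is positive, there is a diffeomorphism \[ \Phi=(r,q):\ q^{-1}(V)\longrightarrow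 \mathbb R_{>0}\times V,\qquad \Phi^*d(r\,\theta)=\omega_{\mathcal G}, \] so that $\mathcal G$ over $V$ is the symplectization of $(V,\theta)$. The coordinate $r$ is the homogeneous scale of the null covector: $r(\pi(x,cp))=c\,r(\pi(x,p))$ for $c>0$, and $\alpha|_{T\Sigma}=r\cdot(q\circ\pi)^*\theta$ over $V$; the projection to $\mathcal N$ forgets it. -/

import Mathlib

open scoped Manifold ContDiff Topology
open Set

noncomputable section

/-! ## Differential forms on manifolds -/

section Forms

variable {E : Type*} [NormedAddCommGroup E] [NormedSpace ℝ E] {H : Type*} [TopologicalSpace H]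
  (I : ModelWithCorners ℝ E H) {X : Type*} [TopologicalSpace X] [ChartedSpace H X]
  {E' : Type*} [NormedAddCommGroup E'] [NormedSpace ℝ E'] {H' : Type*} [TopologicalSpace H']
  (J : ModelWithCorners ℝ E' H') {Y : Type*} [TopologicalSpace Y] [ChartedSpace H' Y]

/-- A (not necessarily smooth) differential `k`-form on the manifold `X`. -/
abbrev DiffForm (X : Type*) [TopologicalSpace X] [ChartedSpace H X] (k : ℕ) :=
  (x : X) → TangentSpace I x [⋀^Fin k]→L[ℝ] ℝ

variable {k : ℕ}

/-- The local representative of `η` in the preferred chart `φ` at `x₀`: the form `(φ⁻¹)^* η` on the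
model vector space (meaningful on the target of `φ`). -/
def DiffForm.chartRep (η : DiffForm I X k) (x₀ : X) : E → E [⋀^Fin k]→L[ℝ] ℝ := fun y =>
  (η ((extChartAt I x₀).symm y)).compContinuousLinearMap
    (mfderivWithin 𝓘(ℝ, E) I (extChartAt I x₀).symm (range I) y)

/-- `η` is a smooth form on the set `V` (used for open `V`): its local representatives are smooth. -/
def DiffForm.SmoothOn (η : DiffForm I X k) (V : Set X) : Prop :=
  ∀ x₀ : X, ContDiffOn ℝ ∞ (DiffForm.chartRep I η x₀)
    ((extChartAt I x₀).target ∩ (extChartAt I x₀).symm ⁻¹' V)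

/-- The exterior derivative, computed at `x` in the preferred chart `φ` at `x` as
`φ^* d((φ⁻¹)^* η)`. -/
def DiffForm.d (η : DiffForm I X k) : DiffForm I X (k + 1) := fun x =>
  (extDerivWithin (DiffForm.chartRep I η x) (range I) (extChartAt I x x)).compContinuousLinearMap
    (mfderiv I 𝓘(ℝ, E) (extChartAt I x) x)

/-- The pullback `f^* η`. -/
def DiffForm.pullback (f : X → Y) (η : DiffForm J Y k) : DiffForm I X k := fun x =>
  (η (f x)).compContinuousLinearMap (mfderiv I J f x)

/-- A symplectic form: a smooth, closed, nondegenerate `2`-form. -/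
def IsSymplecticForm (η : DiffForm I X 2) : Prop :=
  DiffForm.SmoothOn I η univ ∧ (∀ x, DiffForm.d I η x = 0) ∧
    ∀ (x : X) (v : TangentSpace I x), (∀ w : TangentSpace I x, η x ![v, w] = 0) → v = 0

/-- `θ` is a contact form on the open set `V` for the field of hyperplanes `C`: a smooth, nowhere
vanishing `1`-form with kernel `C` whose differential is nondegenerate on `C`. -/
def IsContactFormOn (C : (x : X) → Submodule ℝ (TangentSpace I x)) (θ : DiffForm I X 1)
    (V : Set X) : Prop :=
  DiffForm.SmoothOn I θ V ∧ ∀ x ∈ V, θ x ≠ 0 ∧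
    (∀ v : TangentSpace I x, v ∈ C x ↔ θ x ![v] = 0) ∧
    ∀ v ∈ C x, (∀ w ∈ C x, DiffForm.d I θ x ![v, w] = 0) → v = 0

/-- A contact distribution: a field of hyperplanes that is locally the kernel of a contact form. -/
def IsContactDistribution (C : (x : X) → Submodule ℝ (TangentSpace I x)) : Prop :=
  ∀ x : X, ∃ V : Set X, IsOpen V ∧ x ∈ V ∧ ∃ θ : DiffForm I X 1, IsContactFormOn I C θ V

/-- The primitive `r θ` of the symplectization form, as a `1`-form on `ℝ × X` (with `r` the first
coordinate). -/
def symplectizationPrimitive (θ : DiffForm I X 1) :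
    DiffForm (𝓘(ℝ, ℝ).prod I) (ℝ × X) 1 := fun z =>
  z.1 • DiffForm.pullback (𝓘(ℝ, ℝ).prod I) I (Prod.snd : ℝ × X → X) θ z

end Forms

/-! ## Lorentzian metrics, the null cone and null geodesics -/

/-- The model space of an `(n+2)`-dimensional manifold. -/
abbrev Model (n : ℕ) := EuclideanSpace ℝ (Fin (n + 2))

/-- The cotangent bundle `T^*M`, with Mathlib's smooth structure of a bundle of linear maps. -/
abbrev CotangentBundle (n : ℕ) (M : Type*) [TopologicalSpace M] [ChartedSpace (Model n) M]
    [IsManifold (𝓡 (n + 2)) ∞ M] :=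
  Bundle.TotalSpace (Model n →L[ℝ] ℝ)
    (fun x : M => TangentSpace (𝓡 (n + 2)) x →L[ℝ] Bundle.Trivial M ℝ x)

/-- The model with corners of `T^*M`. -/
abbrev cotangentModel (n : ℕ) := (𝓡 (n + 2)).prod 𝓘(ℝ, Model n →L[ℝ] ℝ)

/-- A Lorentzian metric on `M`, `dim M = n + 2`: a smooth field of symmetric bilinear forms that are
at each point of signature `(1, n+1)`, in either overall sign convention `ε`. -/
structure LorentzianMetric (n : ℕ) (M : Type*) [TopologicalSpace M] [ChartedSpace (Model n) M]
    [IsManifold (𝓡 (n + 2)) ∞ M] where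
  /-- the bilinear form on each tangent space -/
  form (x : M) : TangentSpace (𝓡 (n + 2)) x →L[ℝ] TangentSpace (𝓡 (n + 2)) x →L[ℝ] ℝ
  symm (x : M) (v w : TangentSpace (𝓡 (n + 2)) x) : form x v w = form x w v
  lorentz (x : M) : ∃ ε : ℝ, (ε = 1 ∨ ε = -1) ∧ ∃ v : TangentSpace (𝓡 (n + 2)) x,
    ε * form x v v < 0 ∧
      ∀ w : TangentSpace (𝓡 (n + 2)) x, form x v w = 0 → w ≠ 0 → 0 < ε * form x w w
  contMDiff : ContMDiff (𝓡 (n + 2))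
    ((𝓡 (n + 2)).prod 𝓘(ℝ, Model n →L[ℝ] Model n →L[ℝ] ℝ)) ∞
    (fun x => Bundle.TotalSpace.mk' (Model n →L[ℝ] Model n →L[ℝ] ℝ)
      (E := fun x : M => TangentSpace (𝓡 (n + 2)) x →L[ℝ] TangentSpace (𝓡 (n + 2)) x →L[ℝ] ℝ)
      x (form x))

section NullCone

variable {n : ℕ} {M : Type*} [TopologicalSpace M] [ChartedSpace (Model n) M]
  [IsManifold (𝓡 (n + 2)) ∞ M]

/-- The tautological `1`-form `α` on `T^*M`: `α_{(x,p)}(v) = p(d(proj) v)`. -/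
def tautologicalForm (n : ℕ) (M : Type*) [TopologicalSpace M] [ChartedSpace (Model n) M]
    [IsManifold (𝓡 (n + 2)) ∞ M] : DiffForm (cotangentModel n) (CotangentBundle n M) 1 := fun σ =>
  ContinuousAlternatingMap.ofSubsingleton ℝ (TangentSpace (cotangentModel n) σ) ℝ (0 : Fin 1)
    ((show TangentSpace (𝓡 (n + 2)) σ.proj →L[ℝ] ℝ from σ.snd).comp
      (mfderiv (cotangentModel n) (𝓡 (n + 2))
        (Bundle.TotalSpace.proj : CotangentBundle n M → M) σ))

/-- The canonical symplectic form `ω = dα` on `T^*M`. -/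
def canonicalForm (n : ℕ) (M : Type*) [TopologicalSpace M] [ChartedSpace (Model n) M]
    [IsManifold (𝓡 (n + 2)) ∞ M] : DiffForm (cotangentModel n) (CotangentBundle n M) 2 :=
  DiffForm.d (cotangentModel n) (tautologicalForm n M)

/-- Fiberwise dilation `(x, p) ↦ (x, c p)`; for `c = exp t` this is the flow of the Euler field. -/
def dilate (c : ℝ) (σ : CotangentBundle n M) : CotangentBundle n M := ⟨σ.proj, c • σ.snd⟩

/-- Invariance under all positive fiberwise dilations. -/
def IsConic (W : Set (CotangentBundle n M)) : Prop :=
  ∀ σ ∈ W, ∀ c : ℝ, 0 < c → dilate c σ ∈ W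

namespace LorentzianMetric

variable (g : LorentzianMetric n M)

/-- The Hamiltonian `H(x,p) = ½ g⁻¹(p,p)`, where `g⁻¹(p,p) = p(p^♯)` and `p^♯` is the vector with
`g(p^♯, ·) = p`. -/
def hamiltonian (σ : CotangentBundle n M) : ℝ :=
  (1 / 2 : ℝ) * (show TangentSpace (𝓡 (n + 2)) σ.proj →L[ℝ] ℝ from σ.snd)
    ((g.form σ.proj).inverse σ.snd)

/-- The differential of the Hamiltonian. -/
def dHamiltonian (σ : CotangentBundle n M) : TangentSpace (cotangentModel n) σ →L[ℝ] ℝ :=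
  mfderiv (cotangentModel n) 𝓘(ℝ, ℝ) g.hamiltonian σ

/-- The nonzero null cone `Σ ⊂ T^*M ∖ 0`. -/
def nullCone : Set (CotangentBundle n M) :=
  {σ | g.hamiltonian σ = 0 ∧ σ.snd ≠ 0}

/-- The tangent space `T_σ Σ = ker dH_σ` of the null cone at `σ ∈ Σ`. -/
def nullConeTangent (σ : CotangentBundle n M) : Submodule ℝ (TangentSpace (cotangentModel n) σ) :=
  (g.dHamiltonian σ).ker

/-- The Hamiltonian vector field `X_H`: the unique vector field with `ι_{X_H} ω = -dH` (with
`ω = dα = dp_a ∧ dx^a` this reads `x' = ∂H/∂p`, `p' = -∂H/∂x`). -/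
def hamiltonianField (σ : CotangentBundle n M) : TangentSpace (cotangentModel n) σ :=
  Classical.epsilon fun X : TangentSpace (cotangentModel n) σ =>
    ∀ Y : TangentSpace (cotangentModel n) σ,
      canonicalForm n M σ ![X, Y] = -(g.dHamiltonian σ Y)

/-- `σ` and `τ` lie on one orbit of the flow of `X_H` inside `U`: some integral curve of `X_H`
that stays in `U` passes through both. -/
def FlowEquiv (U : Set (CotangentBundle n M)) (σ τ : CotangentBundle n M) : Prop :=
  ∃ (c : ℝ → CotangentBundle n M) (a b : ℝ),
    IsMIntegralCurveOn (I := cotangentModel n) c g.hamiltonianField (Ioo a b) ∧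
    (∀ t ∈ Ioo a b, c t ∈ U) ∧ ∃ s ∈ Ioo a b, ∃ t ∈ Ioo a b, c s = σ ∧ c t = τ

/-- The coefficients `g_z(v, w)` of the metric in the preferred chart at `x₀`. -/
def chartCoeff (x₀ : M) (z v w : Model n) : ℝ :=
  g.form ((extChartAt (𝓡 (n + 2)) x₀).symm z)
    (mfderiv (𝓡 (n + 2)) (𝓡 (n + 2)) (extChartAt (𝓡 (n + 2)) x₀).symm z v)
    (mfderiv (𝓡 (n + 2)) (𝓡 (n + 2)) (extChartAt (𝓡 (n + 2)) x₀).symm z w)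

/-- `γ` is an affinely parametrized geodesic on the open set of times `T`: it is smooth and satisfies
the geodesic equation of the Levi-Civita connection. With `y` the coordinate expression of `γ`,
the equation `y'' + Γ(y', y') = 0` is written after lowering the index,
`g_{ia} y''^a + ½ (∂_a g_{ib} + ∂_b g_{ia} - ∂_i g_{ab}) y'^a y'^b = 0`,
contracted with an arbitrary `w^i`. -/
def IsGeodesicOn (γ : ℝ → M) (T : Set ℝ) : Prop :=
  ContMDiffOn 𝓘(ℝ, ℝ) (𝓡 (n + 2)) ∞ γ T ∧ ∀ t ∈ T,
    let y : ℝ → Model n := fun s => extChartAt (𝓡 (n + 2)) (γ t) (γ s)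
    let G : Model n → Model n → Model n → ℝ := g.chartCoeff (γ t)
    ∀ w : Model n,
      G (y t) (deriv (deriv y) t) w
        + fderiv ℝ (fun z => G z (deriv y t) w) (y t) (deriv y t)
        - (1 / 2 : ℝ) * fderiv ℝ (fun z => G z (deriv y t) (deriv y t)) (y t) w = 0

/-- The velocity covector `(γ(t), g(γ'(t), ·))` of a curve in `M`. -/
def covelocity (γ : ℝ → M) (t : ℝ) : CotangentBundle n M :=
  ⟨γ t, g.form (γ t) (mfderiv 𝓘(ℝ, ℝ) (𝓡 (n + 2)) γ t (1 : ℝ))⟩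

/-- `σ` and `τ` are tangent to one unparametrized null geodesic in `U ⊂ Σ`: up to positive scale they
are velocity covectors of one affinely parametrized geodesic all of whose velocity covectors lie in
`U` (hence are nonzero and null). -/
def SameUnparametrizedNullGeodesic (U : Set (CotangentBundle n M))
    (σ τ : CotangentBundle n M) : Prop :=
  ∃ (γ : ℝ → M) (a b : ℝ), g.IsGeodesicOn γ (Ioo a b) ∧
    (∀ t ∈ Ioo a b, g.covelocity γ t ∈ U) ∧
    ∃ s ∈ Ioo a b, ∃ t ∈ Ioo a b, ∃ c : ℝ, 0 < c ∧ ∃ c' : ℝ, 0 < c' ∧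
      g.covelocity γ s = dilate c σ ∧ g.covelocity γ t = dilate c' τ

end LorentzianMetric

end NullCone

end

/-!
# The space of null geodesics of a Lorentzian manifold

In a chart of `T*M` the tautological form is the Liouville form `p dx` and the energy is the
kinetic Hamiltonian `h` of the coefficients of the metric, a function homogeneous of degree two
along the fibres (`tautologicalForm_eq`, `canonicalForm_eq`, `LorentzianMetric.hamiltonian_eq`).
Near a null covector neither the covector nor the base component of the Hamiltonian field
vanishes, so flowing out a slice transverse to the field, and dilating the result, gives a chart
with coordinates `(t, κ, s, y)`: the rescaled flow time, the rescaled value of `h`, the logarithm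
of the scale, and the remaining parameters (`IsHomogeneousHamiltonian.exists_flowBox`, which uses
the smooth dependence of flows on initial values, `exists_smooth_flow`). Dilations translate `s`,
and `s` and `y` range over whole vector spaces. The domain of such a chart is the conic
neighbourhood of the theorem, the null cone is `κ = 0`, the projection to `𝒢` is `(s, y)`
(`flowLabel`) and the projection to `𝒩` is `y`. In particular `𝒢` and `𝒩` are Euclidean spaces.

On the null cone the Liouville form vanishes on the Hamiltonian field and is invariant under its
flow, so it is pulled back from a form in the variables `(s, y)`
(`IsFlowBox.liouvilleForm_levelMap`). Homogeneity under dilations gives this form the shape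
`e^s θ₁` with a form `θ₁` in the variables `y` (`IsFlowBox.reducedForm_eq`). As the kernel of the
symplectic form on the null cone is spanned by the Hamiltonian field, `d(e^s θ₁)` is nondegenerate
(`IsFlowBox.extDeriv_reducedForm_nondegenerate`), which says that `θ₁` is a contact form
(`isContactDistribution_kernelField`). Any other contact form with the same kernels is `θ = f θ₁`
with `f` nowhere zero, positive exactly if `θ` is, and then `r = e^s / f` exhibits `d(e^s θ₁)` as
the symplectization `d(r θ)` (`exists_symplectizationChart`, `symplectizationChart_pullback`).

A smooth curve is a geodesic exactly if its velocity covector is an integral curve of the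
Hamiltonian field (`LorentzianMetric.isGeodesicOn_iff`), and the label `y` does not see the scale;
hence the points of `𝒩` are the unparametrized null geodesics
(`LorentzianMetric.flowLabel_snd_eq_iff`).
-/

/-! ### Local diffeomorphisms -/

section LocalDiffeo

variable {A : Type*} [NormedAddCommGroup A] [NormedSpace ℝ A] [CompleteSpace A]
  {B : Type*} [NormedAddCommGroup B] [NormedSpace ℝ B]

/-- A smooth injective map with invertible derivatives on an open set is a diffeomorphism onto an
open image. -/
theorem exists_openPartialHomeomorph_of_injOn {F : A → B} {S : Set A} (hS : IsOpen S)
    (hF : ContDiffOn ℝ ∞ F S) (hinj : InjOn F S) (hinv : ∀ x ∈ S, (fderiv ℝ F x).IsInvertible) :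
    ∃ e : OpenPartialHomeomorph A B, e.source = S ∧ (∀ x, e x = F x) ∧ e.target = F '' S ∧
      ContDiffOn ℝ ∞ e.symm e.target := by
  have hat : ∀ x ∈ S, ContDiffAt ℝ ∞ F x := fun x hx => hF.contDiffAt (hS.mem_nhds hx)
  have hopen : IsOpenMap (S.domRestrict F) := by
    rw [isOpenMap_iff_nhds_le]
    rintro ⟨x, hx⟩
    obtain ⟨e, he⟩ := hinv x hx
    have hs : HasStrictFDerivAt F (e : A →L[ℝ] B) x := by
      rw [he]; exact (hat x hx).hasStrictFDerivAt (by simp)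
    have h1 := hs.map_nhds_eq_of_equiv
    have h2 : Filter.map (Subtype.val : S → A) (𝓝 ⟨x, hx⟩) = 𝓝 x :=
      map_nhds_subtype_coe_eq_nhds hx (hS.mem_nhds hx)
    show 𝓝 (F x) ≤ Filter.map (F ∘ Subtype.val) (𝓝 ⟨x, hx⟩)
    rw [← Filter.map_map, h2, h1]
  let e := OpenPartialHomeomorph.ofContinuousOpenRestrict (hinj.toPartialEquiv F S)
    hF.continuousOn hopen hS
  refine ⟨e, rfl, fun _ => rfl, rfl, ?_⟩
  intro y hy
  have hx : e.symm y ∈ S := e.map_target hy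
  obtain ⟨e', he'⟩ := hinv _ hx
  refine (e.contDiffAt_symm (f₀' := e') hy ?_ (hat _ hx)).contDiffWithinAt
  rw [he']
  exact ((hat _ hx).differentiableAt (by simp)).hasFDerivAt

/-- The smooth inverse function theorem, with a smooth inverse on a whole neighbourhood. -/
theorem exists_openPartialHomeomorph_of_isInvertible [CompleteSpace B] {F : A → B} {S : Set A}
    (hS : IsOpen S) (hF : ContDiffOn ℝ ∞ F S) {a : A} (ha : a ∈ S)
    (hinv : (fderiv ℝ F a).IsInvertible) :
    ∃ e : OpenPartialHomeomorph A B, a ∈ e.source ∧ e.source ⊆ S ∧ (∀ x, e x = F x) ∧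
      (∀ x ∈ e.source, (fderiv ℝ F x).IsInvertible) ∧ ContDiffOn ℝ ∞ e.symm e.target := by
  obtain ⟨e', he'⟩ := hinv
  have hat : ContDiffAt ℝ ∞ F a := hF.contDiffAt (hS.mem_nhds ha)
  have hd : HasFDerivAt F (e' : A →L[ℝ] B) a := by
    rw [he']; exact (hat.differentiableAt (by simp)).hasFDerivAt
  let e₀ := hat.toOpenPartialHomeomorph F hd (by simp)
  have ha₀ : a ∈ e₀.source := hat.mem_toOpenPartialHomeomorph_source hd (by simp)
  have hc : ContinuousOn (fderiv ℝ F) S := hF.continuousOn_fderiv_of_isOpen hS (by simp)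
  have hO : IsOpen (S ∩ fderiv ℝ F ⁻¹' range ((↑) : (A ≃L[ℝ] B) → A →L[ℝ] B)) :=
    hc.isOpen_inter_preimage hS ContinuousLinearEquiv.isOpen
  let S' := e₀.source ∩ (S ∩ fderiv ℝ F ⁻¹' range ((↑) : (A ≃L[ℝ] B) → A →L[ℝ] B))
  have hS' : IsOpen S' := e₀.open_source.inter hO
  have hinj : InjOn F S' := e₀.injOn.mono inter_subset_left
  obtain ⟨e, h1, h2, -, h4⟩ := exists_openPartialHomeomorph_of_injOn hS'
    (hF.mono fun x hx => hx.2.1) hinj (fun x hx => hx.2.2)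
  refine ⟨e, ?_, ?_, h2, ?_, h4⟩
  · rw [h1]; exact ⟨ha₀, ha, ⟨e', he'⟩⟩
  · rw [h1]; exact fun x hx => hx.2.1
  · rw [h1]; exact fun x hx => hx.2.2

end LocalDiffeo

/-! ### Smooth local flows -/

section Flow

universe u

/-- Composition with a fixed continuous map, as an operator between spaces of continuous maps. -/
def nemytskii {K : Type*} [TopologicalSpace K] {Z F : Type*} [TopologicalSpace Z]
    [TopologicalSpace F] (f : Z → F) (hf : Continuous f) (γ : C(K, Z)) : C(K, F) :=
  (ContinuousMap.mk f hf).comp γ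

variable {K : Type} [TopologicalSpace K] [CompactSpace K]
  {Z F : Type u} [NormedAddCommGroup Z] [NormedSpace ℝ Z]
  [NormedAddCommGroup F] [NormedSpace ℝ F]

/-- Pointwise evaluation of a continuous family of linear maps on a continuous family of vectors. -/
noncomputable def pointwiseApply : C(K, Z →L[ℝ] F) →L[ℝ] C(K, Z) →L[ℝ] C(K, F) :=
  LinearMap.mkContinuous₂
    (LinearMap.mk₂ ℝ (fun (A : C(K, Z →L[ℝ] F)) (v : C(K, Z)) =>
        (⟨fun s => A s (v s), by fun_prop⟩ : C(K, F)))
      (fun _ _ _ => by ext; simp) (fun _ _ _ => by ext; simp)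
      (fun _ _ _ => by ext; simp) (fun _ _ _ => by ext; simp)) 1
    (fun A v => by
      refine (ContinuousMap.norm_le _ (by positivity)).2 fun s => ?_
      have h := (A s).le_of_opNorm_le_of_le (A.norm_coe_le_norm s) (v.norm_coe_le_norm s)
      simpa using h)

theorem hasFDerivAt_nemytskii {f : Z → F} (hf : ContDiff ℝ ∞ f) (γ : C(K, Z)) :
    HasFDerivAt (nemytskii f hf.continuous)
      (pointwiseApply (nemytskii (fderiv ℝ f) (hf.continuous_fderiv (by simp)) γ)) γ := by
  rw [hasFDerivAt_iff_isLittleO, Asymptotics.isLittleO_iff]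
  intro ε hε
  have hc : ContinuousAt (nemytskii (K := K) (fderiv ℝ f) (hf.continuous_fderiv (by simp))) γ :=
    (ContinuousMap.continuous_postcomp (X := K)
    (ContinuousMap.mk (fderiv ℝ f) (hf.continuous_fderiv (by simp)))).continuousAt (x := γ)
  obtain ⟨δ, hδ, h⟩ := (Metric.continuousAt_iff (α := C(K, Z)) (β := C(K, Z →L[ℝ] F))).1 hc ε hε
  filter_upwards [Metric.ball_mem_nhds γ hδ] with η hη
  refine (ContinuousMap.norm_le _ (by positivity)).2 fun s => ?_
  have hηs : η s ∈ Metric.ball (γ s) δ := (ContinuousMap.dist_apply_le_dist s).trans_lt hη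
  have key : ‖f (η s) - f (γ s) - fderiv ℝ f (γ s) (η s - γ s)‖ ≤ ε * ‖η s - γ s‖ := by
    refine (convex_ball (γ s) δ).norm_image_sub_le_of_norm_hasFDerivWithin_le'
      (f' := fderiv ℝ f)
      (fun x _ => ((hf.differentiable (by simp)) x).hasFDerivAt.hasFDerivWithinAt)
      (fun x hx => ?_) (Metric.mem_ball_self hδ) hηs
    -- compare with the translate of `γ` by a constant that passes through `x` at `s`
    have hd : dist (γ + ContinuousMap.const K (x - γ s)) γ < δ := by
      rw [dist_eq_norm, add_sub_cancel_left]
      refine lt_of_le_of_lt ((ContinuousMap.norm_le _ (norm_nonneg (x - γ s))).2 fun _ => le_rfl) ?_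
      simpa [dist_eq_norm] using hx
    have h1 := (ContinuousMap.dist_apply_le_dist s).trans_lt (h hd)
    rw [dist_eq_norm] at h1
    have h2 : (nemytskii (fderiv ℝ f) (hf.continuous_fderiv (by simp))
      (γ + ContinuousMap.const K (x - γ s))) s = fderiv ℝ f x := by
      simp [nemytskii]
    rw [h2] at h1
    exact h1.le
  calc _ = ‖f (η s) - f (γ s) - fderiv ℝ f (γ s) (η s - γ s)‖ := rfl
    _ ≤ ε * ‖η s - γ s‖ := key
    _ ≤ ε * ‖η - γ‖ := by
      gcongr; exact (η - γ).norm_coe_le_norm s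

theorem contDiff_nemytskii {f : Z → F} (hf : ContDiff ℝ ∞ f) :
    ContDiff ℝ ∞ (nemytskii (K := K) f hf.continuous) := by
  rw [contDiff_infty]
  intro n
  induction n generalizing F with
  | zero => exact contDiff_zero.2 (ContinuousMap.continuous_postcomp _)
  | succ n ih =>
    rw [Nat.cast_add, Nat.cast_one, contDiff_succ_iff_hasFDerivAt]
    refine ⟨fun γ => pointwiseApply (nemytskii (fderiv ℝ f) (hf.continuous_fderiv (by simp)) γ),
      ?_, fun γ => hasFDerivAt_nemytskii hf γ⟩
    exact pointwiseApply.contDiff.comp (ih (hf.fderiv_right (by simp)))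

/-- The primitive vanishing at `0` of a continuous curve on the unit interval. -/
noncomputable def unitPrimitive (Z : Type u) [NormedAddCommGroup Z] [NormedSpace ℝ Z]
    [CompleteSpace Z] : C(unitInterval, Z) →L[ℝ] C(unitInterval, Z) :=
  LinearMap.mkContinuous
    { toFun := fun γ => ⟨fun s => ∫ u in (0 : ℝ)..s, IccExtend zero_le_one γ u, by
        have h : Continuous fun s : ℝ => ∫ u in (0 : ℝ)..s, IccExtend zero_le_one γ u :=
          intervalIntegral.continuous_primitive
            (fun a b => (γ.continuous.Icc_extend' (h := zero_le_one)).intervalIntegrable a b) 0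
        exact h.comp continuous_subtype_val⟩
      map_add' := fun γ η => by
        ext s
        exact intervalIntegral.integral_add
          ((γ.continuous.Icc_extend' (h := zero_le_one)).intervalIntegrable _ _)
          ((η.continuous.Icc_extend' (h := zero_le_one)).intervalIntegrable _ _)
      map_smul' := fun c γ => by
        ext s
        exact intervalIntegral.integral_smul c _ } 1
    (fun γ => by
      refine (ContinuousMap.norm_le _ (by positivity)).2 fun s => ?_
      have h := intervalIntegral.norm_integral_le_of_norm_le_const (a := 0) (b := (s : ℝ))
        (f := IccExtend zero_le_one γ) (C := ‖γ‖) (fun u _ => γ.norm_coe_le_norm _)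
      refine h.trans ?_
      rw [sub_zero, abs_of_nonneg s.2.1, one_mul]
      exact mul_le_of_le_one_right (norm_nonneg _) s.2.2)

/-- The map `(t, x, γ) ↦ (t, x, γ - x - t ∫ f(γ))`. The zeros of its last component are the
solutions on the unit interval of `γ' = t f(γ)`, `γ(0) = x`; keeping `t` and `x` as components turns
the implicit function theorem into the inverse function theorem. -/
noncomputable def robbinMap [CompleteSpace Z] (f : Z → Z) (hf : Continuous f)
    (p : ℝ × Z × C(unitInterval, Z)) : ℝ × Z × C(unitInterval, Z) :=
  (p.1, p.2.1, p.2.2 - ContinuousMap.const _ p.2.1 - p.1 • unitPrimitive Z (nemytskii f hf p.2.2))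

theorem contDiff_robbinMap [CompleteSpace Z] {f : Z → Z} (hf : ContDiff ℝ ∞ f) :
    ContDiff ℝ ∞ (robbinMap f hf.continuous) := by
  have h1 : ContDiff ℝ ∞ fun x : Z => ContinuousMap.const unitInterval x :=
    (ContinuousLinearMap.const ℝ unitInterval (M := Z)).contDiff
  have h2 := (unitPrimitive Z).contDiff.comp (contDiff_nemytskii (K := unitInterval) hf) (n := ∞)
  unfold robbinMap
  exact contDiff_fst.prodMk ((contDiff_fst.comp contDiff_snd).prodMk
    (((contDiff_snd.comp contDiff_snd).sub (h1.comp (contDiff_fst.comp contDiff_snd))).sub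
      (contDiff_fst.smul (h2.comp (contDiff_snd.comp contDiff_snd)))))

/-- At `t = 0` the derivative is unipotent: the nonlinear term is multiplied by `t`. -/
theorem isInvertible_fderiv_robbinMap [CompleteSpace Z] {f : Z → Z} (hf : ContDiff ℝ ∞ f) (x : Z)
    (γ : C(unitInterval, Z)) :
    (fderiv ℝ (robbinMap f hf.continuous) (0, x, γ)).IsInvertible := by
  set w := unitPrimitive Z (nemytskii f hf.continuous γ) with hw
  let T : (ℝ × Z × C(unitInterval, Z)) →L[ℝ] C(unitInterval, Z) :=
    (ContinuousLinearMap.const ℝ unitInterval (M := Z)).comp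
      ((ContinuousLinearMap.fst ℝ Z C(unitInterval, Z)).comp (ContinuousLinearMap.snd ℝ ℝ _)) +
    (ContinuousLinearMap.fst ℝ ℝ (Z × C(unitInterval, Z))).smulRight w
  let S : (ℝ × Z × C(unitInterval, Z)) →L[ℝ] C(unitInterval, Z) :=
    (ContinuousLinearMap.snd ℝ Z C(unitInterval, Z)).comp (ContinuousLinearMap.snd ℝ ℝ _)
  let P : (ℝ × Z × C(unitInterval, Z)) →L[ℝ] Z :=
    (ContinuousLinearMap.fst ℝ Z C(unitInterval, Z)).comp (ContinuousLinearMap.snd ℝ ℝ _)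
  have hT : ∀ p : ℝ × Z × C(unitInterval, Z), T p = ContinuousMap.const _ p.2.1 + p.1 • w :=
    fun p => rfl
  refine ⟨ContinuousLinearEquiv.equivOfInverse
    ((ContinuousLinearMap.fst ℝ ℝ _).prod (P.prod (S - T)))
    ((ContinuousLinearMap.fst ℝ ℝ _).prod (P.prod (S + T))) ?_ ?_, ?_⟩
  · intro p
    refine Prod.ext rfl (Prod.ext rfl ?_)
    show (p.2.2 - T p) + (ContinuousMap.const _ p.2.1 + p.1 • w) = p.2.2
    rw [hT]; abel
  · intro p
    refine Prod.ext rfl (Prod.ext rfl ?_)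
    show (p.2.2 + T p) - (ContinuousMap.const _ p.2.1 + p.1 • w) = p.2.2
    rw [hT]; abel
  · refine (HasFDerivAt.fderiv ?_).symm
    have hJ : HasFDerivAt (fun p : ℝ × Z × C(unitInterval, Z) =>
        unitPrimitive Z (nemytskii f hf.continuous p.2.2))
        ((unitPrimitive Z).comp ((pointwiseApply
          (nemytskii (fderiv ℝ f) (hf.continuous_fderiv (by simp)) γ)).comp S)) (0, x, γ) :=
      (unitPrimitive Z).hasFDerivAt.comp _ (HasFDerivAt.comp (0, x, γ)
        (g := nemytskii f hf.continuous) (hasFDerivAt_nemytskii hf γ) S.hasFDerivAt)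
    have h3 := ((S.hasFDerivAt (x := (0, x, γ))).sub
      (((ContinuousLinearMap.const ℝ unitInterval (M := Z)).comp P).hasFDerivAt)).sub
      (((ContinuousLinearMap.fst ℝ ℝ (Z × C(unitInterval, Z))).hasFDerivAt
        (x := (0, x, γ))).smul hJ)
    refine HasFDerivAt.congr_fderiv (((ContinuousLinearMap.fst ℝ ℝ _).hasFDerivAt).prodMk
      (P.hasFDerivAt.prodMk h3)) ?_
    ext1
    · ext <;> simp [T, S, P, hw]
    · ext <;> simp [T, S, P, hw]

/-- A continuous curve of a global smooth field solves the integral equation after rescaling of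
time to the unit interval. -/
theorem robbinMap_of_hasDerivAt [CompleteSpace Z] {f : Z → Z} (hf : Continuous f) {c : ℝ → Z}
    {t ε : ℝ} (ht : |t| < ε) (hc : ∀ u ∈ Ioo (-ε) ε, HasDerivAt c (f (c u)) u)
    (γ : C(unitInterval, Z)) (hγ : ∀ s : unitInterval, γ s = c (t * s)) :
    robbinMap f hf (t, c 0, γ) = (t, c 0, 0) := by
  refine Prod.ext rfl (Prod.ext rfl ?_)
  ext s
  show γ s - c 0 - t • ∫ u in (0 : ℝ)..s, IccExtend zero_le_one (nemytskii f hf γ) u = 0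
  have hmem : ∀ u ∈ Icc (0 : ℝ) s, t * u ∈ Ioo (-ε) ε := fun u hu => by
    rw [mem_Ioo, ← abs_lt, abs_mul, abs_of_nonneg hu.1]
    exact (mul_le_of_le_one_right (abs_nonneg t) (hu.2.trans s.2.2)).trans_lt ht
  have hd : ∀ u ∈ uIcc (0 : ℝ) s, HasDerivAt (fun u => c (t * u)) (t • f (c (t * u))) u := by
    intro u hu
    rw [uIcc_of_le s.2.1] at hu
    have h1 : HasDerivAt (fun u : ℝ => t * u) t u := by
      simpa using (hasDerivAt_id u).const_mul t
    exact (hc _ (hmem u hu)).scomp u h1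
  have hcont : ContinuousOn (fun u => t • f (c (t * u))) (uIcc (0 : ℝ) s) :=
    continuousOn_const.smul
      (hf.comp_continuousOn fun u hu => (hd u hu).continuousAt.continuousWithinAt)
  have h2 := intervalIntegral.integral_eq_sub_of_hasDerivAt hd hcont.intervalIntegrable
  rw [← intervalIntegral.integral_smul]
  rw [intervalIntegral.integral_congr (g := fun u => t • f (c (t * u))), h2, hγ]
  · simp
  · intro u hu
    rw [uIcc_of_le s.2.1] at hu
    have hu1 : u ∈ Icc (0 : ℝ) 1 := ⟨hu.1, hu.2.trans s.2.2⟩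
    show t • IccExtend zero_le_one (nemytskii f hf γ) u = _
    rw [IccExtend_of_mem _ _ hu1]
    show t • f (γ ⟨u, hu1⟩) = _
    rw [hγ]

/-- Smooth dependence on initial values for a globally defined smooth field: the Picard–Lindelöf
solutions `γ` with parameters `(t, x)` satisfy `robbinMap f (t, x, γ) = (t, x, 0)`, so they are
given by the smooth local inverse of `robbinMap f`. -/
theorem exists_smooth_flow_of_contDiff [CompleteSpace Z] {f : Z → Z} (hf : ContDiff ℝ ∞ f)
    (x₀ : Z) :
    ∃ (φ : ℝ × Z → Z) (S : Set (ℝ × Z)), S ∈ 𝓝 (0, x₀) ∧ ContDiffOn ℝ ∞ φ S ∧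
      (∀ p ∈ S, HasDerivAt (fun t => φ (t, p.2)) (f (φ p)) p.1) ∧ ∀ p ∈ S, φ (0, p.2) = p.2 := by
  obtain ⟨ε, hε, a, r, L, C, hr, hpl⟩ :=
    IsPicardLindelof.of_contDiffAt_one (hf.contDiffAt (x := x₀) |>.of_le (by simp))
  obtain ⟨α, hα, hαc⟩ := (hpl 0).exists_forall_mem_closedBall_eq_hasDerivWithinAt_continuousOn
  simp only [zero_sub, zero_add] at hα hαc
  have hder : ∀ x ∈ Metric.closedBall x₀ r, ∀ t ∈ Ioo (-ε) ε,
      HasDerivAt (fun t => α (x, t)) (f (α (x, t))) t := fun x hx t ht =>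
    ((hα x hx).2 t (Ioo_subset_Icc_self ht)).hasDerivAt (Icc_mem_nhds ht.1 ht.2)
  have hx₀ : x₀ ∈ Metric.closedBall x₀ (r : ℝ) := Metric.mem_closedBall_self r.2
  set γ₀ : C(unitInterval, Z) := ContinuousMap.const _ x₀
  obtain ⟨e, he0, -, he, -, hes⟩ := exists_openPartialHomeomorph_of_isInvertible isOpen_univ
    (contDiff_robbinMap hf).contDiffOn (mem_univ _) (isInvertible_fderiv_robbinMap hf x₀ γ₀)
  obtain ⟨δ, hδ, hball⟩ := Metric.isOpen_iff.1 e.open_source _ he0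
  -- the solutions stay close to the constant curve for small times
  have hcα : ContinuousAt α (x₀, 0) := hαc.continuousAt
    (prod_mem_nhds (Metric.closedBall_mem_nhds _ hr) (Icc_mem_nhds (by linarith) hε))
  obtain ⟨η, hη, hηα⟩ := Metric.continuousAt_iff.1 hcα (δ / 2) (by positivity)
  have hα0 : α (x₀, 0) = x₀ := (hα x₀ hx₀).1
  let ρ := min (min ε δ) (min η r)
  have hr' : (0 : ℝ) < r := hr
  have hρ : 0 < ρ := by positivity
  have hρε : ρ ≤ ε := (min_le_left _ _).trans (min_le_left _ _)
  have hρδ : ρ ≤ δ := (min_le_left _ _).trans (min_le_right _ _)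
  have hρη : ρ ≤ η := (min_le_right _ _).trans (min_le_left _ _)
  have hρr : ρ ≤ r := (min_le_right _ _).trans (min_le_right _ _)
  let S : Set (ℝ × Z) := Metric.ball (0, x₀) ρ
  have hS : ∀ p ∈ S, |p.1| < ρ ∧ dist p.2 x₀ < ρ := fun p hp => by
    have h := Metric.mem_ball.1 hp
    rw [Prod.dist_eq, max_lt_iff, Real.dist_eq, sub_zero] at h
    exact h
  have hclosed : ∀ p ∈ S, p.2 ∈ Metric.closedBall x₀ (r : ℝ) := fun p hp =>
    Metric.mem_closedBall.2 ((hS p hp).2.le.trans hρr)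
  have key : ∀ p ∈ S, (p.1, p.2, (0 : C(unitInterval, Z))) ∈ e.target ∧
      α (p.2, p.1) = (e.symm (p.1, p.2, 0)).2.2 1 := by
    rintro ⟨t, x⟩ hp
    obtain ⟨ht, hx⟩ := hS _ hp
    simp only at ht hx
    have hmem : ∀ s : unitInterval, t * s ∈ Ioo (-ρ) ρ := fun s => by
      rw [mem_Ioo, ← abs_lt, abs_mul, abs_of_nonneg s.2.1]
      exact (mul_le_of_le_one_right (abs_nonneg t) s.2.2).trans_lt ht
    have hcont : ContinuousOn (fun u => α (x, u)) (Ioo (-ε) ε) := fun u hu =>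
      (hder x (hclosed _ hp) u hu).continuousAt.continuousWithinAt
    let γ : C(unitInterval, Z) := ⟨fun s => α (x, t * s), by
      refine hcont.comp_continuous (by fun_prop) fun s => ?_
      exact ⟨(neg_le_neg hρε).trans_lt (hmem s).1, (hmem s).2.trans_le hρε⟩⟩
    have hrob := robbinMap_of_hasDerivAt hf.continuous (ht.trans_le hρε)
      (hder x (hclosed _ hp)) γ (fun s => rfl)
    rw [(hα x (hclosed _ hp)).1] at hrob
    have hsrc : (t, x, γ) ∈ e.source := by
      refine hball (Metric.mem_ball.2 ?_)
      rw [Prod.dist_eq, Prod.dist_eq, max_lt_iff, max_lt_iff, Real.dist_eq, sub_zero]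
      refine ⟨ht.trans_le hρδ, hx.trans_le hρδ, lt_of_le_of_lt ?_ (half_lt_self hδ)⟩
      refine (ContinuousMap.dist_le (by positivity)).2 fun s => ?_
      have h := hηα (x := (x, t * s)) (by
        rw [Prod.dist_eq, max_lt_iff, Real.dist_eq, sub_zero]
        exact ⟨hx.trans_le hρη, (abs_lt.2 (hmem s)).trans_le hρη⟩)
      rw [hα0] at h
      exact h.le
    have h1 : e (t, x, γ) = (t, x, 0) := by rw [he, hrob]
    refine ⟨h1 ▸ e.map_source hsrc, ?_⟩
    rw [← h1, e.left_inv hsrc]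
    show _ = α (x, t * ((1 : unitInterval) : ℝ))
    simp
  refine ⟨fun p => α (p.2, p.1), S, Metric.ball_mem_nhds _ hρ, ?_, ?_, ?_⟩
  · have h1 : ContDiffOn ℝ ∞ (fun p : ℝ × Z => (e.symm (p.1, p.2, 0)).2.2 1) S := by
      have h2 : ContDiffOn ℝ ∞ (fun p : ℝ × Z => e.symm (p.1, p.2, 0)) S :=
        hes.comp (f := fun p : ℝ × Z => (p.1, p.2, (0 : C(unitInterval, Z))))
          (by fun_prop) fun p hp => (key p hp).1
      exact (ContinuousMap.evalCLM ℝ (1 : unitInterval)).contDiff.comp_contDiffOn h2.snd.snd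
    exact h1.congr fun p hp => (key p hp).2
  · rintro p hp
    have h := (hS p hp).1.trans_le hρε
    exact hder p.2 (hclosed p hp) p.1 (abs_lt.1 h)
  · intro p hp
    exact (hα p.2 (hclosed p hp)).1

/-- The local flow of a smooth vector field is smooth. -/
theorem exists_smooth_flow [FiniteDimensional ℝ Z] {D : Set Z} (hD : IsOpen D) {X : Z → Z}
    (hX : ContDiffOn ℝ ∞ X D) {x₀ : Z} (hx₀ : x₀ ∈ D) :
    ∃ (φ : ℝ × Z → Z) (S : Set (ℝ × Z)), IsOpen S ∧ ((0 : ℝ), x₀) ∈ S ∧ ContDiffOn ℝ ∞ φ S ∧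
      (∀ p ∈ S, φ p ∈ D) ∧
      (∀ p ∈ S, HasDerivAt (fun t => φ (t, p.2)) (X (φ p)) p.1) ∧ ∀ p ∈ S, φ (0, p.2) = p.2 := by
  have : CompleteSpace Z := FiniteDimensional.complete ℝ Z
  obtain ⟨r, hr, hrD⟩ := Metric.isOpen_iff.1 hD x₀ hx₀
  -- the field is cut off outside a ball in `D`
  let b : ContDiffBump x₀ := ⟨r / 4, r / 2, by positivity, by linarith⟩
  have hf : ContDiff ℝ ∞ fun x => b x • X x := by
    rw [contDiff_iff_contDiffAt]
    intro x
    by_cases hx : x ∈ D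
    · exact b.contDiff.contDiffAt.smul (hX.contDiffAt (hD.mem_nhds hx))
    · have hx' : x ∉ tsupport b := fun h => hx (hrD (by
        rw [b.tsupport_eq] at h
        exact Metric.closedBall_subset_ball (by show r / 2 < r; linarith) h))
      have h0 : (fun x => b x • X x) =ᶠ[𝓝 x] fun _ => 0 := by
        filter_upwards [(isClosed_tsupport b).isOpen_compl.mem_nhds hx'] with y hy
        rw [image_eq_zero_of_notMem_tsupport hy, zero_smul]
      exact contDiffAt_const.congr_of_eventuallyEq h0
  obtain ⟨φ, S, hS, hφ, hφd, hφ0⟩ := exists_smooth_flow_of_contDiff hf x₀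
  have hS' : interior S ∈ 𝓝 ((0 : ℝ), x₀) := interior_mem_nhds.2 hS
  have hφ00 : φ (0, x₀) = x₀ := hφ0 _ (mem_of_mem_nhds hS)
  refine ⟨φ, interior S ∩ φ ⁻¹' Metric.ball x₀ (r / 4), ?_, ?_, ?_, ?_, ?_, ?_⟩
  · exact (hφ.continuousOn.mono interior_subset).isOpen_inter_preimage isOpen_interior
      Metric.isOpen_ball
  · refine ⟨mem_of_mem_nhds hS', ?_⟩
    rw [mem_preimage, hφ00]
    exact Metric.mem_ball_self (by positivity)
  · exact hφ.mono fun p hp => interior_subset hp.1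
  · exact fun p hp => hrD (Metric.ball_subset_ball (by linarith) hp.2)
  · intro p hp
    have h := hφd p (interior_subset hp.1)
    rwa [b.one_of_mem_closedBall (Metric.ball_subset_closedBall hp.2), one_smul] at h
  · exact fun p hp => hφ0 p (interior_subset hp.1)

end Flow

/-! ### The symplectic vector space `E × E*` -/

section Symplectic

variable {E : Type*} [NormedAddCommGroup E] [NormedSpace ℝ E]

/-- The fibre dilation `(x, p) ↦ (x, c p)` of `E × E*`. -/
noncomputable def fiberScale (c : ℝ) : E × (E →L[ℝ] ℝ) →L[ℝ] E × (E →L[ℝ] ℝ) :=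
  (ContinuousLinearMap.fst ℝ _ _).prod (c • ContinuousLinearMap.snd ℝ _ _)

@[simp] theorem fiberScale_apply (c : ℝ) (z : E × (E →L[ℝ] ℝ)) :
    fiberScale c z = (z.1, c • z.2) := rfl

theorem hasFDerivAt_fiberScale (c : ℝ) (z : E × (E →L[ℝ] ℝ)) :
    HasFDerivAt (fiberScale c) (fiberScale (E := E) c) z :=
  ContinuousLinearMap.hasFDerivAt _

/-- The standard symplectic form `dp ∧ dx` of `E × E*`, as a map to the dual space. -/
noncomputable def symplecticFlat :
    E × (E →L[ℝ] ℝ) →L[ℝ] (E × (E →L[ℝ] ℝ)) →L[ℝ] ℝ :=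
  LinearMap.mkContinuous₂
    (LinearMap.mk₂ ℝ (fun v w : E × (E →L[ℝ] ℝ) => v.2 w.1 - w.2 v.1)
      (fun _ _ _ => by simp; ring) (fun _ _ _ => by simp; ring)
      (fun _ _ _ => by simp; ring) (fun _ _ _ => by simp; ring)) 2
    (fun v w => by
      have h1 := v.2.le_of_opNorm_le_of_le (norm_snd_le v) (norm_fst_le w)
      have h2 := w.2.le_of_opNorm_le_of_le (norm_snd_le w) (norm_fst_le v)
      refine (norm_sub_le _ _).trans ?_
      linarith)

@[simp] theorem symplecticFlat_apply (v w : E × (E →L[ℝ] ℝ)) :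
    symplecticFlat v w = v.2 w.1 - w.2 v.1 := rfl

theorem symplecticFlat_injective :
    Function.Injective (symplecticFlat (E := E)) := by
  rw [injective_iff_map_eq_zero]
  intro v hv
  have h : ∀ w : E × (E →L[ℝ] ℝ), v.2 w.1 - w.2 v.1 = 0 := fun w => by
    rw [← symplecticFlat_apply, hv]; rfl
  refine Prod.ext ?_ ?_
  · by_contra hne
    obtain ⟨f, -, hf⟩ := exists_dual_vector ℝ v.1 (norm_ne_zero_iff.2 hne)
    have := h (0, f)
    simp [hf] at this
    exact hne this
  · ext w
    simpa using h (w, 0)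

theorem finrank_continuousDual (V : Type*) [NormedAddCommGroup V] [NormedSpace ℝ V]
    [FiniteDimensional ℝ V] : Module.finrank ℝ (V →L[ℝ] ℝ) = Module.finrank ℝ V := by
  rw [← (LinearMap.toContinuousLinearMap (𝕜 := ℝ) (E := V) (F' := ℝ)).finrank_eq]
  exact Subspace.dual_finrank_eq

/-- The isomorphism of `E × E*` with its dual space given by the standard symplectic form. -/
noncomputable def symplecticEquiv [FiniteDimensional ℝ E] :
    (E × (E →L[ℝ] ℝ)) ≃L[ℝ] (E × (E →L[ℝ] ℝ) →L[ℝ] ℝ) :=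
  (LinearMap.linearEquivOfInjective (symplecticFlat (E := E)).toLinearMap
    symplecticFlat_injective (finrank_continuousDual _).symm).toContinuousLinearEquiv

theorem symplecticEquiv_apply [FiniteDimensional ℝ E] (v : E × (E →L[ℝ] ℝ)) :
    symplecticEquiv v = symplecticFlat v := by
  rfl

/-- The Hamiltonian vector field `X` of `h` on `E × E*`, with the sign `ι_X (dp ∧ dx) = -dh`. -/
noncomputable def hamVec [FiniteDimensional ℝ E] (h : E × (E →L[ℝ] ℝ) → ℝ)
    (z : E × (E →L[ℝ] ℝ)) : E × (E →L[ℝ] ℝ) :=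
  symplecticEquiv.symm (-fderiv ℝ h z)

theorem symplecticFlat_hamVec [FiniteDimensional ℝ E] (h : E × (E →L[ℝ] ℝ) → ℝ)
    (z : E × (E →L[ℝ] ℝ)) :
    symplecticFlat (hamVec h z) = -fderiv ℝ h z := by
  rw [← symplecticEquiv_apply, hamVec, ContinuousLinearEquiv.apply_symm_apply]

theorem eq_hamVec [FiniteDimensional ℝ E] {h : E × (E →L[ℝ] ℝ) → ℝ} {z X : E × (E →L[ℝ] ℝ)}
    (hX : ∀ w, symplecticFlat X w = -fderiv ℝ h z w) : X = hamVec h z :=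
  symplecticFlat_injective (ContinuousLinearMap.ext fun w => by
    rw [symplecticFlat_hamVec]; exact hX w)

theorem fderiv_hamVec_self [FiniteDimensional ℝ E] (h : E × (E →L[ℝ] ℝ) → ℝ)
    (z : E × (E →L[ℝ] ℝ)) :
    fderiv ℝ h z (hamVec h z) = 0 := by
  have h1 := congrArg (fun f => f (hamVec h z)) (symplecticFlat_hamVec h z)
  simpa using h1

theorem contDiffOn_hamVec [FiniteDimensional ℝ E] {h : E × (E →L[ℝ] ℝ) → ℝ}
    {D : Set (E × (E →L[ℝ] ℝ))} (hD : IsOpen D)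
    (hh : ContDiffOn ℝ ∞ h D) : ContDiffOn ℝ ∞ (hamVec h) D :=
  symplecticEquiv.symm.contDiff.comp_contDiffOn (hh.fderiv_of_isOpen hD (by simp)).neg

/-! ### Homogeneous Hamiltonians -/

/-- A smooth function on a conic open set of `E × E*` that is homogeneous of degree two along the
fibres. -/
structure IsHomogeneousHamiltonian (h : E × (E →L[ℝ] ℝ) → ℝ) (D : Set (E × (E →L[ℝ] ℝ))) :
    Prop where
  isOpen : IsOpen D
  scale_mem : ∀ z ∈ D, ∀ c : ℝ, 0 < c → fiberScale c z ∈ D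
  contDiffOn : ContDiffOn ℝ ∞ h D
  map_scale : ∀ z ∈ D, ∀ c : ℝ, 0 < c → h (fiberScale c z) = c ^ 2 * h z

namespace IsHomogeneousHamiltonian

variable {h : E × (E →L[ℝ] ℝ) → ℝ} {D : Set (E × (E →L[ℝ] ℝ))}

theorem hasFDerivAt (H : IsHomogeneousHamiltonian h D) {z : E × (E →L[ℝ] ℝ)} (hz : z ∈ D) :
    HasFDerivAt h (fderiv ℝ h z) z :=
  ((H.contDiffOn.contDiffAt (H.isOpen.mem_nhds hz)).differentiableAt (by simp)).hasFDerivAt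

theorem fderiv_scale (H : IsHomogeneousHamiltonian h D) {z : E × (E →L[ℝ] ℝ)} (hz : z ∈ D)
    {c : ℝ} (hc : 0 < c) (w : E × (E →L[ℝ] ℝ)) :
    fderiv ℝ h (fiberScale c z) (fiberScale c w) = c ^ 2 * fderiv ℝ h z w := by
  have h1 : HasFDerivAt (fun x => h (fiberScale c x))
      ((fderiv ℝ h (fiberScale c z)).comp (fiberScale c)) z :=
    (H.hasFDerivAt (H.scale_mem z hz c hc)).comp z (hasFDerivAt_fiberScale c z)
  have h2 : HasFDerivAt (fun x => h (fiberScale c x)) (c ^ 2 • fderiv ℝ h z) z := by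
    refine ((H.hasFDerivAt hz).const_mul (c ^ 2)).congr_of_eventuallyEq ?_
    filter_upwards [H.isOpen.mem_nhds hz] with x hx using H.map_scale x hx c hc
  have := congrArg (fun f => f w) (h1.unique h2)
  simpa using this

/-- Euler's identity. -/
theorem fderiv_euler (H : IsHomogeneousHamiltonian h D) {z : E × (E →L[ℝ] ℝ)} (hz : z ∈ D) :
    fderiv ℝ h z (0, z.2) = 2 * h z := by
  have hd : HasDerivAt (fun c : ℝ => ((z.1, c • z.2) : E × (E →L[ℝ] ℝ))) (0, z.2) 1 := by
    have := (hasDerivAt_const (1 : ℝ) z.1).prodMk ((hasDerivAt_id (1 : ℝ)).smul_const z.2)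
    simpa using this
  have hz1 : (z.1, (1 : ℝ) • z.2) = z := by simp
  have h1 : HasDerivAt (fun c : ℝ => h (z.1, c • z.2)) (fderiv ℝ h z (0, z.2)) 1 := by
    refine HasFDerivAt.comp_hasDerivAt (1 : ℝ) (l := h) ?_ hd
    rw [hz1]; exact H.hasFDerivAt hz
  have h2 : HasDerivAt (fun c : ℝ => h (z.1, c • z.2)) (2 * h z) 1 := by
    have h3 : HasDerivAt (fun c : ℝ => c ^ 2 * h z) (2 * h z) 1 := by
      simpa using (hasDerivAt_pow 2 (1 : ℝ)).mul_const (h z)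
    refine h3.congr_of_eventuallyEq ?_
    filter_upwards [Ioi_mem_nhds (zero_lt_one' ℝ)] with c hc using H.map_scale z hz c hc
  exact h1.unique h2

/-- The Liouville form evaluates on the Hamiltonian field to twice the Hamiltonian. -/
theorem snd_hamVec_fst [FiniteDimensional ℝ E] (H : IsHomogeneousHamiltonian h D)
    {z : E × (E →L[ℝ] ℝ)} (hz : z ∈ D) :
    z.2 (hamVec h z).1 = 2 * h z := by
  have h1 := congrArg (fun f => f (0, z.2)) (symplecticFlat_hamVec h z)
  simp only [symplecticFlat_apply, neg_apply, map_zero, H.fderiv_euler hz,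
    zero_sub, neg_inj] at h1
  exact h1

/-- Dilation by `c` multiplies the Hamiltonian field by `c⁻¹`: flow lines are dilated to flow lines,
run at a different speed. -/
theorem fiberScale_hamVec [FiniteDimensional ℝ E] (H : IsHomogeneousHamiltonian h D)
    {z : E × (E →L[ℝ] ℝ)} (hz : z ∈ D)
    {c : ℝ} (hc : 0 < c) :
    fiberScale c (hamVec h z) = c⁻¹ • hamVec h (fiberScale c z) := by
  have h1 : c • fiberScale c (hamVec h z) = hamVec h (fiberScale c z) := by
    refine eq_hamVec fun w => ?_
    have hw : w = fiberScale c (fiberScale c⁻¹ w) := by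
      ext <;> simp [hc.ne']
    have h2 := congrArg (fun f => f (fiberScale c⁻¹ w)) (symplecticFlat_hamVec h z)
    simp only [neg_apply] at h2
    rw [hw, H.fderiv_scale hz hc, ← hw, ← mul_neg, ← h2]
    simp
    field_simp
  rw [← h1, inv_smul_smul₀ hc.ne']

end IsHomogeneousHamiltonian

end Symplectic

/-! ### Flow boxes adapted to a homogeneous Hamiltonian -/

section NormalForm

/-- A basis-free form of extending three independent vectors to a basis: given a functional `f` with
`f X = f R = 0`, `f N = 1`, the further basis vectors can be chosen in the kernel of `f`. -/
theorem exists_adapted_frame {V Y : Type*} [NormedAddCommGroup V] [NormedSpace ℝ V]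
    [FiniteDimensional ℝ V] [NormedAddCommGroup Y] [NormedSpace ℝ Y] [FiniteDimensional ℝ Y]
    (hdim : Module.finrank ℝ V = Module.finrank ℝ Y + 3) (f : V →L[ℝ] ℝ) {X N R : V}
    (hX : f X = 0) (hN : f N = 1) (hR : f R = 0)
    (hXR : ∀ a b : ℝ, a • X + b • R = 0 → a = 0 ∧ b = 0) :
    ∃ (j : Y →L[ℝ] V) (A : (ℝ × ℝ × ℝ × Y) ≃L[ℝ] V), (∀ y, f (j y) = 0) ∧
      ∀ p, A p = p.1 • X + p.2.1 • N + p.2.2.1 • R + j p.2.2.2 := by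
  let T : (ℝ × ℝ × ℝ) →ₗ[ℝ] V :=
    { toFun := fun p => p.1 • X + p.2.1 • N + p.2.2 • R
      map_add' := fun p q => by simp only [Prod.fst_add, Prod.snd_add]; module
      map_smul' := fun c p => by
        simp only [Prod.smul_fst, Prod.smul_snd, smul_eq_mul, RingHom.id_apply]; module }
  have hTf : ∀ p, f (T p) = p.2.1 := fun p => by simp [T, hX, hN, hR]
  have hT : ∀ p, T p = 0 → p = 0 := fun p hp => by
    have h1 : p.2.1 = 0 := by rw [← hTf, hp, map_zero]
    have h2 : p.1 • X + p.2.2 • R = 0 := by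
      have : p.1 • X + p.2.1 • N + p.2.2 • R = 0 := hp
      rwa [h1, zero_smul, add_zero] at this
    obtain ⟨h3, h4⟩ := hXR _ _ h2
    exact Prod.ext h3 (Prod.ext h1 h4)
  have hTinj : Function.Injective T := (injective_iff_map_eq_zero T).2 hT
  obtain ⟨Q, hQ⟩ := Submodule.exists_isCompl (LinearMap.range T)
  have hrange : Module.finrank ℝ (LinearMap.range T) = 3 := by
    rw [LinearMap.finrank_range_of_inj hTinj]; simp
  have hQdim : Module.finrank ℝ Y = Module.finrank ℝ Q := by
    have := Submodule.finrank_add_eq_of_isCompl hQ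
    omega
  let j₀ : Y ≃ₗ[ℝ] Q := LinearEquiv.ofFinrankEq _ _ hQdim
  let j : Y →ₗ[ℝ] V := Q.subtype ∘ₗ j₀.toLinearMap -
    (f.toLinearMap ∘ₗ Q.subtype ∘ₗ j₀.toLinearMap).smulRight N
  have hj : ∀ y, j y = (j₀ y : V) - f (j₀ y) • N := fun y => rfl
  let B : (ℝ × ℝ × ℝ × Y) →ₗ[ℝ] V :=
    { toFun := fun p => p.1 • X + p.2.1 • N + p.2.2.1 • R + j p.2.2.2
      map_add' := fun p q => by simp only [Prod.fst_add, Prod.snd_add, map_add]; module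
      map_smul' := fun c p => by
        simp only [Prod.smul_fst, Prod.smul_snd, smul_eq_mul, RingHom.id_apply, map_smul]; module }
  have hB : Function.Injective B := by
    refine (injective_iff_map_eq_zero B).2 fun p hp => ?_
    have hp' : p.1 • X + p.2.1 • N + p.2.2.1 • R + j p.2.2.2 = 0 := hp
    rw [hj] at hp'
    have h1 : (j₀ p.2.2.2 : V) = T (-p.1, f (j₀ p.2.2.2) - p.2.1, -p.2.2.1) := by
      show _ = (-p.1) • X + (f (j₀ p.2.2.2) - p.2.1) • N + (-p.2.2.1) • R
      rw [← sub_eq_zero, ← hp']; module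
    have h2 : (j₀ p.2.2.2 : V) = 0 :=
      Submodule.disjoint_def.1 hQ.disjoint _ (h1 ▸ LinearMap.mem_range_self T _) (j₀ _).2
    have h3 : p.2.2.2 = 0 := by
      rw [← map_eq_zero_iff j₀ j₀.injective]; exact Subtype.ext h2
    rw [h2, map_zero, zero_smul, sub_zero, add_zero] at hp'
    have h4 := hT (p.1, p.2.1, p.2.2.1) hp'
    simp only [Prod.mk_eq_zero] at h4
    exact Prod.ext h4.1 (Prod.ext h4.2.1 (Prod.ext h4.2.2 h3))
  have hBdim : Module.finrank ℝ (ℝ × ℝ × ℝ × Y) = Module.finrank ℝ V := by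
    simp [hdim]; ring
  refine ⟨LinearMap.toContinuousLinearMap j,
    (LinearMap.linearEquivOfInjective B hB hBdim).toContinuousLinearEquiv, fun y => ?_,
    fun p => rfl⟩
  show f (j y) = 0
  rw [hj, map_sub, map_smul, hN]; simp

/-- A local section of a smooth function `h` transverse to its level sets, along an affine subspace:
`h (m (κ, y)) = κ`. -/
theorem exists_level_slice {V Y : Type*} [NormedAddCommGroup V] [NormedSpace ℝ V]
    [NormedAddCommGroup Y] [NormedSpace ℝ Y] [CompleteSpace Y] {h : V → ℝ} {D : Set V}
    (hD : IsOpen D) (hh : ContDiffOn ℝ ∞ h D) {z₀ : V} (hz₀ : z₀ ∈ D) (h0 : h z₀ = 0) {N : V}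
    {j : Y →L[ℝ] V} (hN : fderiv ℝ h z₀ N = 1) (hj : ∀ y, fderiv ℝ h z₀ (j y) = 0) :
    ∃ (m : ℝ × Y → V) (S : Set (ℝ × Y)), IsOpen S ∧ (0, 0) ∈ S ∧ ContDiffOn ℝ ∞ m S ∧
      m (0, 0) = z₀ ∧ (∀ p ∈ S, m p ∈ D ∧ h (m p) = p.1) ∧
      HasFDerivAt m ((ContinuousLinearMap.fst ℝ ℝ Y).smulRight N +
        j.comp (ContinuousLinearMap.snd ℝ ℝ Y)) (0, 0) := by
  let ι : ℝ × Y →L[ℝ] V := (ContinuousLinearMap.fst ℝ ℝ Y).smulRight N +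
        j.comp (ContinuousLinearMap.snd ℝ ℝ Y)
  let a : ℝ × Y → V := fun p => z₀ + ι p
  have ha : ContDiff ℝ ∞ a := contDiff_const.add ι.contDiff
  have ha' : ∀ p, HasFDerivAt a ι p := fun p => ι.hasFDerivAt.const_add z₀
  have ha0 : a 0 = z₀ := by simp [a]
  let F : ℝ × Y → ℝ × Y := fun p => (h (a p), p.2)
  have hS : IsOpen (a ⁻¹' D) := hD.preimage ha.continuous
  have hF : ContDiffOn ℝ ∞ F (a ⁻¹' D) :=
    (hh.comp ha.contDiffOn fun _ hp => hp).prodMk contDiffOn_snd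
  have h0S : (0 : ℝ × Y) ∈ a ⁻¹' D := by rw [mem_preimage, ha0]; exact hz₀
  have hF' : HasFDerivAt F (ContinuousLinearMap.id ℝ (ℝ × Y)) 0 := by
    have h1 : HasFDerivAt h (fderiv ℝ h z₀) (a 0) := by
      rw [ha0]
      exact ((hh.contDiffAt (hD.mem_nhds hz₀)).differentiableAt (by simp)).hasFDerivAt
    refine ((h1.comp 0 (ha' 0)).prodMk hasFDerivAt_snd).congr_fderiv ?_
    ext <;> simp [ι, hN, hj]
  obtain ⟨e, he0, heS, he, -, hes⟩ := exists_openPartialHomeomorph_of_isInvertible hS hF h0S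
    ⟨ContinuousLinearEquiv.refl ℝ _, by rw [hF'.fderiv]; rfl⟩
  have heF : ∀ p ∈ e.target, F (e.symm p) = p := fun p hp => by rw [← he, e.right_inv hp]
  have hF0 : F 0 = 0 := by simp [F, ha0, h0]
  have h00 : (0 : ℝ × Y) ∈ e.target := by rw [← hF0, ← he]; exact e.map_source he0
  have hes0 : e.symm 0 = 0 := by
    conv_lhs => rw [← hF0, ← he]
    exact e.left_inv he0
  have hes' : HasFDerivAt e.symm (ContinuousLinearMap.id ℝ (ℝ × Y)) 0 := by
    refine e.hasFDerivAt_symm (f' := ContinuousLinearEquiv.refl ℝ (ℝ × Y)) h00 ?_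
    rw [hes0]
    exact hF'.congr_of_eventuallyEq (Filter.Eventually.of_forall he)
  refine ⟨fun p => a (e.symm p), e.target, e.open_target, h00, ?_, ?_, ?_, ?_⟩
  · exact ha.comp_contDiffOn hes
  · show a (e.symm 0) = z₀
    rw [hes0, ha0]
  · intro p hp
    exact ⟨heS (e.map_target hp), congrArg Prod.fst (heF p hp)⟩
  · exact ((ha' _).comp (0 : ℝ × Y) hes').congr_fderiv (by ext <;> simp [ι])

variable {E : Type*} [NormedAddCommGroup E] [NormedSpace ℝ E] [FiniteDimensional ℝ E]
  {Y : Type*} [NormedAddCommGroup Y] [InnerProductSpace ℝ Y] [FiniteDimensional ℝ Y]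

/-- A flow box of a homogeneous Hamiltonian `h`: a chart with coordinates `(t, κ, s, y)`, where `t`
is `exp s` times the flow time, `κ` is `exp (-2 s) h`, `s` is the logarithm of the scale of the
covector, and `y` parametrizes flow lines on a level of `h` up to scale. The dilations act by
translation of `s`, which ranges over all reals; `y` ranges over a whole vector space. -/
structure IsFlowBox (h : E × (E →L[ℝ] ℝ) → ℝ) (ε : ℝ)
    (L : OpenPartialHomeomorph (ℝ × ℝ × ℝ × Y) (E × (E →L[ℝ] ℝ))) : Prop where
  pos : 0 < ε
  source_eq : L.source = Ioo (-ε) ε ×ˢ Ioo (-ε) ε ×ˢ univ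
  contDiffOn : ContDiffOn ℝ ∞ L L.source
  contDiffOn_symm : ContDiffOn ℝ ∞ L.symm L.target
  map_eq : ∀ p ∈ L.source, h (L p) = Real.exp p.2.2.1 ^ 2 * p.2.1
  scale : ∀ p ∈ L.source, ∀ a : ℝ,
    fiberScale (Real.exp a) (L p) = L (p.1, p.2.1, p.2.2.1 + a, p.2.2.2)
  hasDerivAt : ∀ p ∈ L.source, HasDerivAt (fun t => L (t, p.2))
    ((Real.exp p.2.2.1)⁻¹ • hamVec h (L p)) p.1

end NormalForm

/-! ### Existence of flow boxes -/

section FlowBoxExistence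

variable {E : Type*} [NormedAddCommGroup E] [NormedSpace ℝ E]

theorem contDiff_expScale : ContDiff ℝ ∞ fun p : ℝ × (E × (E →L[ℝ] ℝ)) =>
    fiberScale (Real.exp p.1) p.2 :=
  (contDiff_fst.comp contDiff_snd).prodMk
    ((Real.contDiff_exp.comp contDiff_fst).smul (contDiff_snd.comp contDiff_snd))

theorem fiberScale_expScale (a b : ℝ) (z : E × (E →L[ℝ] ℝ)) :
    fiberScale (Real.exp a) (fiberScale (Real.exp b) z) = fiberScale (Real.exp (b + a)) z := by
  simp [smul_smul, Real.exp_add, mul_comm]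

theorem isInvertible_fiberScale {c : ℝ} (hc : c ≠ 0) :
    (fiberScale (E := E) c).IsInvertible :=
  ⟨ContinuousLinearEquiv.equivOfInverse (fiberScale c) (fiberScale c⁻¹)
    (fun z => by ext <;> simp [hc]) (fun z => by ext <;> simp [hc]), rfl⟩

theorem hasFDerivAt_expScale_zero (z : E × (E →L[ℝ] ℝ)) :
    HasFDerivAt (fun p : ℝ × (E × (E →L[ℝ] ℝ)) => fiberScale (Real.exp p.1) p.2)
      ((ContinuousLinearMap.fst ℝ ℝ (E × (E →L[ℝ] ℝ))).smulRight ((0, z.2) : E × (E →L[ℝ] ℝ)) +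
        ContinuousLinearMap.snd ℝ ℝ (E × (E →L[ℝ] ℝ))) (0, z) := by
  have h1 : HasFDerivAt (fun p : ℝ × (E × (E →L[ℝ] ℝ)) => Real.exp p.1)
      (Real.exp 0 • ContinuousLinearMap.fst ℝ ℝ (E × (E →L[ℝ] ℝ))) (0, z) :=
    HasDerivAt.comp_hasFDerivAt (h₂ := Real.exp) ((0 : ℝ), z) (Real.hasDerivAt_exp 0)
      hasFDerivAt_fst
  have h2 : HasFDerivAt (fun p : ℝ × (E × (E →L[ℝ] ℝ)) => p.2.2)
      ((ContinuousLinearMap.snd ℝ E (E →L[ℝ] ℝ)).comp (ContinuousLinearMap.snd ℝ ℝ _)) (0, z) :=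
    hasFDerivAt_snd.comp _ hasFDerivAt_snd
  have h3 : HasFDerivAt (fun p : ℝ × (E × (E →L[ℝ] ℝ)) => p.2.1)
      ((ContinuousLinearMap.fst ℝ E (E →L[ℝ] ℝ)).comp (ContinuousLinearMap.snd ℝ ℝ _)) (0, z) :=
    hasFDerivAt_fst.comp _ hasFDerivAt_snd
  refine (h3.prodMk (h1.smul h2)).congr_fderiv ?_
  refine ContinuousLinearMap.ext fun p => Prod.ext (by simp) ?_
  simpa using add_comm p.2.2 (p.1 • z.2)

/-- The derivative at `(0, x₀)` of a map that is the identity at time zero and has initial velocity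
`X`. -/
theorem hasFDerivAt_flow_zero {V : Type*} [NormedAddCommGroup V] [NormedSpace ℝ V]
    {φ : ℝ × V → V} {x₀ X : V} (hφ : DifferentiableAt ℝ φ (0, x₀))
    (ht : HasDerivAt (fun t => φ (t, x₀)) X 0) (h0 : ∀ᶠ x in 𝓝 x₀, φ (0, x) = x) :
    HasFDerivAt φ ((ContinuousLinearMap.fst ℝ ℝ V).smulRight X + ContinuousLinearMap.snd ℝ ℝ V)
      (0, x₀) := by
  refine hφ.hasFDerivAt.congr_fderiv ?_
  have h1 : HasDerivAt (fun t : ℝ => φ (t, x₀)) (fderiv ℝ φ (0, x₀) (1, 0)) 0 :=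
    hφ.hasFDerivAt.comp_hasDerivAt (0 : ℝ) ((hasDerivAt_id _).prodMk (hasDerivAt_const _ _))
  have h2 : HasFDerivAt (fun x => φ (0, x))
      ((fderiv ℝ φ (0, x₀)).comp (ContinuousLinearMap.inr ℝ ℝ V)) x₀ :=
    hφ.hasFDerivAt.comp x₀ (hasFDerivAt_prodMk_right 0 x₀)
  have h3 : HasFDerivAt (fun x => φ (0, x)) (ContinuousLinearMap.id ℝ V) x₀ :=
    (hasFDerivAt_id x₀).congr_of_eventuallyEq h0
  refine ContinuousLinearMap.ext fun p => ?_
  have h4 : fderiv ℝ φ (0, x₀) (0, p.2) = p.2 := congrArg (fun f => f p.2) (h2.unique h3)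
  have h5 : p = p.1 • ((1 : ℝ), (0 : V)) + (0, p.2) := by ext <;> simp
  conv_lhs => rw [h5, map_add, map_smul, h1.unique ht, h4]
  simp

/-- Around a point of the zero level of a homogeneous Hamiltonian at which the covector is nonzero
and the Hamiltonian field is not vertical, the dilated flow of a slice is a flow box. -/
theorem IsHomogeneousHamiltonian.exists_flowBox [FiniteDimensional ℝ E]
    {Y : Type*} [NormedAddCommGroup Y] [InnerProductSpace ℝ Y] [FiniteDimensional ℝ Y]
    {h : E × (E →L[ℝ] ℝ) → ℝ}
    {D : Set (E × (E →L[ℝ] ℝ))} (H : IsHomogeneousHamiltonian h D) {z₀ : E × (E →L[ℝ] ℝ)}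
    (hz₀ : z₀ ∈ D) (h0 : h z₀ = 0) (hp : z₀.2 ≠ 0) (hX : (hamVec h z₀).1 ≠ 0)
    (hdim : Module.finrank ℝ (E × (E →L[ℝ] ℝ)) = Module.finrank ℝ Y + 3) :
    ∃ (ε : ℝ) (L : OpenPartialHomeomorph (ℝ × ℝ × ℝ × Y) (E × (E →L[ℝ] ℝ))),
      IsFlowBox h ε L ∧ z₀ ∈ L.target ∧ L.target ⊆ D := by
  -- the frame at `z₀`
  obtain ⟨N, hN⟩ : ∃ N, fderiv ℝ h z₀ N = 1 := by
    have hne : fderiv ℝ h z₀ ≠ 0 := fun h1 => hX (by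
      rw [← eq_hamVec (h := h) (z := z₀) (X := 0) fun w => by simp [h1]]; rfl)
    obtain ⟨w, hw⟩ := ContinuousLinearMap.exists_ne_zero hne
    exact ⟨(fderiv ℝ h z₀ w)⁻¹ • w, by simp [hw]⟩
  have hR : fderiv ℝ h z₀ (0, z₀.2) = 0 := by rw [H.fderiv_euler hz₀, h0, mul_zero]
  obtain ⟨j, A, hj, hA⟩ := exists_adapted_frame (Y := Y) hdim (fderiv ℝ h z₀)
    (fderiv_hamVec_self h z₀) hN hR (fun a b hab => by
      have h1 : a • (hamVec h z₀).1 = 0 := by simpa using congrArg Prod.fst hab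
      have ha : a = 0 := (smul_eq_zero.1 h1).resolve_right hX
      have h2 : b • z₀.2 = 0 := by simpa [ha] using congrArg Prod.snd hab
      exact ⟨ha, (smul_eq_zero.1 h2).resolve_right hp⟩)
  obtain ⟨m, Sm, hSm, h0Sm, hm, hm0, hmh, hm'⟩ :=
    exists_level_slice H.isOpen H.contDiffOn hz₀ h0 hN hj
  obtain ⟨φ, Sφ, hSφ, h0Sφ, hφ, hφD, hφt, hφ0⟩ := exists_smooth_flow H.isOpen
    (contDiffOn_hamVec H.isOpen H.contDiffOn) hz₀
  -- the flowed-out slice `K₀ (t, κ, y)` and its dilates `K (t, κ, s, y)`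
  let ρ : (ℝ × ℝ × ℝ × Y) → ℝ × ℝ × Y := fun p => (p.2.1, p.1, p.2.2.2)
  let I₀ : ℝ × ℝ × Y → ℝ × (E × (E →L[ℝ] ℝ)) := fun q => (q.2.1, m (q.1, q.2.2))
  have hI₀ : ContDiffOn ℝ ∞ I₀ {q | (q.1, q.2.2) ∈ Sm} :=
    (contDiff_fst.comp contDiff_snd).contDiffOn.prodMk
      (hm.comp (contDiff_fst.prodMk (contDiff_snd.comp contDiff_snd)).contDiffOn fun _ hq => hq)
  have hSmO : IsOpen {q : ℝ × ℝ × Y | (q.1, q.2.2) ∈ Sm} := hSm.preimage (by fun_prop)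
  let S₀ : Set (ℝ × ℝ × Y) := {q | (q.1, q.2.2) ∈ Sm} ∩ I₀ ⁻¹' Sφ
  have hS₀ : IsOpen S₀ := hI₀.continuousOn.isOpen_inter_preimage hSmO hSφ
  let K₀ : ℝ × ℝ × Y → E × (E →L[ℝ] ℝ) := fun q => φ (I₀ q)
  have hK₀ : ContDiffOn ℝ ∞ K₀ S₀ := hφ.comp (hI₀.mono inter_subset_left) fun q hq => hq.2
  let K : ℝ × ℝ × ℝ × Y → E × (E →L[ℝ] ℝ) := fun p => fiberScale (Real.exp p.2.2.1) (K₀ (ρ p))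
  have hρ : ContDiff ℝ ∞ ρ := by fun_prop
  have hK : ContDiffOn ℝ ∞ K (ρ ⁻¹' S₀) :=
    contDiff_expScale.comp_contDiffOn
      ((by fun_prop : ContDiff ℝ ∞ fun p : ℝ × ℝ × ℝ × Y => p.2.2.1).contDiffOn.prodMk
        (hK₀.comp hρ.contDiffOn fun _ hp => hp))
  have hSK : IsOpen (ρ ⁻¹' S₀) := hS₀.preimage hρ.continuous
  have h0S₀ : ((0 : ℝ), (0 : ℝ), (0 : Y)) ∈ S₀ := ⟨h0Sm, by
    show ((0 : ℝ), m (0, 0)) ∈ Sφ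
    rw [hm0]; exact h0Sφ⟩
  have hI00 : I₀ (0, 0, 0) = (0, z₀) := by simp [I₀, hm0]
  have hK₀0 : K₀ (0, 0, 0) = z₀ := by
    show φ (I₀ (0, 0, 0)) = z₀
    rw [hI00]; exact hφ0 _ h0Sφ
  have hKinv : (fderiv ℝ K 0).IsInvertible := by
    refine ⟨A, ?_⟩
    have h1 : HasFDerivAt φ _ (0, z₀) := hasFDerivAt_flow_zero (X := hamVec h z₀)
      ((hφ.contDiffAt (hSφ.mem_nhds h0Sφ)).differentiableAt (by simp))
      (by simpa [hφ0 _ h0Sφ] using hφt _ h0Sφ) (by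
        filter_upwards [(Continuous.prodMk_right (0 : ℝ)).continuousAt.preimage_mem_nhds
          (hSφ.mem_nhds h0Sφ)] with x hx using hφ0 _ hx)
    have h2 : HasFDerivAt (fun p : ℝ × ℝ × ℝ × Y => ((p.2.1, p.2.2.2) : ℝ × Y)) _ 0 :=
      ContinuousLinearMap.hasFDerivAt (((ContinuousLinearMap.fst ℝ ℝ (ℝ × Y)).comp
        (ContinuousLinearMap.snd ℝ ℝ _)).prod ((ContinuousLinearMap.snd ℝ ℝ Y).comp
          ((ContinuousLinearMap.snd ℝ ℝ _).comp (ContinuousLinearMap.snd ℝ ℝ (ℝ × ℝ × Y)))))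
    have h3 : HasFDerivAt (fun p : ℝ × ℝ × ℝ × Y => (p.1, m (p.2.1, p.2.2.2))) _ 0 :=
      hasFDerivAt_fst.prodMk (HasFDerivAt.comp (0 : ℝ × ℝ × ℝ × Y) (g := m) hm' h2)
    have h4 : HasFDerivAt (fun p : ℝ × ℝ × ℝ × Y => φ (p.1, m (p.2.1, p.2.2.2))) _ 0 :=
      HasFDerivAt.comp (0 : ℝ × ℝ × ℝ × Y) (g := φ) (by
        show HasFDerivAt φ _ ((0 : ℝ), m (0, 0))
        rw [hm0]; exact h1) h3
    have h5 : HasFDerivAt (fun p : ℝ × ℝ × ℝ × Y => p.2.2.1) _ 0 :=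
      ContinuousLinearMap.hasFDerivAt ((ContinuousLinearMap.fst ℝ ℝ Y).comp
        ((ContinuousLinearMap.snd ℝ ℝ _).comp (ContinuousLinearMap.snd ℝ ℝ (ℝ × ℝ × Y))))
    have h6 : HasFDerivAt (fun p : ℝ × ℝ × ℝ × Y =>
        fiberScale (Real.exp p.2.2.1) (φ (p.1, m (p.2.1, p.2.2.2)))) _ 0 :=
      HasFDerivAt.comp (0 : ℝ × ℝ × ℝ × Y)
        (g := fun p : ℝ × (E × (E →L[ℝ] ℝ)) => fiberScale (Real.exp p.1) p.2) (by
          show HasFDerivAt _ _ ((0 : ℝ), φ (0, m (0, 0)))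
          rw [hm0, hφ0 _ h0Sφ]; exact hasFDerivAt_expScale_zero z₀) (h5.prodMk h4)
    rw [show fderiv ℝ K 0 = _ from h6.fderiv]
    refine ContinuousLinearMap.ext fun p => ?_
    rw [ContinuousLinearEquiv.coe_coe, hA]
    simp
    module
  obtain ⟨e, he0, heS, he, heinv, -⟩ :=
    exists_openPartialHomeomorph_of_isInvertible hSK hK (a := 0) h0S₀ hKinv
  obtain ⟨ε₁, hε₁, hball⟩ := Metric.isOpen_iff.1 e.open_source _ he0
  -- a linear function of the covector that detects the scale
  obtain ⟨u, hu⟩ : ∃ u, z₀.2 u = 1 := by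
    obtain ⟨w, hw⟩ := ContinuousLinearMap.exists_ne_zero hp
    exact ⟨(z₀.2 w)⁻¹ • w, by simp [hw]⟩
  have hK₀c : ContinuousAt K₀ (0, 0, 0) := hK₀.continuousOn.continuousAt (hS₀.mem_nhds h0S₀)
  have hev : ContinuousAt (fun q => (K₀ q).2 u) (0, 0, 0) :=
    (ContinuousLinearMap.apply ℝ ℝ u).continuous.continuousAt.comp hK₀c.snd
  have hev0 : (K₀ (0, 0, 0)).2 u = 1 := by rw [hK₀0, hu]
  have hnhds : ∀ᶠ q in 𝓝 ((0 : ℝ), (0 : ℝ), (0 : Y)), q ∈ S₀ ∧ 0 < (K₀ q).2 u ∧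
      |Real.log ((K₀ q).2 u)| < ε₁ / 2 := by
    have h1 : ContinuousAt (fun q => |Real.log ((K₀ q).2 u)|) (0, 0, 0) :=
      (hev.log (by rw [hev0]; exact one_ne_zero)).abs
    have h2 := hev.eventually (lt_mem_nhds (show 0 < (K₀ (0, 0, 0)).2 u by
      rw [hev0]; exact one_pos))
    have h3 := h1.eventually (gt_mem_nhds (show |Real.log ((K₀ (0, 0, 0)).2 u)| < ε₁ / 2 by
      rw [hev0]; simpa using hε₁))
    filter_upwards [hS₀.mem_nhds h0S₀, h2, h3] with q a b c using ⟨a, b, c⟩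
  obtain ⟨ε₂, hε₂, hbox⟩ := Metric.eventually_nhds_iff_ball.1 hnhds
  let ε := min ε₁ ε₂
  have hε : 0 < ε := lt_min hε₁ hε₂
  let B : Set (ℝ × ℝ × ℝ × Y) := {p | |p.1| < ε ∧ |p.2.1| < ε ∧ ‖p.2.2.2‖ < ε}
  have hBO : IsOpen B :=
    (isOpen_lt (f := fun p : ℝ × ℝ × ℝ × Y => |p.1|) (by fun_prop) continuous_const).inter
      ((isOpen_lt (f := fun p : ℝ × ℝ × ℝ × Y => |p.2.1|) (by fun_prop) continuous_const).inter
        (isOpen_lt (f := fun p : ℝ × ℝ × ℝ × Y => ‖p.2.2.2‖) (by fun_prop) continuous_const))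
  have hB : ∀ p ∈ B, ρ p ∈ S₀ ∧ 0 < (K₀ (ρ p)).2 u ∧ |Real.log ((K₀ (ρ p)).2 u)| < ε₁ / 2 := by
    intro p hp
    refine hbox _ (Metric.mem_ball.2 ?_)
    rw [Prod.dist_eq, Prod.dist_eq, max_lt_iff, max_lt_iff, dist_zero_right, dist_zero_right,
      dist_zero_right]
    exact ⟨hp.2.1.trans_le (min_le_right _ _), hp.1.trans_le (min_le_right _ _),
      hp.2.2.trans_le (min_le_right _ _)⟩
  have hBe : ∀ p ∈ B, ∀ s : ℝ, |s| < ε₁ → (p.1, p.2.1, s, p.2.2.2) ∈ e.source := by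
    intro p hp s hs
    refine hball (Metric.mem_ball.2 ?_)
    rw [dist_zero_right]
    exact max_lt (hp.1.trans_le (min_le_left _ _)) (max_lt (hp.2.1.trans_le (min_le_left _ _))
      (max_lt hs (hp.2.2.trans_le (min_le_left _ _))))
  have hKscale : ∀ (p : ℝ × ℝ × ℝ × Y) (a : ℝ), fiberScale (Real.exp a) (K p) =
      K (p.1, p.2.1, p.2.2.1 + a, p.2.2.2) := fun p a => fiberScale_expScale _ _ _
  -- the scales of two points with one image differ by less than `ε₁`, so that after a dilation both
  -- points lie where `K` is known to be injective
  have hinj : InjOn K B := by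
    intro p hp p' hp' hpp
    obtain ⟨-, h1, h2⟩ := hB p hp
    obtain ⟨-, h1', h2'⟩ := hB p' hp'
    have h3 : Real.exp p.2.2.1 * (K₀ (ρ p)).2 u = Real.exp p'.2.2.1 * (K₀ (ρ p')).2 u :=
      congrArg (fun z : E × (E →L[ℝ] ℝ) => z.2 u) hpp
    have h4 := congrArg Real.log h3
    rw [Real.log_mul (Real.exp_pos _).ne' h1.ne', Real.log_mul (Real.exp_pos _).ne' h1'.ne',
      Real.log_exp, Real.log_exp] at h4
    have h5 : |p.2.2.1 - p'.2.2.1| < ε₁ := by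
      rw [abs_lt] at h2 h2' ⊢
      constructor <;> linarith
    have h6 : K (p.1, p.2.1, p.2.2.1 - p'.2.2.1, p.2.2.2) = K (p'.1, p'.2.1, 0, p'.2.2.2) := by
      have h7 := congrArg (fiberScale (Real.exp (-p'.2.2.1))) hpp
      rw [hKscale, hKscale, add_neg_cancel, ← sub_eq_add_neg] at h7
      exact h7
    rw [← he, ← he] at h6
    have h8 := e.injOn (hBe p hp _ h5) (hBe p' hp' 0 (by simpa using hε₁)) h6
    simp only [Prod.mk.injEq] at h8
    exact Prod.ext h8.1 (Prod.ext h8.2.1 (Prod.ext (sub_eq_zero.1 h8.2.2.1) h8.2.2.2))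
  have hinv : ∀ p ∈ B, (fderiv ℝ K p).IsInvertible := by
    intro p hp
    have hsrc := hBe p hp 0 (by simpa using hε₁)
    have h1 : HasFDerivAt K (fderiv ℝ K (p.1, p.2.1, 0, p.2.2.2)) (p.1, p.2.1, 0, p.2.2.2) :=
      ((hK.contDiffAt (hSK.mem_nhds (heS hsrc))).differentiableAt (by simp)).hasFDerivAt
    let w : ℝ × ℝ × ℝ × Y := (0, 0, p.2.2.1, 0)
    have hw : p - w = (p.1, p.2.1, 0, p.2.2.2) := by ext <;> simp [w]
    have h2 : HasFDerivAt (fun p' => fiberScale (Real.exp p.2.2.1) (K (p' - w)))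
        ((fiberScale (Real.exp p.2.2.1)).comp (fderiv ℝ K (p.1, p.2.1, 0, p.2.2.2))) p := by
      refine HasFDerivAt.comp p (hasFDerivAt_fiberScale _ _) ?_
      rw [← hw] at h1 ⊢
      exact h1.comp p ((hasFDerivAt_id p).sub_const w)
    have h3 : (fun p' => fiberScale (Real.exp p.2.2.1) (K (p' - w))) = K := by
      funext p'
      rw [hKscale]
      congr 1
      ext <;> simp [w]
    rw [h3] at h2
    rw [h2.fderiv]
    exact (isInvertible_fiberScale (Real.exp_pos _).ne').comp (heinv _ hsrc)
  have hBK : B ⊆ ρ ⁻¹' S₀ := fun p hp => (hB p hp).1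
  obtain ⟨e₃, he₃s, he₃, -, he₃c⟩ :=
    exists_openPartialHomeomorph_of_injOn hBO (hK.mono hBK) hinj hinv
  -- the ball of parameters `y` is replaced by the whole space
  let b := OpenPartialHomeomorph.univBall (0 : Y) ε
  have hbmem : ∀ y, ‖b y‖ < ε := fun y => by
    have := b.map_source (x := y) (by simp [b, OpenPartialHomeomorph.univBall_source])
    rwa [OpenPartialHomeomorph.univBall_target _ hε, mem_ball_zero_iff] at this
  let P := (OpenPartialHomeomorph.refl ℝ).prod ((OpenPartialHomeomorph.refl ℝ).prod
    ((OpenPartialHomeomorph.refl ℝ).prod b))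
  have hPapp : ∀ p, P p = (p.1, p.2.1, p.2.2.1, b p.2.2.2) := fun p => rfl
  let L := P.trans e₃
  have hL : ∀ p, L p = K (p.1, p.2.1, p.2.2.1, b p.2.2.2) := fun p => he₃ _
  have hLs : L.source = Ioo (-ε) ε ×ˢ Ioo (-ε) ε ×ˢ univ := by
    ext p
    simp only [L, OpenPartialHomeomorph.trans_source, he₃s, mem_inter_iff, mem_preimage, hPapp]
    simp [P, b, B, OpenPartialHomeomorph.univBall_source, abs_lt, hbmem]
  have hmemB : ∀ p ∈ L.source, (p.1, p.2.1, p.2.2.1, b p.2.2.2) ∈ B := fun p hp => by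
    rw [hLs] at hp
    exact ⟨abs_lt.2 hp.1, abs_lt.2 hp.2.1, hbmem _⟩
  have h0L : (0 : ℝ × ℝ × ℝ × Y) ∈ L.source := by rw [hLs]; simp [hε]
  have hL0 : L 0 = z₀ := by
    rw [hL]
    have : b (0 : ℝ × ℝ × ℝ × Y).2.2.2 = 0 := OpenPartialHomeomorph.univBall_apply_zero _ _
    rw [this]
    show fiberScale (Real.exp 0) (K₀ (0, 0, 0)) = z₀
    rw [hK₀0]; simp
  have hmemI : ∀ p ∈ B, I₀ (ρ p) ∈ Sφ ∧ (p.2.1, p.2.2.2) ∈ Sm := fun p hp =>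
    ⟨(hB p hp).1.2, (hB p hp).1.1⟩
  refine ⟨ε, L, ⟨hε, hLs, ?_, ?_, ?_, ?_, ?_⟩, ?_, ?_⟩
  · have hb : ContDiff ℝ ∞ b := OpenPartialHomeomorph.contDiff_univBall
    have hPc : ContDiff ℝ ∞ P := by
      show ContDiff ℝ ∞ fun p : ℝ × ℝ × ℝ × Y => (p.1, p.2.1, p.2.2.1, b p.2.2.2)
      fun_prop
    have h1 : ContDiffOn ℝ ∞ (K ∘ P) L.source :=
      (hK.mono hBK).comp hPc.contDiffOn hmemB
    exact h1.congr fun p _ => hL p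
  · have hb : ContDiffOn ℝ ∞ b.symm b.target := by
      rw [OpenPartialHomeomorph.univBall_target _ hε]
      exact OpenPartialHomeomorph.contDiffOn_univBall_symm
    have hPc : ContDiffOn ℝ ∞ P.symm P.target := by
      show ContDiffOn ℝ ∞ (fun p : ℝ × ℝ × ℝ × Y => (p.1, p.2.1, p.2.2.1, b.symm p.2.2.2)) P.target
      refine contDiffOn_fst.prodMk ((contDiff_fst.comp contDiff_snd).contDiffOn.prodMk
        ((by fun_prop : ContDiff ℝ ∞ fun p : ℝ × ℝ × ℝ × Y => p.2.2.1).contDiffOn.prodMk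
        (hb.comp (by fun_prop : ContDiff ℝ ∞ fun p : ℝ × ℝ × ℝ × Y => p.2.2.2).contDiffOn ?_)))
      exact fun p hp => hp.2.2.2
    have hLt : L.target = e₃.target ∩ e₃.symm ⁻¹' P.target := P.trans_target e₃
    rw [hLt]
    exact hPc.comp (he₃c.mono inter_subset_left) fun z hz => hz.2
  · intro p hp
    have hpB := hmemB p hp
    have hI := (hmemI _ hpB).1
    have hcons : h (K₀ (ρ (p.1, p.2.1, p.2.2.1, b p.2.2.2))) = p.2.1 := by
      have hd : ∀ t ∈ Ioo (-ε) ε, HasDerivAt (fun t => h (φ (t, m (p.2.1, b p.2.2.2)))) 0 t := by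
        intro t ht
        have h1 : (t, m (p.2.1, b p.2.2.2)) ∈ Sφ :=
          (hmemI (t, p.2.1, p.2.2.1, b p.2.2.2) ⟨abs_lt.2 ht, hpB.2.1, hpB.2.2⟩).1
        have h2 := (H.hasFDerivAt (hφD _ h1)).comp_hasDerivAt t (hφt _ h1)
        rwa [fderiv_hamVec_self] at h2
      have h2 := isOpen_Ioo.is_const_of_deriv_eq_zero isPreconnected_Ioo
        (fun t ht => (hd t ht).differentiableAt.differentiableWithinAt)
        (fun t ht => (hd t ht).deriv) (abs_lt.1 hpB.1) (show (0 : ℝ) ∈ Ioo (-ε) ε by simp [hε])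
      have h3 := hφ0 _ hI
      show h (φ (p.1, m (p.2.1, b p.2.2.2))) = _
      rw [h2]
      have h4 : φ (0, m (p.2.1, b p.2.2.2)) = m (p.2.1, b p.2.2.2) := h3
      rw [h4]
      exact (hmh _ (hmemI _ hpB).2).2
    rw [hL]
    show h (fiberScale (Real.exp p.2.2.1) (K₀ (ρ (p.1, p.2.1, p.2.2.1, b p.2.2.2)))) = _
    rw [H.map_scale _ (hφD _ hI) _ (Real.exp_pos _), hcons]
  · intro p _ a
    rw [hL, hL, hKscale]
  · intro p hp
    have hpB := hmemB p hp
    have hI := (hmemI _ hpB).1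
    have h1 := (hasFDerivAt_fiberScale (Real.exp p.2.2.1) _).comp_hasDerivAt p.1 (hφt _ hI)
    have h2 : (fun t => L (t, p.2)) = fiberScale (Real.exp p.2.2.1) ∘
        fun t => φ (t, m (p.2.1, b p.2.2.2)) := by
      funext t; rw [hL]; rfl
    rw [h2, hL]
    refine h1.congr_deriv ?_
    exact H.fiberScale_hamVec (hφD _ hI) (Real.exp_pos _)
  · rw [← hL0]; exact L.map_source h0L
  · intro z hz
    rw [← L.right_inv hz, hL]
    exact H.scale_mem _ (hφD _ (hmemI _ (hmemB _ (L.map_target hz))).1) _ (Real.exp_pos _)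

end FlowBoxExistence

/-! ### One-forms on vector spaces and the Liouville form -/

section Alternating

variable {V W : Type*} [AddCommGroup V] [Module ℝ V] [TopologicalSpace V] [AddCommGroup W]
  [Module ℝ W] [TopologicalSpace W]

theorem alternatingMap_one_ext {η ζ : V [⋀^Fin 1]→L[ℝ] ℝ} (h : ∀ v, η ![v] = ζ ![v]) : η = ζ := by
  ext v
  have : v = ![v 0] := by ext i; fin_cases i; rfl
  rw [this]; exact h _

theorem compContinuousLinearMap_one {η : W [⋀^Fin 1]→L[ℝ] ℝ} (f : V →L[ℝ] W) (v : V) :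
    η.compContinuousLinearMap f ![v] = η ![f v] := by
  rw [ContinuousAlternatingMap.compContinuousLinearMap_apply]
  congr 1
  ext i; fin_cases i; rfl

theorem compContinuousLinearMap_two {η : W [⋀^Fin 2]→L[ℝ] ℝ} (f : V →L[ℝ] W) (v w : V) :
    η.compContinuousLinearMap f ![v, w] = η ![f v, f w] := by
  rw [ContinuousAlternatingMap.compContinuousLinearMap_apply]
  congr 1
  ext i; fin_cases i <;> rfl

end Alternating

section OneForms

variable {V W : Type*} [NormedAddCommGroup V] [NormedSpace ℝ V] [NormedAddCommGroup W]
  [NormedSpace ℝ W]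

/-- The evaluation of one-forms on a fixed vector. -/
noncomputable def evalOneForm (v : V) : V [⋀^Fin 1]→L[ℝ] ℝ →L[ℝ] ℝ :=
  ContinuousAlternatingMap.apply ℝ V ℝ ![v]

theorem extDeriv_one_form {η : V → V [⋀^Fin 1]→L[ℝ] ℝ} {x : V} (hη : DifferentiableAt ℝ η x)
    (v w : V) :
    extDeriv η x ![v, w] =
      fderiv ℝ (fun y => η y ![w]) x v - fderiv ℝ (fun y => η y ![v]) x w := by
  rw [extDeriv_apply hη, Fin.sum_univ_two]
  have h0 : (0 : Fin 2).removeNth ![v, w] = ![w] := by ext i; fin_cases i; rfl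
  have h1 : (1 : Fin 2).removeNth ![v, w] = ![v] := by ext i; fin_cases i; rfl
  rw [h0, h1]
  simp [sub_eq_add_neg]

theorem contDiffOn_one_form_apply {η : V → V [⋀^Fin 1]→L[ℝ] ℝ} {S : Set V}
    (hη : ContDiffOn ℝ ∞ η S) (v : V) : ContDiffOn ℝ ∞ (fun x => η x ![v]) S :=
  (evalOneForm v).contDiff.comp_contDiffOn hη

/-- The identification of functionals with one-forms, as a linear map. -/
noncomputable def toOneForm : (V →L[ℝ] ℝ) →L[ℝ] V [⋀^Fin 1]→L[ℝ] ℝ :=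
  (ContinuousAlternatingMap.ofSubsingletonLIE (𝕜 := ℝ) (E := V) (F := ℝ)
    (0 : Fin 1)).toContinuousLinearEquiv

@[simp] theorem toOneForm_apply (L : V →L[ℝ] ℝ) (v : V) : toOneForm L ![v] = L v := rfl

theorem contDiff_toOneForm : ContDiff ℝ ∞ (toOneForm (V := V)) := ContinuousLinearMap.contDiff _

/-- The functional of a one-form. -/
noncomputable def ofOneForm : V [⋀^Fin 1]→L[ℝ] ℝ →L[ℝ] (V →L[ℝ] ℝ) :=
  (ContinuousAlternatingMap.ofSubsingletonLIE (𝕜 := ℝ) (E := V) (F := ℝ)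
    (0 : Fin 1)).toContinuousLinearEquiv.symm

@[simp] theorem ofOneForm_apply (η : V [⋀^Fin 1]→L[ℝ] ℝ) (v : V) : ofOneForm η v = η ![v] := by
  show η (fun _ => v) = _
  congr 1; ext i; fin_cases i; rfl

theorem contDiff_ofOneForm : ContDiff ℝ ∞ (ofOneForm (V := V)) := ContinuousLinearMap.contDiff _

theorem one_form_map_add (η : V [⋀^Fin 1]→L[ℝ] ℝ) (v w : V) :
    η ![v + w] = η ![v] + η ![w] := by
  simp only [← ofOneForm_apply, map_add]

theorem one_form_map_smul (η : V [⋀^Fin 1]→L[ℝ] ℝ) (c : ℝ) (v : V) :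
    η ![c • v] = c * η ![v] := by
  simp only [← ofOneForm_apply, map_smul, smul_eq_mul]

theorem contDiffOn_pullback {η : W → W [⋀^Fin 1]→L[ℝ] ℝ} {F : V → W} {S : Set V} {T : Set W}
    (hS : IsOpen S) (hη : ContDiffOn ℝ ∞ η T) (hF : ContDiffOn ℝ ∞ F S) (hST : MapsTo F S T) :
    ContDiffOn ℝ ∞ (fun x => (η (F x)).compContinuousLinearMap (fderiv ℝ F x)) S := by
  have h1 : ContDiffOn ℝ ∞ (fun x => (ofOneForm (η (F x))).comp (fderiv ℝ F x)) S :=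
    (contDiff_ofOneForm.comp_contDiffOn (hη.comp hF hST)).clm_comp
      (hF.fderiv_of_isOpen hS (by simp))
  refine (contDiff_toOneForm.comp_contDiffOn h1).congr fun x _ => alternatingMap_one_ext fun v => ?_
  rw [compContinuousLinearMap_one]; simp

theorem extDeriv_pullback_smooth {k : ℕ} {η : W → W [⋀^Fin k]→L[ℝ] ℝ} {F : V → W} {x : V}
    (hη : DifferentiableAt ℝ η (F x)) (hF : ContDiffAt ℝ ∞ F x) :
    extDeriv (fun x => (η (F x)).compContinuousLinearMap (fderiv ℝ F x)) x =
      (extDeriv η (F x)).compContinuousLinearMap (fderiv ℝ F x) :=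
  extDeriv_pullback (r := 2) hη (hF.of_le (WithTop.coe_le_coe.2 (le_top : (2 : ℕ∞) ≤ ⊤))) (by simp)

theorem contDiffOn_extDeriv {k : ℕ} {η : V → V [⋀^Fin k]→L[ℝ] ℝ} {S : Set V} (hS : IsOpen S)
    (hη : ContDiffOn ℝ ∞ η S) : ContDiffOn ℝ ∞ (extDeriv η) S :=
  (ContinuousAlternatingMap.alternatizeUncurryFinCLM ℝ V ℝ (n := k)).contDiff.comp_contDiffOn
    (hη.fderiv_of_isOpen hS (by simp))

end OneForms

section Liouville

variable {E : Type*} [NormedAddCommGroup E] [NormedSpace ℝ E]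

/-- The tautological one-form `p dx` of `E × E*`. -/
noncomputable def liouvilleForm (z : E × (E →L[ℝ] ℝ)) : (E × (E →L[ℝ] ℝ)) [⋀^Fin 1]→L[ℝ] ℝ :=
  ContinuousAlternatingMap.ofSubsingleton ℝ (E × (E →L[ℝ] ℝ)) ℝ (0 : Fin 1)
    (z.2.comp (ContinuousLinearMap.fst ℝ E (E →L[ℝ] ℝ)))

@[simp] theorem liouvilleForm_apply (z v : E × (E →L[ℝ] ℝ)) : liouvilleForm z ![v] = z.2 v.1 := rfl

theorem contDiff_liouvilleForm : ContDiff ℝ ∞ (liouvilleForm (E := E)) :=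
  contDiff_toOneForm.comp
    (contDiff_snd.clm_comp contDiff_const)

theorem extDeriv_liouvilleForm (z v w : E × (E →L[ℝ] ℝ)) :
    extDeriv liouvilleForm z ![v, w] = symplecticFlat v w := by
  rw [extDeriv_one_form (contDiff_liouvilleForm.differentiable (by simp) z)]
  have h : ∀ w : E × (E →L[ℝ] ℝ), fderiv ℝ (fun y => liouvilleForm y ![w]) z =
      (ContinuousLinearMap.apply ℝ ℝ w.1).comp (ContinuousLinearMap.snd ℝ E (E →L[ℝ] ℝ)) :=
    fun w => ContinuousLinearMap.fderiv
      ((ContinuousLinearMap.apply ℝ ℝ w.1).comp (ContinuousLinearMap.snd ℝ E (E →L[ℝ] ℝ)))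
  rw [h, h]
  rfl

end Liouville

/-! ### Symplectic reduction in a flow box -/

section Reduction

variable {E : Type*} [NormedAddCommGroup E] [NormedSpace ℝ E] [FiniteDimensional ℝ E]
  {Y : Type*} [NormedAddCommGroup Y] [InnerProductSpace ℝ Y]
  {h : E × (E →L[ℝ] ℝ) → ℝ} {D : Set (E × (E →L[ℝ] ℝ))} {ε : ℝ}
  {L : OpenPartialHomeomorph (ℝ × ℝ × ℝ × Y) (E × (E →L[ℝ] ℝ))}

/-- The restriction of a flow box to the zero level of the Hamiltonian, with coordinates `(t, g)`,
`g = (s, y)`. -/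
noncomputable def levelMap (L : OpenPartialHomeomorph (ℝ × ℝ × ℝ × Y) (E × (E →L[ℝ] ℝ)))
    (q : ℝ × ℝ × Y) : E × (E →L[ℝ] ℝ) := L (q.1, 0, q.2)

/-- The section `t = 0` of the zero level, parametrizing the space of flow lines. -/
noncomputable def levelSection (L : OpenPartialHomeomorph (ℝ × ℝ × ℝ × Y) (E × (E →L[ℝ] ℝ)))
    (g : ℝ × Y) : E × (E →L[ℝ] ℝ) := L (0, 0, g)

/-- The Liouville form on the space of flow lines. -/
noncomputable def reducedForm (L : OpenPartialHomeomorph (ℝ × ℝ × ℝ × Y) (E × (E →L[ℝ] ℝ)))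
    (g : ℝ × Y) : (ℝ × Y) [⋀^Fin 1]→L[ℝ] ℝ :=
  (liouvilleForm (levelSection L g)).compContinuousLinearMap (fderiv ℝ (levelSection L) g)

theorem isOpen_strip {T : Type*} [TopologicalSpace T] {ε : ℝ} :
    IsOpen {q : ℝ × T | q.1 ∈ Ioo (-ε) ε} :=
  isOpen_Ioo.preimage continuous_fst

namespace IsFlowBox

theorem mem_source_iff (hL : IsFlowBox h ε L) {p : ℝ × ℝ × ℝ × Y} :
    p ∈ L.source ↔ p.1 ∈ Ioo (-ε) ε ∧ p.2.1 ∈ Ioo (-ε) ε := by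
  rw [hL.source_eq]; simp

theorem zero_mem (hL : IsFlowBox h ε L) : (0 : ℝ) ∈ Ioo (-ε) ε :=
  ⟨neg_lt_zero.2 hL.pos, hL.pos⟩

theorem hasFDerivAt (hL : IsFlowBox h ε L) {p : ℝ × ℝ × ℝ × Y} (hp : p ∈ L.source) :
    HasFDerivAt L (fderiv ℝ L p) p :=
  ((hL.contDiffOn.contDiffAt (L.open_source.mem_nhds hp)).differentiableAt (by simp)).hasFDerivAt

theorem hasFDerivAt_symm (hL : IsFlowBox h ε L) {z : E × (E →L[ℝ] ℝ)} (hz : z ∈ L.target) :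
    HasFDerivAt L.symm (fderiv ℝ L.symm z) z :=
  ((hL.contDiffOn_symm.contDiffAt (L.open_target.mem_nhds hz)).differentiableAt
    (by simp)).hasFDerivAt

theorem fderiv_symm_fderiv (hL : IsFlowBox h ε L) {p : ℝ × ℝ × ℝ × Y} (hp : p ∈ L.source)
    (w : ℝ × ℝ × ℝ × Y) : fderiv ℝ L.symm (L p) (fderiv ℝ L p w) = w := by
  have h1 := (hL.hasFDerivAt_symm (L.map_source hp)).comp p (hL.hasFDerivAt hp)
  have h2 : HasFDerivAt (L.symm ∘ L) (ContinuousLinearMap.id ℝ _) p := by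
    refine (hasFDerivAt_id p).congr_of_eventuallyEq ?_
    filter_upwards [L.open_source.mem_nhds hp] with x hx using L.left_inv hx
  exact congrArg (fun f => f w) (h1.unique h2)

theorem fderiv_fderiv_symm (hL : IsFlowBox h ε L) {z : E × (E →L[ℝ] ℝ)} (hz : z ∈ L.target)
    (v : E × (E →L[ℝ] ℝ)) : fderiv ℝ L (L.symm z) (fderiv ℝ L.symm z v) = v := by
  have h1 := (hL.hasFDerivAt (L.map_target hz)).comp z (hL.hasFDerivAt_symm hz)
  have h2 : HasFDerivAt (L ∘ L.symm) (ContinuousLinearMap.id ℝ _) z := by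
    refine (hasFDerivAt_id z).congr_of_eventuallyEq ?_
    filter_upwards [L.open_target.mem_nhds hz] with x hx using L.right_inv hx
  exact congrArg (fun f => f v) (h1.unique h2)

theorem apply_eq_zero_iff (hL : IsFlowBox h ε L) {p : ℝ × ℝ × ℝ × Y} (hp : p ∈ L.source) :
    h (L p) = 0 ↔ p.2.1 = 0 := by
  rw [hL.map_eq p hp]
  simp [(Real.exp_pos p.2.2.1).ne']

theorem fderiv_time (hL : IsFlowBox h ε L) {p : ℝ × ℝ × ℝ × Y} (hp : p ∈ L.source) :
    fderiv ℝ L p (1, 0) = (Real.exp p.2.2.1)⁻¹ • hamVec h (L p) := by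
  have h1 : HasDerivAt (fun t => L (t, p.2)) (fderiv ℝ L p (1, 0)) p.1 :=
    HasFDerivAt.comp_hasDerivAt (l := L) p.1 (hL.hasFDerivAt hp)
      ((hasDerivAt_id p.1).prodMk (hasDerivAt_const p.1 p.2))
  exact h1.unique (hL.hasDerivAt p hp)

/-- In a flow box the differential of the Hamiltonian along its zero level is a multiple of `dκ`. -/
theorem fderiv_hamiltonian (hL : IsFlowBox h ε L) (H : IsHomogeneousHamiltonian h D)
    (hLD : L.target ⊆ D) {p : ℝ × ℝ × ℝ × Y} (hp : p ∈ L.source) (hp0 : p.2.1 = 0)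
    (w : ℝ × ℝ × ℝ × Y) :
    fderiv ℝ h (L p) (fderiv ℝ L p w) = Real.exp p.2.2.1 ^ 2 * w.2.1 := by
  have h1 := (H.hasFDerivAt (hLD (L.map_source hp))).comp p (hL.hasFDerivAt hp)
  let c : (ℝ × ℝ × ℝ × Y) →L[ℝ] ℝ :=
    (ContinuousLinearMap.fst ℝ ℝ (ℝ × Y)).comp (ContinuousLinearMap.snd ℝ ℝ _)
  let s : (ℝ × ℝ × ℝ × Y) →L[ℝ] ℝ := (ContinuousLinearMap.fst ℝ ℝ Y).comp
    ((ContinuousLinearMap.snd ℝ ℝ (ℝ × Y)).comp (ContinuousLinearMap.snd ℝ ℝ _))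
  have h2 : HasFDerivAt (h ∘ L) _ p :=
    (((s.hasFDerivAt (x := p)).exp.pow 2).mul (c.hasFDerivAt (x := p))).congr_of_eventuallyEq (by
      filter_upwards [L.open_source.mem_nhds hp] with x hx using hL.map_eq x hx)
  have h3 := congrArg (fun f => f w) (h1.unique h2)
  have hc : c p = 0 := hp0
  simp [hc] at h3
  exact h3

theorem mem_level (hL : IsFlowBox h ε L) {q : ℝ × ℝ × Y} (hq : q.1 ∈ Ioo (-ε) ε) :
    ((q.1, 0, q.2) : ℝ × ℝ × ℝ × Y) ∈ L.source := hL.mem_source_iff.2 ⟨hq, hL.zero_mem⟩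

theorem hasFDerivAt_levelMap (hL : IsFlowBox h ε L) {q : ℝ × ℝ × Y} (hq : q.1 ∈ Ioo (-ε) ε) :
    HasFDerivAt (levelMap L) ((fderiv ℝ L (q.1, 0, q.2)).comp
      ((ContinuousLinearMap.fst ℝ ℝ (ℝ × Y)).prod
        ((0 : (ℝ × ℝ × Y) →L[ℝ] ℝ).prod (ContinuousLinearMap.snd ℝ ℝ (ℝ × Y))))) q := by
  have h1 := (hL.hasFDerivAt (hL.mem_level hq)).comp q
    ((ContinuousLinearMap.fst ℝ ℝ (ℝ × Y)).prod
      ((0 : (ℝ × ℝ × Y) →L[ℝ] ℝ).prod (ContinuousLinearMap.snd ℝ ℝ (ℝ × Y)))).hasFDerivAt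
  exact h1

theorem fderiv_levelMap (hL : IsFlowBox h ε L) {q : ℝ × ℝ × Y} (hq : q.1 ∈ Ioo (-ε) ε)
    (w : ℝ × ℝ × Y) : fderiv ℝ (levelMap L) q w = fderiv ℝ L (q.1, 0, q.2) (w.1, 0, w.2) := by
  rw [(hL.hasFDerivAt_levelMap hq).fderiv]; rfl

theorem contDiffOn_levelMap (hL : IsFlowBox h ε L) :
    ContDiffOn ℝ ∞ (levelMap L) {q : ℝ × ℝ × Y | q.1 ∈ Ioo (-ε) ε} :=
  hL.contDiffOn.comp (by fun_prop : ContDiff ℝ ∞ fun q : ℝ × ℝ × Y =>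
    ((q.1, 0, q.2) : ℝ × ℝ × ℝ × Y)).contDiffOn fun _ hq => hL.mem_level hq

theorem contDiff_levelSection (hL : IsFlowBox h ε L) : ContDiff ℝ ∞ (levelSection L) :=
  contDiffOn_univ.1 (hL.contDiffOn.comp (by fun_prop : ContDiff ℝ ∞ fun g : ℝ × Y =>
    ((0, 0, g) : ℝ × ℝ × ℝ × Y)).contDiffOn
      fun _ _ => hL.mem_source_iff.2 ⟨hL.zero_mem, hL.zero_mem⟩)

theorem fderiv_levelSection (hL : IsFlowBox h ε L) (g w : ℝ × Y) :
    fderiv ℝ (levelSection L) g w = fderiv ℝ L (0, 0, g) (0, 0, w) := by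
  have h1 : HasFDerivAt (levelSection L) _ g :=
    (hL.hasFDerivAt (p := ((0, 0, g) : ℝ × ℝ × ℝ × Y))
      (hL.mem_source_iff.2 ⟨hL.zero_mem, hL.zero_mem⟩)).comp g
    ((0 : (ℝ × Y) →L[ℝ] ℝ).prod
      ((0 : (ℝ × Y) →L[ℝ] ℝ).prod (ContinuousLinearMap.id ℝ (ℝ × Y)))).hasFDerivAt
  rw [h1.fderiv]; rfl

theorem contDiff_reducedForm (hL : IsFlowBox h ε L) : ContDiff ℝ ∞ (reducedForm L) :=
  contDiffOn_univ.1 (contDiffOn_pullback isOpen_univ contDiff_liouvilleForm.contDiffOn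
    hL.contDiff_levelSection.contDiffOn (mapsTo_univ _ _))

theorem contDiffOn_pullback_levelMap (hL : IsFlowBox h ε L) :
    ContDiffOn ℝ ∞ (fun q => (liouvilleForm (levelMap L q)).compContinuousLinearMap
      (fderiv ℝ (levelMap L) q)) {q : ℝ × ℝ × Y | q.1 ∈ Ioo (-ε) ε} :=
  contDiffOn_pullback isOpen_strip contDiff_liouvilleForm.contDiffOn hL.contDiffOn_levelMap
    (mapsTo_univ _ _)

variable (hL : IsFlowBox h ε L) (H : IsHomogeneousHamiltonian h D) (hLD : L.target ⊆ D)
include hL H hLD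

/-- The Liouville form vanishes on the Hamiltonian field along the zero level. -/
theorem liouvilleForm_time {q : ℝ × ℝ × Y} (hq : q.1 ∈ Ioo (-ε) ε) :
    liouvilleForm (levelMap L q) ![fderiv ℝ (levelMap L) q (1, 0)] = 0 := by
  have hs := hL.mem_level hq
  rw [hL.fderiv_levelMap hq]
  have h1 := hL.fderiv_time hs
  simp only [Prod.mk_zero_zero] at h1 ⊢
  rw [h1, one_form_map_smul, liouvilleForm_apply]
  show _ * (L (q.1, 0, q.2)).2 (hamVec h (L (q.1, 0, q.2))).1 = 0
  rw [H.snd_hamVec_fst (hLD (L.map_source hs)), (hL.apply_eq_zero_iff hs).2 rfl]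
  simp

theorem symplecticFlat_time {q : ℝ × ℝ × Y} (hq : q.1 ∈ Ioo (-ε) ε) (w : ℝ × ℝ × Y) :
    symplecticFlat (fderiv ℝ (levelMap L) q (1, 0)) (fderiv ℝ (levelMap L) q w) = 0 := by
  have hs := hL.mem_level hq
  rw [hL.fderiv_levelMap hq, hL.fderiv_levelMap hq]
  have h1 := hL.fderiv_time hs
  simp only [Prod.mk_zero_zero] at h1 ⊢
  rw [h1, map_smul, symplecticFlat_hamVec]
  simp [hL.fderiv_hamiltonian H hLD hs rfl]

/-- The Liouville form is invariant under the Hamiltonian flow along the zero level, so that it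
descends to the space of flow lines. -/
theorem liouvilleForm_levelMap {q : ℝ × ℝ × Y} (hq : q.1 ∈ Ioo (-ε) ε) (w : ℝ × ℝ × Y) :
    liouvilleForm (levelMap L q) ![fderiv ℝ (levelMap L) q w] = reducedForm L q.2 ![w.2] := by
  set β : ℝ × ℝ × Y → (ℝ × ℝ × Y) [⋀^Fin 1]→L[ℝ] ℝ := fun q =>
    (liouvilleForm (levelMap L q)).compContinuousLinearMap (fderiv ℝ (levelMap L) q) with hβ
  have hβa : ∀ q v, β q ![v] = liouvilleForm (levelMap L q) ![fderiv ℝ (levelMap L) q v] :=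
    fun q v => compContinuousLinearMap_one _ _
  have hβs := hL.contDiffOn_pullback_levelMap
  have hnhds : ∀ q : ℝ × ℝ × Y, q.1 ∈ Ioo (-ε) ε → {q : ℝ × ℝ × Y | q.1 ∈ Ioo (-ε) ε} ∈ 𝓝 q :=
    fun q hq => isOpen_strip.mem_nhds hq
  -- the Lie derivative along the flow vanishes
  have hder : ∀ q : ℝ × ℝ × Y, q.1 ∈ Ioo (-ε) ε →
      fderiv ℝ (fun q => β q ![(0, w.2)]) q (1, 0) = 0 := by
    intro q hq
    have h1 : extDeriv β q ![(1, 0), (0, w.2)] = 0 := by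
      rw [hβ, extDeriv_pullback_smooth
        ((contDiff_liouvilleForm (E := E)).differentiable (by simp) _)
        (hL.contDiffOn_levelMap.contDiffAt (hnhds q hq)),
        compContinuousLinearMap_two, extDeriv_liouvilleForm]
      exact symplecticFlat_time hL H hLD hq _
    rw [extDeriv_one_form ((hβs.contDiffAt (hnhds q hq)).differentiableAt (by simp))] at h1
    have h2 : (fun q => β q ![(1, 0)]) =ᶠ[𝓝 q] fun _ => 0 := by
      filter_upwards [hnhds q hq] with x hx
      rw [hβa]
      exact liouvilleForm_time hL H hLD hx
    rwa [h2.fderiv_eq, fderiv_fun_const, Pi.zero_apply, zero_apply, sub_zero] at h1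
  have hconst : β q ![(0, w.2)] = β (0, q.2) ![(0, w.2)] := by
    have hd : ∀ t ∈ Ioo (-ε) ε, HasDerivAt (fun t => β (t, q.2) ![(0, w.2)]) 0 t := by
      intro t ht
      have h1 : HasFDerivAt (fun q => β q ![(0, w.2)])
          (fderiv ℝ (fun q => β q ![(0, w.2)]) (t, q.2)) (t, q.2) :=
        (((contDiffOn_one_form_apply hβs _).contDiffAt (hnhds (t, q.2) ht)).differentiableAt
          (by simp)).hasFDerivAt
      have h2 := HasFDerivAt.comp_hasDerivAt (l := fun q => β q ![(0, w.2)]) t h1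
        ((hasDerivAt_id t).prodMk (hasDerivAt_const t q.2))
      rwa [hder (t, q.2) ht] at h2
    exact isOpen_Ioo.is_const_of_deriv_eq_zero isPreconnected_Ioo
        (fun t ht => (hd t ht).differentiableAt.differentiableWithinAt)
        (fun t ht => (hd t ht).deriv) hq hL.zero_mem
  have hw : w = w.1 • ((1 : ℝ), (0 : ℝ × Y)) + (0, w.2) := by ext <;> simp
  calc liouvilleForm (levelMap L q) ![fderiv ℝ (levelMap L) q w] = β q ![w] := (hβa _ _).symm
    _ = β q ![(0, w.2)] := by
        conv_lhs => rw [hw, one_form_map_add, one_form_map_smul, hβa,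
          liouvilleForm_time hL H hLD hq]
        simp
    _ = β (0, q.2) ![(0, w.2)] := hconst
    _ = reducedForm L q.2 ![w.2] := by
        rw [hβa, reducedForm, compContinuousLinearMap_one, hL.fderiv_levelMap hL.zero_mem,
          hL.fderiv_levelSection]
        rfl

theorem symplecticFlat_levelMap {q : ℝ × ℝ × Y} (hq : q.1 ∈ Ioo (-ε) ε) (v w : ℝ × ℝ × Y) :
    symplecticFlat (fderiv ℝ (levelMap L) q v) (fderiv ℝ (levelMap L) q w) =
      extDeriv (reducedForm L) q.2 ![v.2, w.2] := by
  have hn : {q : ℝ × ℝ × Y | q.1 ∈ Ioo (-ε) ε} ∈ 𝓝 q := isOpen_strip.mem_nhds hq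
  have h1 : (fun q => (liouvilleForm (levelMap L q)).compContinuousLinearMap
      (fderiv ℝ (levelMap L) q)) =ᶠ[𝓝 q] fun q =>
      (reducedForm L (Prod.snd q)).compContinuousLinearMap
        (fderiv ℝ (Prod.snd : ℝ × ℝ × Y → ℝ × Y) q) := by
    filter_upwards [hn] with x hx
    refine alternatingMap_one_ext fun v => ?_
    rw [compContinuousLinearMap_one, compContinuousLinearMap_one, fderiv_snd]
    exact liouvilleForm_levelMap hL H hLD hx v
  have h2 := DFunLike.congr_fun h1.extDeriv_eq ![v, w]
  rw [extDeriv_pullback_smooth ((contDiff_liouvilleForm (E := E)).differentiable (by simp) _)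
      (hL.contDiffOn_levelMap.contDiffAt hn),
    extDeriv_pullback_smooth (hL.contDiff_reducedForm.differentiable (by simp) _)
      contDiffAt_snd, compContinuousLinearMap_two,
    compContinuousLinearMap_two, extDeriv_liouvilleForm, fderiv_snd] at h2
  exact h2

/-- The tangent vectors to the zero level, in the coordinates of a flow box. -/
theorem exists_levelMap_tangent {z : E × (E →L[ℝ] ℝ)} (hz : z ∈ L.target) (hz0 : h z = 0)
    {v : E × (E →L[ℝ] ℝ)} (hv : fderiv ℝ h z v = 0) :
    (L.symm z).1 ∈ Ioo (-ε) ε ∧ levelMap L ((L.symm z).1, (L.symm z).2.2) = z ∧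
      fderiv ℝ (levelMap L) ((L.symm z).1, (L.symm z).2.2)
        ((fderiv ℝ L.symm z v).1, (fderiv ℝ L.symm z v).2.2) = v := by
  have hs := L.map_target hz
  have h0 : (L.symm z).2.1 = 0 := by
    rw [← hL.apply_eq_zero_iff hs, L.right_inv hz, hz0]
  have hm := (hL.mem_source_iff.1 hs).1
  have hp : (((L.symm z).1, 0, (L.symm z).2.2) : ℝ × ℝ × ℝ × Y) = L.symm z := by rw [← h0]
  have h1 := hL.fderiv_hamiltonian H hLD hs h0 (fderiv ℝ L.symm z v)
  rw [hL.fderiv_fderiv_symm hz, L.right_inv hz, hv] at h1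
  have h2 : (fderiv ℝ L.symm z v).2.1 = 0 := by
    simpa [(Real.exp_pos (L.symm z).2.2.1).ne'] using h1.symm
  refine ⟨hm, ?_, ?_⟩
  · show L ((L.symm z).1, 0, (L.symm z).2.2) = z
    rw [hp, L.right_inv hz]
  · rw [hL.fderiv_levelMap hm]
    simp only
    rw [hp, ← h2]
    exact hL.fderiv_fderiv_symm hz v

/-- The reduced two-form is nondegenerate: the kernel of the symplectic form on the zero level is
spanned by the Hamiltonian field. -/
theorem extDeriv_reducedForm_nondegenerate {g v : ℝ × Y}
    (hv : ∀ w, extDeriv (reducedForm L) g ![v, w] = 0) : v = 0 := by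
  have hq : ((0 : ℝ), g).1 ∈ Ioo (-ε) ε := hL.zero_mem
  have hs := hL.mem_level hq
  simp only at hs
  set p : ℝ × ℝ × ℝ × Y := (0, 0, g) with hp
  set V := fderiv ℝ L p (0, 0, v) with hV
  -- the functional `ω(V, ·)` vanishes on the kernel of `dh`, so it is a multiple of `dh`
  have h1 : ∀ w : ℝ × ℝ × ℝ × Y, w.2.1 = 0 → symplecticFlat V (fderiv ℝ L p w) = 0 := by
    intro w hw
    have h2 := symplecticFlat_levelMap hL H hLD hq (0, v) (w.1, w.2.2)
    rw [hL.fderiv_levelMap hq, hL.fderiv_levelMap hq, hv] at h2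
    have h3 : ((w.1, 0, w.2.2) : ℝ × ℝ × ℝ × Y) = w := by rw [← hw]
    simp only at h2
    rwa [h3] at h2
  have h4 : ∀ w : ℝ × ℝ × ℝ × Y, symplecticFlat V (fderiv ℝ L p w) =
      w.2.1 * symplecticFlat V (fderiv ℝ L p (0, 1, 0)) := by
    intro w
    have h5 := h1 (w - w.2.1 • (0, 1, 0)) (by simp)
    rw [map_sub, map_sub, map_smul, map_smul, sub_eq_zero] at h5
    exact h5
  set c := symplecticFlat V (fderiv ℝ L p (0, 1, 0)) with hc
  set r := Real.exp p.2.2.1 with hr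
  have hr0 : r ≠ 0 := (Real.exp_pos _).ne'
  have h6 : symplecticFlat V = symplecticFlat (-(c / r ^ 2) • hamVec h (L p)) := by
    rw [map_smul, symplecticFlat_hamVec]
    refine ContinuousLinearMap.ext fun x => ?_
    have hx : x = fderiv ℝ L p (fderiv ℝ L.symm (L p) x) := by
      have := hL.fderiv_fderiv_symm (L.map_source hs) x
      rw [L.left_inv hs] at this
      exact this.symm
    rw [hx, h4, ← hx]
    have h7 := hL.fderiv_hamiltonian H hLD hs rfl (fderiv ℝ L.symm (L p) x)
    rw [← hx, ← hr] at h7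
    simp only [FunLike.coe_smul, Pi.smul_apply, neg_apply, smul_eq_mul, h7]
    field_simp
  have h8 := symplecticFlat_injective h6
  have h9 : V = fderiv ℝ L p ((-(c / r)) • ((1 : ℝ), (0 : ℝ × ℝ × Y))) := by
    rw [map_smul, hL.fderiv_time hs, h8, ← hr, smul_smul]
    congr 1
    field_simp
  have h10 := congrArg (fderiv ℝ L.symm (L p)) h9
  rw [hV, hL.fderiv_symm_fderiv hs, hL.fderiv_symm_fderiv hs] at h10
  have := congrArg (fun x => x.2.2) h10
  simpa using this

end IsFlowBox

end Reduction

/-! ### Contact forms and symplectizations on vector spaces -/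

section Contact

variable {Y : Type*} [NormedAddCommGroup Y] [NormedSpace ℝ Y]

/-- The form `e^s θ` on `ℝ × Y`, with `s` the first coordinate. -/
noncomputable def expForm (θ : Y → Y [⋀^Fin 1]→L[ℝ] ℝ) (g : ℝ × Y) : (ℝ × Y) [⋀^Fin 1]→L[ℝ] ℝ :=
  Real.exp g.1 • (θ g.2).compContinuousLinearMap (ContinuousLinearMap.snd ℝ ℝ Y)

theorem expForm_apply (θ : Y → Y [⋀^Fin 1]→L[ℝ] ℝ) (g v : ℝ × Y) :
    expForm θ g ![v] = Real.exp g.1 * θ g.2 ![v.2] := by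
  rw [expForm, ContinuousAlternatingMap.smul_apply, compContinuousLinearMap_one, smul_eq_mul]
  rfl

theorem contDiff_expForm {θ : Y → Y [⋀^Fin 1]→L[ℝ] ℝ} (hθ : ContDiff ℝ ∞ θ) :
    ContDiff ℝ ∞ (expForm θ) := by
  have h1 := contDiffOn_univ.1 (contDiffOn_pullback (V := ℝ × Y) isOpen_univ hθ.contDiffOn
    contDiff_snd.contDiffOn (mapsTo_univ _ _))
  refine (Real.contDiff_exp.comp contDiff_fst).smul ?_
  simpa only [fderiv_snd] using h1

theorem extDeriv_expForm {θ : Y → Y [⋀^Fin 1]→L[ℝ] ℝ} (hθ : ContDiff ℝ ∞ θ) (g v w : ℝ × Y) :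
    extDeriv (expForm θ) g ![v, w] = Real.exp g.1 *
      (v.1 * θ g.2 ![w.2] - w.1 * θ g.2 ![v.2] + extDeriv θ g.2 ![v.2, w.2]) := by
  rw [extDeriv_one_form ((contDiff_expForm hθ).differentiable (by simp) _),
    extDeriv_one_form (hθ.differentiable (by simp) _)]
  have h : ∀ v w : ℝ × Y, fderiv ℝ (fun g => expForm θ g ![w]) g v =
      Real.exp g.1 * (v.1 * θ g.2 ![w.2] + fderiv ℝ (fun y => θ y ![w.2]) g.2 v.2) := by
    intro v w
    have h1 : HasFDerivAt (fun y => θ y ![w.2]) (fderiv ℝ (fun y => θ y ![w.2]) g.2) g.2 :=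
      ((contDiffOn_univ.1 (contDiffOn_one_form_apply hθ.contDiffOn w.2)).differentiable
        (by simp) _).hasFDerivAt
    have h2 : HasFDerivAt (fun g : ℝ × Y => θ g.2 ![w.2]) _ g :=
      h1.comp g (hasFDerivAt_snd (p := g))
    have h3 : HasFDerivAt (fun g : ℝ × Y => Real.exp g.1) _ g := (hasFDerivAt_fst (p := g)).exp
    have h4 : (fun g => expForm θ g ![w]) = fun g : ℝ × Y => Real.exp g.1 * θ g.2 ![w.2] :=
      funext fun g => expForm_apply θ g w
    have h5 : HasFDerivAt (fun g : ℝ × Y => Real.exp g.1 * θ g.2 ![w.2]) _ g := h3.mul h2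
    rw [h4, h5.fderiv]
    simp
    ring
  rw [h, h]
  ring

/-- If `d(e^s θ)` is nondegenerate then `θ` vanishes nowhere. -/
theorem ne_zero_of_nondegenerate {θ : Y → Y [⋀^Fin 1]→L[ℝ] ℝ} (hθ : ContDiff ℝ ∞ θ)
    (hnd : ∀ g v : ℝ × Y, (∀ w, extDeriv (expForm θ) g ![v, w] = 0) → v = 0) (y : Y) : θ y ≠ 0 := by
  intro h
  have h1 := hnd (0, y) (1, 0) fun w => by
    rw [extDeriv_expForm hθ]
    have h2 : extDeriv θ y ![0, w.2] = 0 :=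
      (extDeriv θ y).map_coord_zero (m := ![0, w.2]) 0 rfl
    simp [h, h2]
  simpa using congrArg Prod.fst h1

theorem exists_apply_ne_zero {η : Y [⋀^Fin 1]→L[ℝ] ℝ} (h : η ≠ 0) : ∃ v, η ![v] ≠ 0 := by
  by_contra! hv
  exact h (alternatingMap_one_ext fun v => by rw [hv]; rfl)

/-- A functional vanishing on the kernel of a one-form is a multiple of it. -/
theorem exists_eq_mul_of_ker_le {η : Y [⋀^Fin 1]→L[ℝ] ℝ} {f : Y →ₗ[ℝ] ℝ}
    (h : ∀ w, η ![w] = 0 → f w = 0) : ∃ c : ℝ, ∀ w, f w = c * η ![w] := by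
  by_cases hη : η = 0
  · exact ⟨0, fun w => by rw [h w (by rw [hη]; rfl), zero_mul]⟩
  · obtain ⟨u, hu⟩ := exists_apply_ne_zero hη
    refine ⟨f u / η ![u], fun w => ?_⟩
    have h1 := h (w + (-(η ![w] / η ![u])) • u) (by
      rw [one_form_map_add, one_form_map_smul]; field_simp; ring)
    rw [map_add, map_smul, smul_eq_mul] at h1
    field_simp at h1 ⊢
    linarith

/-- If `d(e^s θ)` is nondegenerate then `dθ` is nondegenerate on the kernel of `θ`. -/
theorem eq_zero_of_nondegenerate {θ : Y → Y [⋀^Fin 1]→L[ℝ] ℝ} (hθ : ContDiff ℝ ∞ θ)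
    (hnd : ∀ g v : ℝ × Y, (∀ w, extDeriv (expForm θ) g ![v, w] = 0) → v = 0) {y v : Y}
    (hv : θ y ![v] = 0) (hw : ∀ w, θ y ![w] = 0 → extDeriv θ y ![v, w] = 0) : v = 0 := by
  let f : Y →ₗ[ℝ] ℝ := (fderiv ℝ θ y v : Y [⋀^Fin 1]→L[ℝ] ℝ) |> fun η => (ofOneForm η).toLinearMap -
    (ContinuousLinearMap.comp (evalOneForm v) (fderiv ℝ θ y)).toLinearMap
  have hf : ∀ w, f w = extDeriv θ y ![v, w] := by
    intro w
    have hd := hθ.differentiable (by simp) y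
    have h1 : ∀ w, fderiv ℝ (fun y => θ y ![w]) y = (evalOneForm w).comp (fderiv ℝ θ y) := fun w =>
      ((evalOneForm w).hasFDerivAt.comp y hd.hasFDerivAt).fderiv
    rw [extDeriv_one_form hd, h1, h1]
    show ofOneForm (fderiv ℝ θ y v) w - _ = _
    rw [ofOneForm_apply]
    rfl
  obtain ⟨c, hc⟩ := exists_eq_mul_of_ker_le (η := θ y) (f := f) fun w h => by rw [hf, hw w h]
  have h1 := hnd (0, y) (-c, v) fun w => by
    rw [extDeriv_expForm hθ]
    simp only [hv, ← hf, hc]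
    ring
  simpa using congrArg Prod.snd h1

/-- Two smooth nowhere vanishing one-forms with the same kernels differ by a smooth nowhere
vanishing factor. -/
theorem exists_smooth_factor {θ₁ θ : Y → Y [⋀^Fin 1]→L[ℝ] ℝ} {V : Set Y} (hV : IsOpen V)
    (hθ₁ : ContDiffOn ℝ ∞ θ₁ V) (hθ : ContDiffOn ℝ ∞ θ V) (h0 : ∀ y ∈ V, θ y ≠ 0)
    (hker : ∀ y ∈ V, ∀ v, θ₁ y ![v] = 0 ↔ θ y ![v] = 0) :
    ∃ f : Y → ℝ, ContDiffOn ℝ ∞ f V ∧ (∀ y ∈ V, f y ≠ 0) ∧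
      ∀ y ∈ V, ∀ v, θ y ![v] = f y * θ₁ y ![v] := by
  have hex : ∀ y, ∃ c : ℝ, y ∈ V → ∀ v, θ y ![v] = c * θ₁ y ![v] := by
    intro y
    by_cases hy : y ∈ V
    · obtain ⟨c, hc⟩ := exists_eq_mul_of_ker_le (η := θ₁ y) (f := (ofOneForm (θ y)).toLinearMap)
        fun w hw => by simpa using (hker y hy w).1 hw
      exact ⟨c, fun _ v => by simpa using hc v⟩
    · exact ⟨0, fun h => absurd h hy⟩
  choose f hf using hex
  refine ⟨f, ?_, ?_, fun y hy v => hf y hy v⟩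
  · intro y hy
    obtain ⟨v, hv⟩ := exists_apply_ne_zero (h0 y hy)
    have hv₁ : θ₁ y ![v] ≠ 0 := fun h => hv ((hker y hy v).1 h)
    have h1 := (contDiffOn_one_form_apply hθ₁ v).contDiffAt (hV.mem_nhds hy)
    have h2 := (contDiffOn_one_form_apply hθ v).contDiffAt (hV.mem_nhds hy)
    refine ((h2.div h1 hv₁).congr_of_eventuallyEq ?_).contDiffWithinAt
    filter_upwards [hV.mem_nhds hy, h1.continuousAt.eventually_ne hv₁] with x hx hx1
    show f x = θ x ![v] / θ₁ x ![v]
    rw [hf x hx v, mul_div_cancel_right₀ _ hx1]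
  · intro y hy h
    obtain ⟨v, hv⟩ := exists_apply_ne_zero (h0 y hy)
    exact hv (by rw [hf y hy, h, zero_mul])

/-- The symplectization chart `(s, y) ↦ (e^s / f y, y)` associated with a positive function `f`. -/
theorem exists_symplectizationChart {G : Type*} [NormedAddCommGroup G] [NormedSpace ℝ G]
    (e : G ≃L[ℝ] ℝ × Y) {V : Set Y} (hV : IsOpen V) {f : Y → ℝ} (hf : ContDiffOn ℝ ∞ f V)
    (hpos : ∀ y ∈ V, 0 < f y) :
    ∃ Φ : OpenPartialHomeomorph G (ℝ × Y), Φ.source = {a | (e a).2 ∈ V} ∧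
      Φ.target = Ioi (0 : ℝ) ×ˢ V ∧ (∀ a, Φ a = (Real.exp (e a).1 / f (e a).2, (e a).2)) ∧
      ContDiffOn ℝ ∞ Φ Φ.source ∧ ContDiffOn ℝ ∞ Φ.symm Φ.target := by
  have hs : IsOpen {a | (e a).2 ∈ V} := hV.preimage (continuous_snd.comp e.continuous)
  have h1 : ContDiff ℝ ∞ fun a => (e a).1 := contDiff_fst.comp e.contDiff
  have h2 : ContDiff ℝ ∞ fun a => (e a).2 := contDiff_snd.comp e.contDiff
  have hc : ContDiffOn ℝ ∞ (fun a => (Real.exp (e a).1 / f (e a).2, (e a).2)) {a | (e a).2 ∈ V} :=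
    ((Real.contDiff_exp.comp h1).contDiffOn.div (hf.comp h2.contDiffOn fun _ ha => ha)
      fun a ha => (hpos _ ha).ne').prodMk h2.contDiffOn
  have hf' : ContDiffOn ℝ ∞ (fun z : ℝ × Y => f z.2) (Ioi (0 : ℝ) ×ˢ V) :=
    hf.comp contDiffOn_snd fun _ hz => hz.2
  have hc' : ContDiffOn ℝ ∞ (fun z : ℝ × Y => e.symm (Real.log (z.1 * f z.2), z.2))
      (Ioi (0 : ℝ) ×ˢ V) :=
    e.symm.contDiff.comp_contDiffOn (((contDiffOn_fst.mul hf').log fun z hz =>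
      (mul_pos hz.1 (hpos _ hz.2)).ne').prodMk contDiffOn_snd)
  refine ⟨⟨⟨⟨fun a => (Real.exp (e a).1 / f (e a).2, (e a).2),
    fun z => e.symm (Real.log (z.1 * f z.2), z.2), {a | (e a).2 ∈ V}, Ioi (0 : ℝ) ×ˢ V,
    ?_, ?_, ?_, ?_⟩, hc.continuousOn, hc'.continuousOn⟩, hs, isOpen_Ioi.prod hV⟩, rfl, rfl,
    fun _ => rfl, hc, hc'⟩
  · exact fun a ha => ⟨div_pos (Real.exp_pos _) (hpos _ ha), ha⟩
  · intro z hz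
    show (e (e.symm _)).2 ∈ V
    rw [e.apply_symm_apply]; exact hz.2
  · intro a ha
    show e.symm (Real.log (Real.exp (e a).1 / f (e a).2 * f (e a).2), (e a).2) = a
    rw [div_mul_cancel₀ _ (hpos _ ha).ne', Real.log_exp]
    exact e.symm_apply_apply a
  · intro z hz
    show (Real.exp (e (e.symm _)).1 / f (e (e.symm _)).2, (e (e.symm _)).2) = z
    rw [e.apply_symm_apply]
    simp only
    rw [Real.exp_log (mul_pos hz.1 (hpos _ hz.2)), mul_div_cancel_right₀ _ (hpos _ hz.2).ne']

/-- In the chart `(s, y) ↦ (e^s / f y, y)` the form `r θ`, with `θ = f θ₁`, is `e^s θ₁`. -/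
theorem symplectizationChart_pullback {G : Type*} [NormedAddCommGroup G] [NormedSpace ℝ G]
    (e : G ≃L[ℝ] ℝ × Y) {V : Set Y} (hV : IsOpen V) {f : Y → ℝ}
    (hpos : ∀ y ∈ V, 0 < f y) {θ₁ θ : Y → Y [⋀^Fin 1]→L[ℝ] ℝ} (hθ₁ : ContDiff ℝ ∞ θ₁)
    (hθ : ContDiffOn ℝ ∞ θ V) (hfθ : ∀ y ∈ V, ∀ v, θ y ![v] = f y * θ₁ y ![v])
    {Φ : G → ℝ × Y} (hΦ : ∀ a, Φ a = (Real.exp (e a).1 / f (e a).2, (e a).2))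
    {a : G} (ha : (e a).2 ∈ V) (hΦa : ContDiffAt ℝ ∞ Φ a) :
    (extDeriv (fun z : ℝ × Y => z.1 • (θ z.2).compContinuousLinearMap
      (ContinuousLinearMap.snd ℝ ℝ Y)) (Φ a)).compContinuousLinearMap (fderiv ℝ Φ a) =
    (extDeriv (expForm θ₁) (e a)).compContinuousLinearMap (e : G →L[ℝ] ℝ × Y) := by
  have hs : IsOpen {a | (e a).2 ∈ V} := hV.preimage (continuous_snd.comp e.continuous)
  have hΦ2 : ∀ a, (Φ a).2 = (e a).2 := fun a => by rw [hΦ]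
  have hsm : ContDiffOn ℝ ∞ (fun z : ℝ × Y => z.1 • (θ z.2).compContinuousLinearMap
      (ContinuousLinearMap.snd ℝ ℝ Y)) {z | z.2 ∈ V} := by
    have h1 := contDiffOn_pullback (V := ℝ × Y) (S := {z | z.2 ∈ V}) (hV.preimage continuous_snd) hθ
      contDiff_snd.contDiffOn (fun _ hz => hz)
    simp only [fderiv_snd] at h1
    exact contDiffOn_fst.smul h1
  have hd1 : DifferentiableAt ℝ (fun z : ℝ × Y => z.1 • (θ z.2).compContinuousLinearMap
      (ContinuousLinearMap.snd ℝ ℝ Y)) (Φ a) :=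
    (hsm.contDiffAt ((hV.preimage continuous_snd).mem_nhds (by
      show (Φ a).2 ∈ V
      rw [hΦ2]; exact ha))).differentiableAt (by simp)
  have hd2 : DifferentiableAt ℝ (expForm θ₁) (e a) :=
    (contDiff_expForm hθ₁).differentiable (by simp) _
  rw [← extDeriv_pullback_smooth hd1 hΦa]
  have h3 := extDeriv_pullback_smooth (F := e) hd2 e.contDiff.contDiffAt
  rw [ContinuousLinearEquiv.fderiv] at h3
  rw [← h3]
  refine Filter.EventuallyEq.extDeriv_eq ?_
  filter_upwards [hs.mem_nhds ha,
    (hΦa.of_le (by simp : (1 : WithTop ℕ∞) ≤ ∞)).eventually (by simp)] with x hx hx'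
  refine alternatingMap_one_ext fun v => ?_
  rw [compContinuousLinearMap_one, compContinuousLinearMap_one, ContinuousAlternatingMap.smul_apply,
    compContinuousLinearMap_one, expForm_apply, ContinuousLinearEquiv.fderiv]
  have h4 : (fderiv ℝ Φ x v).2 = (e v).2 := by
    have h5 : HasFDerivAt (fun x => (Φ x).2) _ x :=
      hasFDerivAt_snd.comp x (hx'.differentiableAt (by simp)).hasFDerivAt
    have h6 : HasFDerivAt (fun x => (Φ x).2)
        ((ContinuousLinearMap.snd ℝ ℝ Y).comp (e : G →L[ℝ] ℝ × Y)) x := by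
      simp only [hΦ2]
      exact hasFDerivAt_snd.comp x e.hasFDerivAt
    exact congrArg (fun T => T v) (h5.unique h6)
  show (Φ x).1 • θ (Φ x).2 ![(fderiv ℝ Φ x v).2] = Real.exp (e x).1 * θ₁ (e x).2 ![(e v).2]
  rw [h4, hΦ2, hfθ _ hx, hΦ]
  have := (hpos _ hx).ne'
  simp only [smul_eq_mul]
  field_simp

end Contact

section ReducedContact

variable {E : Type*} [NormedAddCommGroup E] [NormedSpace ℝ E] [FiniteDimensional ℝ E]
  {Y : Type*} [NormedAddCommGroup Y] [InnerProductSpace ℝ Y]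
  {h : E × (E →L[ℝ] ℝ) → ℝ} {ε : ℝ}
  {L : OpenPartialHomeomorph (ℝ × ℝ × ℝ × Y) (E × (E →L[ℝ] ℝ))}

/-- The contact form on the space of flow lines up to scale: the Liouville form restricted to the
slice of scale one. -/
noncomputable def reducedContactForm
    (L : OpenPartialHomeomorph (ℝ × ℝ × ℝ × Y) (E × (E →L[ℝ] ℝ))) (y : Y) : Y [⋀^Fin 1]→L[ℝ] ℝ :=
  (reducedForm L (0, y)).compContinuousLinearMap (ContinuousLinearMap.inr ℝ ℝ Y)

theorem IsFlowBox.contDiff_reducedContactForm (hL : IsFlowBox h ε L) :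
    ContDiff ℝ ∞ (reducedContactForm L) := by
  have h1 := contDiffOn_univ.1 (contDiffOn_pullback (V := Y) (F := fun y => ((0 : ℝ), y))
    isOpen_univ
    hL.contDiff_reducedForm.contDiffOn (by fun_prop) (mapsTo_univ _ _))
  have h2 : ∀ y : Y, fderiv ℝ (fun y => ((0 : ℝ), y)) y = ContinuousLinearMap.inr ℝ ℝ Y := fun y =>
    (hasFDerivAt_prodMk_right (0 : ℝ) y).fderiv
  simp only [h2] at h1
  exact h1

/-- The Liouville form on the space of flow lines is homogeneous under dilations. -/
theorem IsFlowBox.reducedForm_eq (hL : IsFlowBox h ε L) :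
    reducedForm L = expForm (reducedContactForm L) := by
  funext g
  refine alternatingMap_one_ext fun v => ?_
  have hS : ∀ g, levelSection L g = fiberScale (Real.exp g.1) (levelSection L (0, g.2)) := by
    intro g
    have := hL.scale (0, 0, 0, g.2) (hL.mem_source_iff.2 ⟨hL.zero_mem, hL.zero_mem⟩) g.1
    simp only [zero_add] at this
    exact this.symm
  have h1 : ∀ g, HasFDerivAt (levelSection L) (fderiv ℝ (levelSection L) g) g := fun g =>
    (hL.contDiff_levelSection.differentiable (by simp) g).hasFDerivAt
  -- the base point does not depend on the scale
  have h2 : HasFDerivAt (fun g => (levelSection L g).1) _ g := hasFDerivAt_fst.comp g (h1 g)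
  have h3 : HasFDerivAt (fun g => (levelSection L g).1)
      ((ContinuousLinearMap.fst ℝ E (E →L[ℝ] ℝ)).comp ((fderiv ℝ (levelSection L) (0, g.2)).comp
        ((ContinuousLinearMap.inr ℝ ℝ Y).comp (ContinuousLinearMap.snd ℝ ℝ Y)))) g := by
    have h4 : (fun g => (levelSection L g).1) = fun g => (levelSection L (0, g.2)).1 := by
      funext g; rw [hS]; rfl
    rw [h4]
    exact hasFDerivAt_fst.comp g (HasFDerivAt.comp (g := levelSection L) g (h1 (0, g.2))
      ((ContinuousLinearMap.inr ℝ ℝ Y).comp (ContinuousLinearMap.snd ℝ ℝ Y)).hasFDerivAt)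
  have h5 : (fderiv ℝ (levelSection L) g v).1 = (fderiv ℝ (levelSection L) (0, g.2) (0, v.2)).1 :=
    congrArg (fun T => T v) (h2.unique h3)
  rw [expForm_apply, reducedContactForm, compContinuousLinearMap_one, reducedForm, reducedForm,
    compContinuousLinearMap_one, compContinuousLinearMap_one, liouvilleForm_apply, h5, hS g]
  rfl

end ReducedContact

/-! ### The kinetic Hamiltonian of a metric on a vector space -/

section Kinetic

variable {E : Type*} [NormedAddCommGroup E] [NormedSpace ℝ E]

/-- The Hamiltonian `½ ξ(G_y⁻¹ ξ)` of a field `G` of bilinear forms on `E`. -/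
noncomputable def kineticHamiltonian (G : E → E →L[ℝ] E →L[ℝ] ℝ) (z : E × (E →L[ℝ] ℝ)) : ℝ :=
  1 / 2 * z.2 ((G z.1).inverse z.2)

/-- A smooth field of nondegenerate symmetric bilinear forms on an open subset of `E`. -/
structure IsMetricField (G : E → E →L[ℝ] E →L[ℝ] ℝ) (D : Set E) : Prop where
  isOpen : IsOpen D
  contDiffOn : ContDiffOn ℝ ∞ G D
  symm : ∀ y ∈ D, ∀ v w, G y v w = G y w v
  isInvertible : ∀ y ∈ D, (G y).IsInvertible

namespace IsMetricField

variable {G : E → E →L[ℝ] E →L[ℝ] ℝ} {D : Set E}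

theorem apply_inverse (hG : IsMetricField G D) {y : E} (hy : y ∈ D) (ξ : E →L[ℝ] ℝ) :
    G y ((G y).inverse ξ) = ξ :=
  (hG.isInvertible y hy).self_apply_inverse ξ

theorem inverse_apply (hG : IsMetricField G D) {y : E} (hy : y ∈ D) (v : E) :
    (G y).inverse (G y v) = v :=
  (hG.isInvertible y hy).inverse_apply_self v

theorem hasFDerivAt (hG : IsMetricField G D) {y : E} (hy : y ∈ D) :
    HasFDerivAt G (fderiv ℝ G y) y :=
  ((hG.contDiffOn.contDiffAt (hG.isOpen.mem_nhds hy)).differentiableAt (by simp)).hasFDerivAt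

theorem fderiv_apply₂ (hG : IsMetricField G D) {y : E} (hy : y ∈ D) (v w a : E) :
    fderiv ℝ (fun x => G x v w) y a = fderiv ℝ G y a v w := by
  have h1 : HasFDerivAt (fun x => G x v) ((fderiv ℝ G y).flip v) y := by
    simpa using! (hG.hasFDerivAt hy).clm_apply (hasFDerivAt_const v y)
  have h2 : HasFDerivAt (fun x => G x v w) (((fderiv ℝ G y).flip v).flip w) y := by
    simpa using! h1.clm_apply (hasFDerivAt_const w y)
  rw [h2.fderiv]; rfl

variable [FiniteDimensional ℝ E]

theorem isHomogeneousHamiltonian (hG : IsMetricField G D) :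
    IsHomogeneousHamiltonian (kineticHamiltonian G) (D ×ˢ univ) where
  isOpen := hG.isOpen.prod isOpen_univ
  scale_mem z hz c _ := ⟨hz.1, mem_univ _⟩
  contDiffOn := by
    have h1 : ContDiffOn ℝ ∞ (fun z : E × (E →L[ℝ] ℝ) => (G z.1).inverse) (D ×ˢ univ) := by
      intro z hz
      have h2 : ContDiffAt ℝ ∞ ContinuousLinearMap.inverse (G z.1) :=
        (hG.isInvertible z.1 hz.1).contDiffAt_map_inverse
      exact (h2.comp z ((hG.contDiffOn.contDiffAt (hG.isOpen.mem_nhds hz.1)).comp z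
        contDiffAt_fst)).contDiffWithinAt
    exact contDiffOn_const.mul (contDiffOn_snd.clm_apply (h1.clm_apply contDiffOn_snd))
  map_scale z _ c _ := by
    simp only [kineticHamiltonian, fiberScale_apply, map_smul, smul_apply, smul_eq_mul]
    ring

/-- The differential of the kinetic Hamiltonian, at the covector `G_y(u, ·)`. -/
theorem fderiv_kineticHamiltonian (hG : IsMetricField G D) {y : E} (hy : y ∈ D) (u a : E)
    (η : E →L[ℝ] ℝ) :
    fderiv ℝ (kineticHamiltonian G) (y, G y u) (a, η)
      = η u - 1 / 2 * fderiv ℝ G y a u u := by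
  -- differentiate `h(y, G_y v) = ½ G_y(v, v)`
  have hd : HasFDerivAt (fun p : E × E => G p.1 p.2)
      ((G y).comp (ContinuousLinearMap.snd ℝ E E)
        + ((fderiv ℝ G y).comp (ContinuousLinearMap.fst ℝ E E)).flip u) (y, u) := by
    have h1 : HasFDerivAt (fun p : E × E => G p.1)
        ((fderiv ℝ G y).comp (ContinuousLinearMap.fst ℝ E E)) (y, u) :=
      HasFDerivAt.comp (g := G) (f := Prod.fst) (y, u) (hG.hasFDerivAt hy)
        (hasFDerivAt_fst (𝕜 := ℝ) (E := E) (F := E) (p := (y, u)))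
    exact h1.clm_apply (hasFDerivAt_snd (p := (y, u)))
  have hd2 : HasFDerivAt (fun p : E × E => 1 / 2 * G p.1 p.2 p.2) _ (y, u) :=
    (hd.clm_apply (hasFDerivAt_snd (p := (y, u)))).const_mul (1 / 2)
  have hc : HasFDerivAt (fun p : E × E => kineticHamiltonian G (p.1, G p.1 p.2)) _ (y, u) :=
    HasFDerivAt.comp (g := kineticHamiltonian G) (y, u)
      (hG.isHomogeneousHamiltonian.hasFDerivAt (z := (y, G y u)) ⟨hy, mem_univ _⟩)
      (hasFDerivAt_fst.prodMk hd)
  have he : (fun p : E × E => kineticHamiltonian G (p.1, G p.1 p.2))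
      =ᶠ[𝓝 (y, u)] fun p : E × E => 1 / 2 * G p.1 p.2 p.2 := by
    filter_upwards [(hG.isOpen.prod isOpen_univ).mem_nhds ⟨hy, mem_univ u⟩] with p hp
    simp only [kineticHamiltonian, hG.inverse_apply hp.1]
  obtain ⟨b, hb⟩ : ∃ b, G y b = η - fderiv ℝ G y a u := ⟨_, hG.apply_inverse hy _⟩
  have key := congrArg (fun f => f (a, b)) ((hd2.congr_of_eventuallyEq he).unique hc)
  simp only [ContinuousLinearMap.comp_apply, ContinuousLinearMap.prod_apply,
    ContinuousLinearMap.coe_fst', ContinuousLinearMap.coe_snd', add_apply,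
    ContinuousLinearMap.flip_apply, smul_apply, smul_eq_mul] at key
  rw [hb, sub_add_cancel] at key
  rw [← key, hG.symm y hy u b, hb, sub_apply]
  ring

/-- Hamilton's equations for the kinetic Hamiltonian. -/
theorem hamVec_kineticHamiltonian (hG : IsMetricField G D) {y : E} (hy : y ∈ D) (u : E) :
    hamVec (kineticHamiltonian G) (y, G y u)
      = (u, (1 / 2 : ℝ) • ((fderiv ℝ G y).flip u).flip u) := by
  refine (eq_hamVec fun w => ?_).symm
  obtain ⟨a, η⟩ := w
  rw [hG.fderiv_kineticHamiltonian hy]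
  simp

theorem hamVec_fst_ne_zero (hG : IsMetricField G D) {z : E × (E →L[ℝ] ℝ)} (hz : z.1 ∈ D)
    (hz2 : z.2 ≠ 0) : (hamVec (kineticHamiltonian G) z).1 ≠ 0 := by
  obtain ⟨y, ξ⟩ := z
  have h1 := hG.hamVec_kineticHamiltonian hz ((G y).inverse ξ)
  rw [hG.apply_inverse hz] at h1
  intro h0
  rw [h1] at h0
  have h2 : G y ((G y).inverse ξ) = 0 := by
    rw [show (G y).inverse ξ = 0 from h0, map_zero]
  exact hz2 ((hG.apply_inverse hz ξ).symm.trans h2)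

/-- The geodesic equation, with lowered index, is Hamilton's equation for the momentum
`G_y(y', ·)`. -/
theorem hasDerivAt_momentum_iff (hG : IsMetricField G D) {y : ℝ → E} {t : ℝ} (hy : y t ∈ D)
    (hc : ContDiffAt ℝ 2 y t) :
    HasDerivAt (fun s => (y s, G (y s) (deriv y s)))
        (hamVec (kineticHamiltonian G) (y t, G (y t) (deriv y t))) t ↔
      ∀ w, G (y t) (deriv (deriv y) t) w
        + fderiv ℝ (fun z => G z (deriv y t) w) (y t) (deriv y t)
        - (1 / 2 : ℝ) * fderiv ℝ (fun z => G z (deriv y t) (deriv y t)) (y t) w = 0 := by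
  have h1 : HasDerivAt y (deriv y t) t := (hc.differentiableAt (by simp)).hasDerivAt
  have h2 : HasDerivAt (deriv y) (deriv (deriv y) t) t := by
    have h3 : ContDiffAt ℝ 1 (deriv y) t := by
      have h4 : ContDiffAt ℝ 1 (fderiv ℝ y) t := hc.fderiv_right (by norm_num)
      exact h4.clm_apply (contDiffAt_const (c := (1 : ℝ)))
    exact (h3.differentiableAt (by simp)).hasDerivAt
  have h3 : HasDerivAt (fun s => G (y s)) (fderiv ℝ G (y t) (deriv y t)) t :=
    HasFDerivAt.comp_hasDerivAt (l := G) t (hG.hasFDerivAt hy) h1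
  have h4 : HasDerivAt (fun s => (y s, G (y s) (deriv y s)))
      (deriv y t, fderiv ℝ G (y t) (deriv y t) (deriv y t) + G (y t) (deriv (deriv y) t)) t :=
    h1.prodMk (h3.clm_apply h2)
  rw [hG.hamVec_kineticHamiltonian hy]
  have h5 : HasDerivAt (fun s => (y s, G (y s) (deriv y s)))
      (deriv y t, (1 / 2 : ℝ) • ((fderiv ℝ G (y t)).flip (deriv y t)).flip (deriv y t)) t ↔
      fderiv ℝ G (y t) (deriv y t) (deriv y t) + G (y t) (deriv (deriv y) t)
        = (1 / 2 : ℝ) • ((fderiv ℝ G (y t)).flip (deriv y t)).flip (deriv y t) := by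
    refine ⟨fun h => (Prod.ext_iff.1 (h4.unique h)).2, fun h => ?_⟩
    rw [← h]; exact h4
  rw [h5, ContinuousLinearMap.ext_iff]
  refine forall_congr' fun w => ?_
  rw [hG.fderiv_apply₂ hy, hG.fderiv_apply₂ hy]
  simp only [add_apply, smul_apply, ContinuousLinearMap.flip_apply, smul_eq_mul]
  constructor <;> intro h <;> linarith

end IsMetricField

end Kinetic

/-! ### Charts of the cotangent bundle -/

section CotangentCharts

variable {n : ℕ} {M : Type*} [TopologicalSpace M] [ChartedSpace (Model n) M]
  [IsManifold (𝓡 (n + 2)) ∞ M]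

/-- The frame of the tangent space at `x` that is induced by the chart of `M` at `x₀`, as a map from
the model space. -/
noncomputable def coordFrame (x₀ x : M) : Model n →L[ℝ] TangentSpace (𝓡 (n + 2)) x :=
  (trivializationAt (Model n) (TangentSpace (𝓡 (n + 2))) x₀).symmL ℝ x

/-- The chart of the cotangent bundle at `σ₀`: it sends a covector to the coordinates of its base
point and its components in the coordinate frame. It depends only on the base point of `σ₀`. -/
noncomputable abbrev cotangentChart (σ₀ : CotangentBundle n M) :
    PartialEquiv (CotangentBundle n M) (Model n × (Model n →L[ℝ] ℝ)) :=
  extChartAt (cotangentModel n) σ₀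

theorem cotangentChart_apply (σ₀ σ : CotangentBundle n M) :
    cotangentChart σ₀ σ = (extChartAt (𝓡 (n + 2)) σ₀.proj σ.proj,
      (show TangentSpace (𝓡 (n + 2)) σ.proj →L[ℝ] ℝ from σ.snd).comp
        (coordFrame σ₀.proj σ.proj)) := by
  have h : cotangentChart σ₀ σ
    = (cotangentModel n) (chartAt (ModelProd (Model n) (Model n →L[ℝ] ℝ)) σ₀ σ) := rfl
  rw [h, hom_chart]
  refine Prod.ext rfl ?_
  ext v
  simp [ContinuousLinearMap.inCoordinates, coordFrame]

theorem mem_cotangentChart_source {σ₀ σ : CotangentBundle n M} :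
    σ ∈ (cotangentChart σ₀).source ↔ σ.proj ∈ (chartAt (Model n) σ₀.proj).source := by
  rw [cotangentChart, FiberBundle.extChartAt, PartialEquiv.trans_source]
  set e := trivializationAt (Model n →L[ℝ] ℝ)
    (fun x : M => TangentSpace (𝓡 (n + 2)) x →L[ℝ] Bundle.Trivial M ℝ x) σ₀.proj with he
  have hb : e.baseSet = (chartAt (Model n) σ₀.proj).source := by
    rw [he, hom_trivializationAt_baseSet]; simp
  constructor
  · intro h
    have := (Bundle.Trivialization.mem_source _).1 h.1
    rwa [hb] at this
  · intro h
    refine ⟨(Bundle.Trivialization.mem_source _).2 (by rwa [hb]), ?_⟩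
    refine ⟨?_, mem_univ _⟩
    rw [extChartAt_source]
    have := Bundle.Trivialization.coe_fst' e (x := σ) (by rwa [hb])
    change (e σ).1 ∈ _
    rwa [this]

theorem cotangentChart_target (σ₀ : CotangentBundle n M) :
    (cotangentChart σ₀).target = (extChartAt (𝓡 (n + 2)) σ₀.proj).target ×ˢ univ := by
  rw [cotangentChart, FiberBundle.extChartAt_target, hom_trivializationAt_baseSet]
  congr 1
  simp only [TangentBundle.trivializationAt_baseSet]
  rw [inter_eq_left]
  intro y hy
  have := (extChartAt (𝓡 (n + 2)) σ₀.proj).map_target hy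
  rw [extChartAt_source] at this
  simpa using this

/-- The differential at `x` of the chart of `M` at `x₀`, with values in the model space; it is the
inverse of `coordFrame x₀ x` for `x` in the domain of the chart. -/
noncomputable def coordDiff (x₀ x : M) : TangentSpace (𝓡 (n + 2)) x →L[ℝ] Model n :=
  mfderiv (𝓡 (n + 2)) (𝓡 (n + 2)) (extChartAt (𝓡 (n + 2)) x₀) x

theorem coordDiff_eq {x₀ x : M} (hx : x ∈ (chartAt (Model n) x₀).source) :
    coordDiff x₀ x =
      (trivializationAt (Model n) (TangentSpace (𝓡 (n + 2))) x₀).continuousLinearMapAt ℝ x :=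
  (TangentBundle.continuousLinearMapAt_trivializationAt hx).symm

theorem coordFrame_coordDiff {x₀ x : M} (hx : x ∈ (chartAt (Model n) x₀).source)
    (v : TangentSpace (𝓡 (n + 2)) x) :
    coordFrame x₀ x (coordDiff x₀ x v) = v := by
  rw [coordDiff_eq hx]
  exact Bundle.Trivialization.symmL_continuousLinearMapAt _ (by simpa using hx) v

theorem coordDiff_coordFrame {x₀ x : M} (hx : x ∈ (chartAt (Model n) x₀).source) (v : Model n) :
    coordDiff x₀ x (coordFrame x₀ x v) = v := by
  rw [coordDiff_eq hx]
  exact Bundle.Trivialization.continuousLinearMapAt_symmL _ (by simpa using hx) v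

theorem coordFrame_eq {x₀ : M} {y : Model n} (hy : y ∈ (extChartAt (𝓡 (n + 2)) x₀).target) :
    coordFrame x₀ ((extChartAt (𝓡 (n + 2)) x₀).symm y) =
      mfderiv (𝓡 (n + 2)) (𝓡 (n + 2)) (extChartAt (𝓡 (n + 2)) x₀).symm y := by
  have h := (extChartAt (𝓡 (n + 2)) x₀).map_target hy
  rw [extChartAt_source] at h
  rw [coordFrame, TangentBundle.symmL_trivializationAt h, (extChartAt (𝓡 (n + 2)) x₀).right_inv hy,
    ModelWithCorners.range_eq_univ, mfderivWithin_univ]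

/-- The metric in the chart at `x₀`: the field of bilinear forms on the model space with the
components of `g` in the coordinate frame. -/
noncomputable def LorentzianMetric.coordForm (g : LorentzianMetric n M) (x₀ : M) (y : Model n) :
    Model n →L[ℝ] Model n →L[ℝ] ℝ :=
  (ContinuousLinearMap.precomp ℝ (coordFrame x₀ ((extChartAt (𝓡 (n + 2)) x₀).symm y))).comp
    ((g.form ((extChartAt (𝓡 (n + 2)) x₀).symm y)).comp
      (coordFrame x₀ ((extChartAt (𝓡 (n + 2)) x₀).symm y)))

theorem LorentzianMetric.coordForm_apply (g : LorentzianMetric n M) (x₀ : M) (y v w : Model n) :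
    g.coordForm x₀ y v w = g.form ((extChartAt (𝓡 (n + 2)) x₀).symm y)
      (coordFrame x₀ ((extChartAt (𝓡 (n + 2)) x₀).symm y) v)
      (coordFrame x₀ ((extChartAt (𝓡 (n + 2)) x₀).symm y) w) := rfl

theorem LorentzianMetric.contDiffOn_coordForm (g : LorentzianMetric n M) (x₀ : M) :
    ContDiffOn ℝ ∞ (g.coordForm x₀) (extChartAt (𝓡 (n + 2)) x₀).target := by
  have h1 := g.contMDiff.contMDiffOn (s := (chartAt (Model n) x₀).source)
  let e := trivializationAt (Model n →L[ℝ] Model n →L[ℝ] ℝ)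
    (fun x : M => TangentSpace (𝓡 (n + 2)) x →L[ℝ] TangentSpace (𝓡 (n + 2)) x →L[ℝ] ℝ) x₀
  have hb : e.baseSet = (chartAt (Model n) x₀).source := by
    rw [show e = _ from rfl, hom_trivializationAt_baseSet, hom_trivializationAt_baseSet]; simp
  have h2 := (Bundle.Trivialization.contMDiffOn_section_iff (e := e) (IB := 𝓡 (n + 2)) (n := ∞)
    (s := g.form) (a := (chartAt (Model n) x₀).source)
    (chartAt (Model n) x₀).open_source hb.ge).1 h1
  have h3 := contMDiffOn_iff_contDiffOn.1 (h2.comp (contMDiffOn_extChartAt_symm x₀) (fun y hy => by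
    have := (extChartAt (𝓡 (n + 2)) x₀).map_target hy
    rwa [extChartAt_source] at this))
  refine h3.congr fun y hy => ?_
  have hs := (extChartAt (𝓡 (n + 2)) x₀).map_target hy
  rw [extChartAt_source] at hs
  simp only [Function.comp_apply]
  rw [hom_trivializationAt_apply]
  ext v w
  rw [inCoordinates_apply_eq₂]
  · have ht : (trivializationAt ℝ (Bundle.Trivial M ℝ) x₀).linearMapAt ℝ
        ((extChartAt (𝓡 (n + 2)) x₀).symm y) = LinearMap.id :=
      Bundle.Trivial.linearMapAt_trivialization ℝ M ℝ _
    have hA : ∀ v, (trivializationAt (Model n) (TangentSpace (𝓡 (n + 2))) x₀).symm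
        ((extChartAt (𝓡 (n + 2)) x₀).symm y) v = coordFrame x₀ _ v := fun v =>
      ((trivializationAt (Model n) (TangentSpace (𝓡 (n + 2))) x₀).symmL_apply (R := ℝ)
        (by simpa using hs) v).symm
    dsimp only
    rw [hA, hA]
    exact (congrArg (fun f : ℝ →ₗ[ℝ] ℝ => f _) ht).symm
  · simpa using hs
  · simpa using hs
  · simp

theorem LorentzianMetric.form_injective (g : LorentzianMetric n M) (x : M)
    {u : TangentSpace (𝓡 (n + 2)) x} (hu : ∀ w, g.form x u w = 0) : u = 0 := by
  obtain ⟨ε, -, v, -, hv⟩ := g.lorentz x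
  by_contra hne
  have := hv u (by rw [g.symm]; exact hu v) hne
  rw [hu u] at this
  simp at this

theorem LorentzianMetric.isMetricField_coordForm (g : LorentzianMetric n M) (x₀ : M) :
    IsMetricField (g.coordForm x₀) (extChartAt (𝓡 (n + 2)) x₀).target where
  isOpen := isOpen_extChartAt_target x₀
  contDiffOn := g.contDiffOn_coordForm x₀
  symm y _ v w := by rw [coordForm_apply, coordForm_apply, g.symm]
  isInvertible y hy := by
    have hs := (extChartAt (𝓡 (n + 2)) x₀).map_target hy
    rw [extChartAt_source] at hs
    have hinj : Function.Injective (g.coordForm x₀ y) := by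
      rw [injective_iff_map_eq_zero]
      intro u hu
      have h1 : coordFrame x₀ ((extChartAt (𝓡 (n + 2)) x₀).symm y) u = 0 := by
        refine g.form_injective _ fun w => ?_
        rw [← coordFrame_coordDiff hs w, ← coordForm_apply, hu]; rfl
      rw [← coordDiff_coordFrame hs u, h1, map_zero]
    exact ⟨(LinearMap.linearEquivOfInjective (g.coordForm x₀ y).toLinearMap hinj
      (finrank_continuousDual _).symm).toContinuousLinearEquiv, by ext; rfl⟩

/-- The inverse metric is computed in the coordinate frame. -/
theorem LorentzianMetric.inverse_form (g : LorentzianMetric n M) {x₀ x : M}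
    (hx : x ∈ (chartAt (Model n) x₀).source) :
    (g.form x).inverse = (coordFrame x₀ x).comp
      ((g.coordForm x₀ (extChartAt (𝓡 (n + 2)) x₀ x)).inverse.comp
        (ContinuousLinearMap.precomp ℝ (coordFrame x₀ x))) := by
  have hx' : x ∈ (extChartAt (𝓡 (n + 2)) x₀).source := by rwa [extChartAt_source]
  have hG := g.isMetricField_coordForm x₀
  have hy := (extChartAt (𝓡 (n + 2)) x₀).map_source hx'
  have hl := (extChartAt (𝓡 (n + 2)) x₀).left_inv hx'
  have hGa : ∀ v w, g.coordForm x₀ (extChartAt (𝓡 (n + 2)) x₀ x) v w =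
      g.form x (coordFrame x₀ x v) (coordFrame x₀ x w) := by
    intro v w
    rw [coordForm_apply, hl]
  apply ContinuousLinearMap.inverse_eq
  · ext p w
    rw [← coordFrame_coordDiff hx w]
    simp only [ContinuousLinearMap.comp_apply]
    rw [← hGa, hG.apply_inverse hy]
    rfl
  · ext v
    simp only [ContinuousLinearMap.comp_apply]
    have : ContinuousLinearMap.precomp ℝ (coordFrame x₀ x) (g.form x v) =
        g.coordForm x₀ (extChartAt (𝓡 (n + 2)) x₀ x) (coordDiff x₀ x v) := by
      ext w
      rw [hGa, coordFrame_coordDiff hx]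
      rfl
    rw [this, hG.inverse_apply hy, coordFrame_coordDiff hx]
    rfl

theorem cotangentChart_dilate (σ₀ : CotangentBundle n M) (c : ℝ) (σ : CotangentBundle n M) :
    cotangentChart σ₀ (dilate c σ) = fiberScale c (cotangentChart σ₀ σ) := by
  rw [cotangentChart_apply, cotangentChart_apply]
  rfl

theorem LorentzianMetric.hamiltonian_eq (g : LorentzianMetric n M) {σ₀ σ : CotangentBundle n M}
    (hσ : σ ∈ (cotangentChart σ₀).source) :
    g.hamiltonian σ = kineticHamiltonian (g.coordForm σ₀.proj) (cotangentChart σ₀ σ) := by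
  rw [hamiltonian, g.inverse_form (mem_cotangentChart_source.1 hσ), cotangentChart_apply]
  rfl

/-- The differential of a chart of the cotangent bundle, with values in the model space. -/
noncomputable def cotangentDiff (σ₀ σ : CotangentBundle n M) :
    TangentSpace (cotangentModel n) σ →L[ℝ] Model n × (Model n →L[ℝ] ℝ) :=
  mfderiv (cotangentModel n) 𝓘(ℝ, Model n × (Model n →L[ℝ] ℝ)) (cotangentChart σ₀) σ

theorem hasMFDerivAt_cotangentChart {σ₀ σ : CotangentBundle n M}
    (hσ : σ ∈ (cotangentChart σ₀).source) :
    HasMFDerivAt (cotangentModel n) 𝓘(ℝ, Model n × (Model n →L[ℝ] ℝ)) (cotangentChart σ₀) σ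
      (cotangentDiff σ₀ σ) := by
  rw [cotangentChart, extChartAt_source] at hσ
  exact (mdifferentiableAt_extChartAt hσ).hasMFDerivAt

theorem bijective_cotangentDiff {σ₀ σ : CotangentBundle n M}
    (hσ : σ ∈ (cotangentChart σ₀).source) : Function.Bijective (cotangentDiff σ₀ σ) :=
  (isInvertible_mfderiv_extChartAt hσ).bijective

theorem cotangentDiff_fst {σ₀ σ : CotangentBundle n M} (hσ : σ ∈ (cotangentChart σ₀).source)
    (v : TangentSpace (cotangentModel n) σ) :
    (cotangentDiff σ₀ σ v).1 = coordDiff σ₀.proj σ.proj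
      (mfderiv (cotangentModel n) (𝓡 (n + 2))
        (Bundle.TotalSpace.proj : CotangentBundle n M → M) σ v) := by
  have h1 : HasMFDerivAt (cotangentModel n) 𝓘(ℝ, Model n) (fun τ => (cotangentChart σ₀ τ).1) σ
      ((ContinuousLinearMap.fst ℝ (Model n) (Model n →L[ℝ] ℝ)).comp (cotangentDiff σ₀ σ)) :=
    HasMFDerivAt.comp (g := Prod.fst) σ (hasFDerivAt_fst.hasMFDerivAt)
      (hasMFDerivAt_cotangentChart hσ)
  have h2 : HasMFDerivAt (cotangentModel n) 𝓘(ℝ, Model n) (fun τ => (cotangentChart σ₀ τ).1) σ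
      ((coordDiff σ₀.proj σ.proj).comp (mfderiv (cotangentModel n) (𝓡 (n + 2))
        (Bundle.TotalSpace.proj : CotangentBundle n M → M) σ)) := by
    have h3 : (fun τ => (cotangentChart σ₀ τ).1) = (extChartAt (𝓡 (n + 2)) σ₀.proj) ∘
        (Bundle.TotalSpace.proj : CotangentBundle n M → M) := by
      funext τ; rw [cotangentChart_apply]; rfl
    rw [h3]
    refine HasMFDerivAt.comp σ ?_ ?_
    · exact (mdifferentiableAt_extChartAt (mem_cotangentChart_source.1 hσ)).hasMFDerivAt
    · exact ((Bundle.contMDiff_proj (n := ∞) _ σ).mdifferentiableAt (by simp)).hasMFDerivAt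
  exact congrArg (fun f => f v) (hasMFDerivAt_unique h1 h2)

theorem tautologicalForm_eq {σ₀ σ : CotangentBundle n M} (hσ : σ ∈ (cotangentChart σ₀).source)
    (v : TangentSpace (cotangentModel n) σ) :
    tautologicalForm n M σ ![v] = liouvilleForm (cotangentChart σ₀ σ) ![cotangentDiff σ₀ σ v] := by
  rw [liouvilleForm_apply, cotangentDiff_fst hσ, cotangentChart_apply]
  change _ = (show TangentSpace (𝓡 (n + 2)) σ.proj →L[ℝ] ℝ from σ.snd) (coordFrame σ₀.proj σ.proj _)
  rw [coordFrame_coordDiff (mem_cotangentChart_source.1 hσ)]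
  rfl

theorem chartRep_tautologicalForm (σ₀ : CotangentBundle n M) {z : Model n × (Model n →L[ℝ] ℝ)}
    (hz : z ∈ (cotangentChart σ₀).target) :
    DiffForm.chartRep (cotangentModel n) (tautologicalForm n M) σ₀ z = liouvilleForm z := by
  apply alternatingMap_one_ext
  intro v
  refine (compContinuousLinearMap_one _ _).trans ?_
  refine (tautologicalForm_eq ((cotangentChart σ₀).map_target hz) _).trans ?_
  rw [(cotangentChart σ₀).right_inv hz]
  exact congrArg (fun w => liouvilleForm z ![w]) (congrArg (fun f => f v)
    (mfderiv_extChartAt_comp_mfderivWithin_extChartAt_symm hz))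

theorem canonicalForm_eq_self (σ : CotangentBundle n M) (v w : TangentSpace (cotangentModel n) σ) :
    canonicalForm n M σ ![v, w] = symplecticFlat (cotangentDiff σ σ v) (cotangentDiff σ σ w) := by
  have h : extDerivWithin (DiffForm.chartRep (cotangentModel n) (tautologicalForm n M) σ)
      (range (cotangentModel n)) (cotangentChart σ σ)
        = extDeriv liouvilleForm (cotangentChart σ σ) := by
    rw [ModelWithCorners.range_eq_univ, extDerivWithin_univ]
    apply Filter.EventuallyEq.extDeriv_eq
    filter_upwards [(isOpen_extChartAt_target σ).mem_nhds (mem_extChartAt_target σ)] with z hz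
      using chartRep_tautologicalForm σ hz
  rw [canonicalForm, DiffForm.d, h]
  exact (compContinuousLinearMap_two _ _ _).trans (extDeriv_liouvilleForm _ _ _)

/-- The canonical symplectic form is standard in every chart. By definition it is computed in the
preferred chart at each point; transition maps between charts preserve the Liouville form, hence its
exterior derivative. -/
theorem canonicalForm_eq {σ₀ σ : CotangentBundle n M} (hσ : σ ∈ (cotangentChart σ₀).source)
    (v w : TangentSpace (cotangentModel n) σ) :
    canonicalForm n M σ ![v, w]
      = symplecticFlat (cotangentDiff σ₀ σ v) (cotangentDiff σ₀ σ w) := by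
  set T : Model n × (Model n →L[ℝ] ℝ) → Model n × (Model n →L[ℝ] ℝ) :=
    cotangentChart σ₀ ∘ (cotangentChart σ).symm with hT
  set z := cotangentChart σ σ with hz
  have hσσ : σ ∈ (cotangentChart σ).source := mem_extChartAt_source σ
  have hzt : z ∈ (cotangentChart σ).target := (cotangentChart σ).map_source hσσ
  -- the domain of the transition map
  set S := ((cotangentChart σ).symm.trans (cotangentChart σ₀)).source with hS
  have hSo : IsOpen S := by
    rw [hS, PartialEquiv.trans_source, PartialEquiv.symm_source]
    exact (continuousOn_extChartAt_symm σ).isOpen_inter_preimage (isOpen_extChartAt_target σ)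
      (isOpen_extChartAt_source σ₀)
  have hzS : z ∈ S := by
    refine ⟨hzt, ?_⟩
    change (cotangentChart σ).symm z ∈ (cotangentChart σ₀).source
    rw [hz, (cotangentChart σ).left_inv hσσ]; exact hσ
  have hTs : ContDiffOn ℝ ∞ T S :=
    contDiffOn_ext_coord_change (I := cotangentModel n) (n := ∞) σ₀ σ
  have hdiff : ∀ z' ∈ S, ∀ u : TangentSpace (cotangentModel n) ((cotangentChart σ).symm z'),
      fderiv ℝ T z' (cotangentDiff σ _ u) = cotangentDiff σ₀ _ u := by
    intro z' hz' u
    have h1 := hasMFDerivAt_cotangentChart hz'.2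
    have hs := (cotangentChart σ).map_target hz'.1
    have h2 : HasMFDerivAt (cotangentModel n) 𝓘(ℝ, Model n × (Model n →L[ℝ] ℝ))
        (T ∘ cotangentChart σ) ((cotangentChart σ).symm z')
        ((fderiv ℝ T z').comp (cotangentDiff σ ((cotangentChart σ).symm z'))) := by
      refine HasMFDerivAt.comp _ ?_ (hasMFDerivAt_cotangentChart hs)
      rw [(cotangentChart σ).right_inv hz'.1]
      exact ((hTs.contDiffAt (hSo.mem_nhds hz')).differentiableAt
        (by simp)).hasFDerivAt.hasMFDerivAt
    have h3 : T ∘ cotangentChart σ =ᶠ[𝓝 ((cotangentChart σ).symm z')] cotangentChart σ₀ := by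
      filter_upwards [(isOpen_extChartAt_source σ).mem_nhds hs] with τ hτ
      simp only [hT, Function.comp_apply, (cotangentChart σ).left_inv hτ]
    exact congrArg (fun f => f u) (hasMFDerivAt_unique h2 (h1.congr_of_eventuallyEq h3))
  -- transition maps preserve the Liouville form
  have hpull : ∀ z' ∈ S,
      (liouvilleForm (T z')).compContinuousLinearMap (fderiv ℝ T z') = liouvilleForm z' := by
    intro z' hz'
    refine alternatingMap_one_ext fun w' => ?_
    have hs := (cotangentChart σ).map_target hz'.1
    obtain ⟨u, rfl⟩ := (bijective_cotangentDiff hs).2 w'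
    rw [compContinuousLinearMap_one, hdiff z' hz', hT, Function.comp_apply,
      ← tautologicalForm_eq (σ₀ := σ₀) (σ := (cotangentChart σ).symm z') hz'.2]
    have := tautologicalForm_eq hs u
    rwa [(cotangentChart σ).right_inv hz'.1] at this
  have hext : extDeriv liouvilleForm z
      = (extDeriv liouvilleForm (T z)).compContinuousLinearMap (fderiv ℝ T z) := by
    rw [← extDeriv_pullback_smooth (contDiff_liouvilleForm.differentiable (by simp) _)
      (hTs.contDiffAt (hSo.mem_nhds hzS))]
    refine (Filter.EventuallyEq.extDeriv_eq ?_).symm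
    filter_upwards [hSo.mem_nhds hzS] with z' hz' using hpull z' hz'
  have hu : ∀ u : TangentSpace (cotangentModel n) σ,
      fderiv ℝ T z (cotangentDiff σ σ u) = cotangentDiff σ₀ σ u := by
    intro u
    have h := hdiff z hzS
    rw [hz, (cotangentChart σ).left_inv hσσ] at h
    exact h u
  rw [canonicalForm_eq_self, ← extDeriv_liouvilleForm z, hext, compContinuousLinearMap_two, hu, hu,
    extDeriv_liouvilleForm]

namespace LorentzianMetric

variable (g : LorentzianMetric n M)

/-- The Hamiltonian in the chart of the cotangent bundle at `σ₀`. -/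
noncomputable def coordHamiltonian (σ₀ : CotangentBundle n M) :
    Model n × (Model n →L[ℝ] ℝ) → ℝ :=
  kineticHamiltonian (g.coordForm σ₀.proj)

theorem isHomogeneousHamiltonian_coordHamiltonian (σ₀ : CotangentBundle n M) :
    IsHomogeneousHamiltonian (g.coordHamiltonian σ₀) (cotangentChart σ₀).target := by
  rw [cotangentChart_target]
  exact (g.isMetricField_coordForm σ₀.proj).isHomogeneousHamiltonian

theorem dHamiltonian_eq {σ₀ σ : CotangentBundle n M} (hσ : σ ∈ (cotangentChart σ₀).source)
    (v : TangentSpace (cotangentModel n) σ) :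
    g.dHamiltonian σ v
      = fderiv ℝ (g.coordHamiltonian σ₀) (cotangentChart σ₀ σ) (cotangentDiff σ₀ σ v) := by
  have h1 : HasMFDerivAt (cotangentModel n) 𝓘(ℝ, ℝ) (g.coordHamiltonian σ₀ ∘ cotangentChart σ₀) σ
      ((fderiv ℝ (g.coordHamiltonian σ₀) (cotangentChart σ₀ σ)).comp (cotangentDiff σ₀ σ)) :=
    HasMFDerivAt.comp σ ((g.isHomogeneousHamiltonian_coordHamiltonian σ₀).hasFDerivAt
      ((cotangentChart σ₀).map_source hσ)).hasMFDerivAt (hasMFDerivAt_cotangentChart hσ)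
  have h2 : g.hamiltonian =ᶠ[𝓝 σ] g.coordHamiltonian σ₀ ∘ cotangentChart σ₀ := by
    filter_upwards [(isOpen_extChartAt_source σ₀).mem_nhds hσ] with τ hτ
      using g.hamiltonian_eq hτ
  exact congrArg (fun f => f v) (h1.congr_of_eventuallyEq h2).mfderiv

/-- In a chart, `X_H` is the Hamiltonian field of the local Hamiltonian. In particular the vector
selected in the definition of `X_H` satisfies the defining equation. -/
theorem cotangentDiff_hamiltonianField {σ₀ σ : CotangentBundle n M}
    (hσ : σ ∈ (cotangentChart σ₀).source) :
    cotangentDiff σ₀ σ (g.hamiltonianField σ)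
      = hamVec (g.coordHamiltonian σ₀) (cotangentChart σ₀ σ) := by
  obtain ⟨X, hX⟩ := (bijective_cotangentDiff hσ).2
    (hamVec (g.coordHamiltonian σ₀) (cotangentChart σ₀ σ))
  have hex : ∃ X : TangentSpace (cotangentModel n) σ, ∀ Y : TangentSpace (cotangentModel n) σ,
      canonicalForm n M σ ![X, Y] = -(g.dHamiltonian σ Y) := by
    refine ⟨X, fun Y => ?_⟩
    rw [canonicalForm_eq hσ, hX, symplecticFlat_hamVec, g.dHamiltonian_eq hσ]
    rfl
  refine eq_hamVec fun w => ?_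
  obtain ⟨Y, rfl⟩ := (bijective_cotangentDiff hσ).2 w
  rw [← canonicalForm_eq hσ, ← g.dHamiltonian_eq hσ]
  exact Classical.epsilon_spec hex Y

end LorentzianMetric

end CotangentCharts

/-! ### Geodesics and the Hamiltonian flow -/

section Geodesics

variable {n : ℕ} {M : Type*} [TopologicalSpace M] [ChartedSpace (Model n) M]
  [IsManifold (𝓡 (n + 2)) ∞ M]

namespace LorentzianMetric

variable (g : LorentzianMetric n M)

/-- In a chart, integral curves of `X_H` solve Hamilton's equations. -/
theorem hasDerivAt_of_hasMFDerivAt {σ₀ : CotangentBundle n M} {c : ℝ → CotangentBundle n M}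
    {t : ℝ} (h1 : HasMFDerivAt 𝓘(ℝ, ℝ) (cotangentModel n) c t
      ((1 : ℝ →L[ℝ] ℝ).smulRight (g.hamiltonianField (c t))))
    (hct : c t ∈ (cotangentChart σ₀).source) :
    HasDerivAt (fun s => cotangentChart σ₀ (c s))
      (hamVec (g.coordHamiltonian σ₀) (cotangentChart σ₀ (c t))) t := by
  have h2 := HasMFDerivAt.comp t (hasMFDerivAt_cotangentChart hct) h1
  have h3 : (show ℝ →L[ℝ] Model n × (Model n →L[ℝ] ℝ) from (cotangentDiff σ₀ (c t)).comp
      ((1 : ℝ →L[ℝ] ℝ).smulRight (g.hamiltonianField (c t)))) 1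
      = hamVec (g.coordHamiltonian σ₀) (cotangentChart σ₀ (c t)) := by
    rw [← g.cotangentDiff_hamiltonianField hct]
    change cotangentDiff σ₀ (c t) ((1 : ℝ) • g.hamiltonianField (c t)) = _
    rw [one_smul]
  rw [← h3]
  exact (show HasFDerivAt (fun s => cotangentChart σ₀ (c s))
    (show ℝ →L[ℝ] Model n × (Model n →L[ℝ] ℝ) from (cotangentDiff σ₀ (c t)).comp
      ((1 : ℝ →L[ℝ] ℝ).smulRight (g.hamiltonianField (c t)))) t from h2.hasFDerivAt).hasDerivAt

theorem hasMFDerivAt_of_hasDerivAt {σ₀ : CotangentBundle n M}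
    {ζ : ℝ → Model n × (Model n →L[ℝ] ℝ)} {t : ℝ} (hz : ζ t ∈ (cotangentChart σ₀).target)
    (hζ : HasDerivAt ζ (hamVec (g.coordHamiltonian σ₀) (ζ t)) t) :
    HasMFDerivAt 𝓘(ℝ, ℝ) (cotangentModel n) (fun s => (cotangentChart σ₀).symm (ζ s)) t
      ((1 : ℝ →L[ℝ] ℝ).smulRight (g.hamiltonianField ((cotangentChart σ₀).symm (ζ t)))) := by
  have hs := (cotangentChart σ₀).map_target hz
  have h0 : MDifferentiableAt 𝓘(ℝ, Model n × (Model n →L[ℝ] ℝ)) (cotangentModel n)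
      (cotangentChart σ₀).symm (ζ t) := by
    have := mdifferentiableWithinAt_extChartAt_symm (I := cotangentModel n) hz
    rwa [ModelWithCorners.range_eq_univ, mdifferentiableWithinAt_univ] at this
  have h1 : HasMFDerivAt 𝓘(ℝ, ℝ) (cotangentModel n) (fun t => (cotangentChart σ₀).symm (ζ t)) t _ :=
    HasMFDerivAt.comp t h0.hasMFDerivAt hζ.hasFDerivAt.hasMFDerivAt
  refine h1.congr_mfderiv (ContinuousLinearMap.ext fun (r : ℝ) => ?_)
  apply (bijective_cotangentDiff hs).1
  have h2 := mfderiv_extChartAt_comp_mfderivWithin_extChartAt_symm hz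
  rw [ModelWithCorners.range_eq_univ, mfderivWithin_univ] at h2
  have h3 := congrArg (fun f => f (r • hamVec (g.coordHamiltonian σ₀) (ζ t))) h2
  refine Eq.trans h3 ?_
  change r • hamVec (g.coordHamiltonian σ₀) (ζ t)
    = cotangentDiff σ₀ _ (r • g.hamiltonianField ((cotangentChart σ₀).symm (ζ t)))
  rw [map_smul, g.cotangentDiff_hamiltonianField hs, (cotangentChart σ₀).right_inv hz]

/-- Being tangent to `X_H` at a time only depends on the germ of the curve. -/
theorem hasMFDerivAt_hamiltonianField_congr {c c' : ℝ → CotangentBundle n M} {t : ℝ}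
    (hc : HasMFDerivAt 𝓘(ℝ, ℝ) (cotangentModel n) c t
      ((1 : ℝ →L[ℝ] ℝ).smulRight (g.hamiltonianField (c t)))) (h : c' =ᶠ[𝓝 t] c) :
    HasMFDerivAt 𝓘(ℝ, ℝ) (cotangentModel n) c' t
      ((1 : ℝ →L[ℝ] ℝ).smulRight (g.hamiltonianField (c' t))) :=
  (hc.congr_of_eventuallyEq h).congr_mfderiv (congrArg (fun σ => (1 : ℝ →L[ℝ] ℝ).smulRight
    (show Model n × (Model n →L[ℝ] ℝ) from g.hamiltonianField σ)) h.eq_of_nhds.symm)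

theorem chartCoeff_eq (x₀ : M) {y : Model n} (hy : y ∈ (extChartAt (𝓡 (n + 2)) x₀).target)
    (v w : Model n) :
    g.chartCoeff x₀ y v w = g.coordForm x₀ y v w := by
  rw [chartCoeff, coordForm_apply, coordFrame_eq hy]
  rfl

theorem cotangentChart_covelocity {σ₀ : CotangentBundle n M} {γ : ℝ → M} {t : ℝ}
    (hγ : MDifferentiableAt 𝓘(ℝ, ℝ) (𝓡 (n + 2)) γ t)
    (ht : γ t ∈ (chartAt (Model n) σ₀.proj).source) :
    cotangentChart σ₀ (g.covelocity γ t) = (extChartAt (𝓡 (n + 2)) σ₀.proj (γ t),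
      g.coordForm σ₀.proj (extChartAt (𝓡 (n + 2)) σ₀.proj (γ t))
        (deriv (fun s => extChartAt (𝓡 (n + 2)) σ₀.proj (γ s)) t)) := by
  have hx : γ t ∈ (extChartAt (𝓡 (n + 2)) σ₀.proj).source := by rwa [extChartAt_source]
  have h1 : HasMFDerivAt 𝓘(ℝ, ℝ) 𝓘(ℝ, Model n) (fun s => extChartAt (𝓡 (n + 2)) σ₀.proj (γ s)) t
      ((coordDiff σ₀.proj (γ t)).comp (mfderiv 𝓘(ℝ, ℝ) (𝓡 (n + 2)) γ t)) :=
    HasMFDerivAt.comp t (mdifferentiableAt_extChartAt ht).hasMFDerivAt hγ.hasMFDerivAt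
  have h2 : deriv (fun s => extChartAt (𝓡 (n + 2)) σ₀.proj (γ s)) t
      = coordDiff σ₀.proj (γ t) (mfderiv 𝓘(ℝ, ℝ) (𝓡 (n + 2)) γ t (1 : ℝ)) := by
    rw [← fderiv_apply_one_eq_deriv]
    exact congrArg (fun f : ℝ →L[ℝ] Model n => f 1) (HasFDerivAt.fderiv
      (f := fun s => extChartAt (𝓡 (n + 2)) σ₀.proj (γ s)) (𝕜 := ℝ) (E := ℝ)
      (F := Model n) h1.hasFDerivAt)
  rw [cotangentChart_apply, h2]
  refine Prod.ext rfl ?_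
  ext w
  change g.form (γ t) (mfderiv 𝓘(ℝ, ℝ) (𝓡 (n + 2)) γ t (1 : ℝ)) (coordFrame σ₀.proj (γ t) w) = _
  rw [coordForm_apply, (extChartAt (𝓡 (n + 2)) σ₀.proj).left_inv hx, coordFrame_coordDiff ht]

/-- A smooth curve is a geodesic exactly if its velocity covector is an integral curve of `X_H`: in
the chart at the point in question the geodesic equation is Hamilton's equation for the momentum. -/
theorem isGeodesicOn_iff {γ : ℝ → M} {T : Set ℝ} (hT : IsOpen T)
    (hγ : ContMDiffOn 𝓘(ℝ, ℝ) (𝓡 (n + 2)) ∞ γ T) :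
    g.IsGeodesicOn γ T ↔
      IsMIntegralCurveOn (I := cotangentModel n) (g.covelocity γ) g.hamiltonianField T := by
  have key : ∀ t ∈ T, (∀ w : Model n,
      g.chartCoeff (γ t) (extChartAt (𝓡 (n + 2)) (γ t) (γ t))
          (deriv (deriv fun s => extChartAt (𝓡 (n + 2)) (γ t) (γ s)) t) w
        + fderiv ℝ (fun z => g.chartCoeff (γ t) z
            (deriv (fun s => extChartAt (𝓡 (n + 2)) (γ t) (γ s)) t) w)
            (extChartAt (𝓡 (n + 2)) (γ t) (γ t))
            (deriv (fun s => extChartAt (𝓡 (n + 2)) (γ t) (γ s)) t)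
        - (1 / 2 : ℝ) * fderiv ℝ (fun z => g.chartCoeff (γ t) z
            (deriv (fun s => extChartAt (𝓡 (n + 2)) (γ t) (γ s)) t)
            (deriv (fun s => extChartAt (𝓡 (n + 2)) (γ t) (γ s)) t))
            (extChartAt (𝓡 (n + 2)) (γ t) (γ t)) w = 0) ↔
      HasMFDerivAt 𝓘(ℝ, ℝ) (cotangentModel n) (g.covelocity γ) t
        ((1 : ℝ →L[ℝ] ℝ).smulRight (g.hamiltonianField (g.covelocity γ t))) := by
    intro t ht
    set y : ℝ → Model n := fun s => extChartAt (𝓡 (n + 2)) (γ t) (γ s) with hy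
    have hyt : y t ∈ (extChartAt (𝓡 (n + 2)) (γ t)).target := mem_extChartAt_target (γ t)
    have hG := g.isMetricField_coordForm (γ t)
    have hγt : ContMDiffAt 𝓘(ℝ, ℝ) (𝓡 (n + 2)) ∞ γ t := hγ.contMDiffAt (hT.mem_nhds ht)
    have hys : ContDiffAt ℝ 2 y t := by
      have h1 : ContMDiffAt 𝓘(ℝ, ℝ) 𝓘(ℝ, Model n) ∞ y t :=
        ContMDiffAt.comp t contMDiffAt_extChartAt hγt
      exact h1.contDiffAt.of_le (WithTop.coe_le_coe.2 (le_top : (2 : ℕ∞) ≤ ⊤))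
    have hev : ∀ v w, (fun z => g.chartCoeff (γ t) z v w)
        =ᶠ[𝓝 (y t)] fun z => g.coordForm (γ t) z v w := fun v w => by
      filter_upwards [hG.isOpen.mem_nhds hyt] with z hz using g.chartCoeff_eq (γ t) hz v w
    have hsrc : ∀ᶠ s in 𝓝 t, s ∈ T ∧ γ s ∈ (chartAt (Model n) (γ t)).source :=
      Filter.Eventually.and (hT.mem_nhds ht)
        (hγt.continuousAt.eventually ((chartAt (Model n) (γ t)).open_source.mem_nhds
          (mem_chart_source _ _)))
    have hcov : (fun s => cotangentChart (g.covelocity γ t) (g.covelocity γ s))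
        =ᶠ[𝓝 t] fun s => (y s, g.coordForm (γ t) (y s) (deriv y s)) := by
      filter_upwards [hsrc] with s hs
      exact g.cotangentChart_covelocity (σ₀ := (g.covelocity γ t))
        ((hγ.contMDiffAt (hT.mem_nhds hs.1)).mdifferentiableAt (by simp)) hs.2
    have hσs : g.covelocity γ t ∈ (cotangentChart (g.covelocity γ t)).source :=
      mem_extChartAt_source (g.covelocity γ t)
    have hiff := hG.hasDerivAt_momentum_iff hyt hys
    have hval := hcov.eq_of_nhds
    rw [← hval] at hiff
    refine Iff.trans (forall_congr' fun w => ?_) (hiff.symm.trans ?_)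
    · have h1 := g.chartCoeff_eq (γ t) hyt (deriv (deriv y) t) w
      have h2 := (hev (deriv y t) w).fderiv_eq (𝕜 := ℝ)
      have h3 := (hev (deriv y t) (deriv y t)).fderiv_eq (𝕜 := ℝ)
      change g.chartCoeff (γ t) (y t) (deriv (deriv y) t) w
        + fderiv ℝ (fun z => g.chartCoeff (γ t) z (deriv y t) w) (y t) (deriv y t)
        - (1 / 2 : ℝ) * fderiv ℝ (fun z => g.chartCoeff (γ t) z (deriv y t) (deriv y t)) (y t) w
          = 0 ↔ _
      rw [h1, h2, h3]
    constructor
    · intro h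
      have h1 : HasDerivAt (fun s => cotangentChart (g.covelocity γ t) (g.covelocity γ s))
          (hamVec (g.coordHamiltonian (g.covelocity γ t))
            (cotangentChart (g.covelocity γ t) (g.covelocity γ t))) t :=
        h.congr_of_eventuallyEq hcov
      have h2 := g.hasMFDerivAt_of_hasDerivAt (σ₀ := (g.covelocity γ t)) (t := t)
        (mem_extChartAt_target (g.covelocity γ t)) h1
      have h3 : (fun s => (cotangentChart (g.covelocity γ t)).symm
            (cotangentChart (g.covelocity γ t) (g.covelocity γ s)))
          =ᶠ[𝓝 t] g.covelocity γ := by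
        filter_upwards [hsrc] with s hs
        exact (cotangentChart (g.covelocity γ t)).left_inv (mem_cotangentChart_source.2 hs.2)
      exact g.hasMFDerivAt_hamiltonianField_congr h2 h3.symm
    · intro h
      refine HasDerivAt.congr_of_eventuallyEq ?_ hcov.symm
      exact g.hasDerivAt_of_hasMFDerivAt h hσs
  constructor
  · intro h t ht
    exact ((key t ht).1 (h.2 t ht)).hasMFDerivWithinAt
  · intro h
    refine ⟨hγ, fun t ht => (key t ht).2 ((h t ht).hasMFDerivAt (hT.mem_nhds ht))⟩

/-- An integral curve of `X_H` is the velocity covector of its projection to the base. -/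
theorem covelocity_proj {c : ℝ → CotangentBundle n M} {t : ℝ}
    (hc : HasMFDerivAt 𝓘(ℝ, ℝ) (cotangentModel n) c t
      ((1 : ℝ →L[ℝ] ℝ).smulRight (g.hamiltonianField (c t)))) :
    g.covelocity (fun s => (c s).proj) t = c t := by
  have hs : c t ∈ (cotangentChart (c t)).source := mem_extChartAt_source (c t)
  have hb := mem_cotangentChart_source.1 hs
  have h1 := g.hasDerivAt_of_hasMFDerivAt hc hs
  have hγ : MDifferentiableAt 𝓘(ℝ, ℝ) (𝓡 (n + 2)) (fun s => (c s).proj) t :=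
    MDifferentiableAt.comp t ((Bundle.contMDiff_proj (n := ∞) _ (c t)).mdifferentiableAt (by simp))
      hc.mdifferentiableAt
  have h2 := g.cotangentChart_covelocity (σ₀ := c t) hγ hb
  have hG := g.isMetricField_coordForm (c t).proj
  have hy : extChartAt (𝓡 (n + 2)) (c t).proj (c t).proj
      ∈ (extChartAt (𝓡 (n + 2)) (c t).proj).target := mem_extChartAt_target _
  have h3 : HasDerivAt (fun s => extChartAt (𝓡 (n + 2)) (c t).proj (c s).proj)
      (hamVec (g.coordHamiltonian (c t)) (cotangentChart (c t) (c t))).1 t := by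
    have h4 : HasDerivAt (fun s => (cotangentChart (c t) (c s)).1) _ t :=
      HasFDerivAt.comp_hasDerivAt (l := Prod.fst) t
        (hasFDerivAt_fst (𝕜 := ℝ) (E := Model n) (F := Model n →L[ℝ] ℝ)) h1
    have h5 : (fun s => (cotangentChart (c t) (c s)).1)
        = fun s => extChartAt (𝓡 (n + 2)) (c t).proj (c s).proj :=
      funext fun s => by rw [cotangentChart_apply]
    rw [h5] at h4
    exact h4
  rw [h3.deriv] at h2
  refine (cotangentChart (c t)).injOn
    ((mem_cotangentChart_source (σ := g.covelocity (fun s => (c s).proj) t)).2 hb) hs (h2.trans ?_)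
  have h5 : ∀ z : Model n × (Model n →L[ℝ] ℝ), z.1 ∈ (extChartAt (𝓡 (n + 2)) (c t).proj).target →
      g.coordForm (c t).proj z.1 (hamVec (g.coordHamiltonian (c t)) z).1 = z.2 := by
    rintro ⟨y, ξ⟩ hz
    have h6 := hG.hamVec_kineticHamiltonian hz ((g.coordForm (c t).proj y).inverse ξ)
    rw [hG.apply_inverse hz] at h6
    rw [coordHamiltonian, h6]
    exact hG.apply_inverse hz ξ
  have h7 := h5 (cotangentChart (c t) (c t)) (by rw [cotangentChart_apply]; exact hy)
  refine Prod.ext (by rw [cotangentChart_apply]) ?_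
  rw [← h7]
  rw [cotangentChart_apply]

end LorentzianMetric
end Geodesics

/-! ### Tubes of null geodesics -/

section Tubes

variable {n : ℕ} {M : Type*} [TopologicalSpace M] [ChartedSpace (Model n) M]
  [IsManifold (𝓡 (n + 2)) ∞ M]

section Definitions

variable {Y : Type*} [TopologicalSpace Y]

/-- The open subset of the cotangent bundle covered by a flow box `L` of the Hamiltonian in the
chart at `σ₀`. -/
def tube (σ₀ : CotangentBundle n M)
    (L : OpenPartialHomeomorph (ℝ × ℝ × ℝ × Y) (Model n × (Model n →L[ℝ] ℝ))) :
    Set (CotangentBundle n M) :=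
  (cotangentChart σ₀).source ∩ cotangentChart σ₀ ⁻¹' L.target

/-- The coordinates `(s, y)` on the space of flow lines of a tube, as functions of the covector. -/
noncomputable def flowLabel (σ₀ : CotangentBundle n M)
    (L : OpenPartialHomeomorph (ℝ × ℝ × ℝ × Y) (Model n × (Model n →L[ℝ] ℝ)))
    (σ : CotangentBundle n M) : ℝ × Y :=
  (L.symm (cotangentChart σ₀ σ)).2.2

/-- The flow line with label `p` on the null cone; its parameter is the flow time multiplied
by `exp p.1`. -/
noncomputable def flowLine (σ₀ : CotangentBundle n M)
    (L : OpenPartialHomeomorph (ℝ × ℝ × ℝ × Y) (Model n × (Model n →L[ℝ] ℝ))) (p : ℝ × Y) (t : ℝ) :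
    CotangentBundle n M :=
  (cotangentChart σ₀).symm (L (t, 0, p))

theorem isOpen_tube (σ₀ : CotangentBundle n M)
    (L : OpenPartialHomeomorph (ℝ × ℝ × ℝ × Y) (Model n × (Model n →L[ℝ] ℝ))) :
    IsOpen (tube σ₀ L) :=
  (continuousOn_extChartAt σ₀).isOpen_inter_preimage (isOpen_extChartAt_source σ₀) L.open_target

theorem dilate_mem_cotangentChart_source {σ₀ σ : CotangentBundle n M}
    (hσ : σ ∈ (cotangentChart σ₀).source) (c : ℝ) : dilate c σ ∈ (cotangentChart σ₀).source :=
  mem_cotangentChart_source.2 (mem_cotangentChart_source.1 hσ)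

end Definitions

variable {Y : Type*} [NormedAddCommGroup Y] [InnerProductSpace ℝ Y]

theorem IsFlowBox.snd_ne_zero {E : Type*} [NormedAddCommGroup E] [NormedSpace ℝ E]
    [FiniteDimensional ℝ E] {h : E × (E →L[ℝ] ℝ) → ℝ} {ε : ℝ}
    {L : OpenPartialHomeomorph (ℝ × ℝ × ℝ × Y) (E × (E →L[ℝ] ℝ))} (hL : IsFlowBox h ε L)
    {p : ℝ × ℝ × ℝ × Y} (hp : p ∈ L.source) : (L p).2 ≠ 0 := by
  intro h0
  -- a covector fixed by the dilations would have several logarithmic scales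
  have h1 : L p = L (p.1, p.2.1, p.2.2.1 + 1, p.2.2.2) := by
    rw [← hL.scale p hp 1]
    exact Prod.ext rfl (by simp [h0])
  have h4 := hL.mem_source_iff.1 hp
  have hp' : (p.1, p.2.1, p.2.2.1 + 1, p.2.2.2) ∈ L.source := hL.mem_source_iff.2 ⟨h4.1, h4.2⟩
  have h2 := L.injOn hp hp' h1
  have h3 := congrArg (fun q : ℝ × ℝ × ℝ × Y => q.2.2.1) h2
  simp at h3

namespace LorentzianMetric

variable {g : LorentzianMetric n M} {σ₀ : CotangentBundle n M} {ε : ℝ}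
  {L : OpenPartialHomeomorph (ℝ × ℝ × ℝ × Y) (Model n × (Model n →L[ℝ] ℝ))}

section FlowBox

variable (hL : IsFlowBox (g.coordHamiltonian σ₀) ε L)
include hL

theorem fiberScale_mem_target {z : Model n × (Model n →L[ℝ] ℝ)} (hz : z ∈ L.target) {c : ℝ}
    (hc : 0 < c) : fiberScale c z ∈ L.target ∧ (L.symm (fiberScale c z)).2.2
      = ((L.symm z).2.2.1 + Real.log c, (L.symm z).2.2.2) := by
  have hs := L.map_target hz
  have h1 := hL.scale _ hs (Real.log c)
  have hs' : ((L.symm z).1, (L.symm z).2.1, (L.symm z).2.2.1 + Real.log c, (L.symm z).2.2.2)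
      ∈ L.source := hL.mem_source_iff.2 ⟨(hL.mem_source_iff.1 hs).1, (hL.mem_source_iff.1 hs).2⟩
  rw [Real.exp_log hc, L.right_inv hz] at h1
  rw [h1]
  exact ⟨L.map_source hs', by rw [L.left_inv hs']⟩

theorem isConic_tube : IsConic (tube σ₀ L) := by
  intro σ hσ c hc
  refine ⟨dilate_mem_cotangentChart_source hσ.1 c, ?_⟩
  rw [mem_preimage, cotangentChart_dilate]
  exact (fiberScale_mem_target hL hσ.2 hc).1

theorem flowLabel_dilate {σ : CotangentBundle n M} (hσ : σ ∈ tube σ₀ L) {c : ℝ} (hc : 0 < c) :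
    flowLabel σ₀ L (dilate c σ) = ((flowLabel σ₀ L σ).1 + Real.log c, (flowLabel σ₀ L σ).2) := by
  rw [flowLabel, cotangentChart_dilate]
  exact (fiberScale_mem_target hL hσ.2 hc).2

/-- On a tube, the null cone is the zero level of the Hamiltonian in the chart. -/
theorem mem_nullCone_iff {σ : CotangentBundle n M} (hσ : σ ∈ tube σ₀ L) :
    σ ∈ g.nullCone ↔ (L.symm (cotangentChart σ₀ σ)).2.1 = 0 := by
  rw [← hL.apply_eq_zero_iff (L.map_target hσ.2), L.right_inv hσ.2]
  refine ⟨fun h => (g.hamiltonian_eq hσ.1).symm.trans h.1,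
    fun h => ⟨(g.hamiltonian_eq hσ.1).trans h, fun h0 => ?_⟩⟩
  have h1 := hL.snd_ne_zero (L.map_target hσ.2)
  rw [L.right_inv hσ.2, cotangentChart_apply, h0] at h1
  exact h1 (ContinuousLinearMap.zero_comp _)

theorem flowLine_flowLabel {σ : CotangentBundle n M} (hσ : σ ∈ g.nullCone ∩ tube σ₀ L) :
    (L.symm (cotangentChart σ₀ σ)).1 ∈ Ioo (-ε) ε ∧
      flowLine σ₀ L (flowLabel σ₀ L σ) (L.symm (cotangentChart σ₀ σ)).1 = σ := by
  refine ⟨(hL.mem_source_iff.1 (L.map_target hσ.2.2)).1, ?_⟩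
  have h0 := (mem_nullCone_iff hL hσ.2).1 hσ.1
  rw [flowLine, flowLabel, ← h0]
  exact (congrArg _ (L.right_inv hσ.2.2)).trans ((cotangentChart σ₀).left_inv hσ.2.1)

/-- The label of the flow line is constant along integral curves of the Hamiltonian field on the
null cone. -/
theorem flowLabel_eq_of_integralCurve {c : ℝ → CotangentBundle n M} {a b : ℝ}
    (hc : IsMIntegralCurveOn (I := cotangentModel n) c g.hamiltonianField (Ioo a b))
    (hU : ∀ t ∈ Ioo a b, c t ∈ g.nullCone ∩ tube σ₀ L) {s t : ℝ} (hs : s ∈ Ioo a b)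
    (ht : t ∈ Ioo a b) : flowLabel σ₀ L (c s) = flowLabel σ₀ L (c t) := by
  have hd : ∀ r ∈ Ioo a b, HasDerivAt (fun r => flowLabel σ₀ L (c r)) 0 r := by
    intro r hr
    have h1 := g.hasDerivAt_of_hasMFDerivAt ((hc r hr).hasMFDerivAt (isOpen_Ioo.mem_nhds hr))
      (hU r hr).2.1
    have hz := (hU r hr).2.2
    have hsrc := L.map_target hz
    have h2 := HasFDerivAt.comp_hasDerivAt (l := L.symm) r (hL.hasFDerivAt_symm hz) h1
    have h3 : HasDerivAt (fun r => flowLabel σ₀ L (c r)) _ r :=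
      HasFDerivAt.comp_hasDerivAt (l := fun q : ℝ × ℝ × ℝ × Y => q.2.2) r
        (((ContinuousLinearMap.snd ℝ ℝ (ℝ × Y)).comp
          (ContinuousLinearMap.snd ℝ ℝ (ℝ × ℝ × Y))).hasFDerivAt) h2
    convert h3 using 1
    -- the Hamiltonian field is a multiple of the time coordinate field of the flow box
    have h4 := hL.fderiv_time hsrc
    rw [L.right_inv hz] at h4
    have h5 : hamVec (g.coordHamiltonian σ₀) (cotangentChart σ₀ (c r))
        = Real.exp (L.symm (cotangentChart σ₀ (c r))).2.2.1 •
          fderiv ℝ L (L.symm (cotangentChart σ₀ (c r))) (1, 0) := by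
      rw [h4, smul_smul, mul_inv_cancel₀ (Real.exp_pos _).ne', one_smul]
    have h6 := hL.fderiv_symm_fderiv hsrc (1, 0)
    rw [L.right_inv hz] at h6
    rw [h5, map_smul, h6]
    simp
  exact isOpen_Ioo.is_const_of_deriv_eq_zero isPreconnected_Ioo
    (fun r hr => (hd r hr).differentiableAt.differentiableWithinAt)
    (fun r hr => (hd r hr).deriv) hs ht

variable (hLt : L.target ⊆ (cotangentChart σ₀).target)
include hLt

theorem cotangentChart_flowLine (p : ℝ × Y) {t : ℝ} (ht : t ∈ Ioo (-ε) ε) :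
    cotangentChart σ₀ (flowLine σ₀ L p t) = L (t, 0, p) :=
  (cotangentChart σ₀).right_inv (hLt (L.map_source (hL.mem_source_iff.2 ⟨ht, hL.zero_mem⟩)))

theorem flowLine_mem (p : ℝ × Y) {t : ℝ} (ht : t ∈ Ioo (-ε) ε) :
    flowLine σ₀ L p t ∈ g.nullCone ∩ tube σ₀ L := by
  have hs : ((t, 0, p) : ℝ × ℝ × ℝ × Y) ∈ L.source := hL.mem_source_iff.2 ⟨ht, hL.zero_mem⟩
  have h1 : flowLine σ₀ L p t ∈ tube σ₀ L := by
    refine ⟨(cotangentChart σ₀).map_target (hLt (L.map_source hs)), ?_⟩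
    rw [mem_preimage, cotangentChart_flowLine hL hLt p ht]
    exact L.map_source hs
  refine ⟨(mem_nullCone_iff hL h1).2 ?_, h1⟩
  rw [cotangentChart_flowLine hL hLt p ht, L.left_inv hs]

theorem flowLabel_flowLine (p : ℝ × Y) {t : ℝ} (ht : t ∈ Ioo (-ε) ε) :
    flowLabel σ₀ L (flowLine σ₀ L p t) = p := by
  rw [flowLabel, cotangentChart_flowLine hL hLt p ht,
    L.left_inv (hL.mem_source_iff.2 ⟨ht, hL.zero_mem⟩)]

/-- Flow lines, run at the right speed, are integral curves of the Hamiltonian field. -/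
theorem hasMFDerivAt_flowLine (p : ℝ × Y) {t : ℝ} (ht : Real.exp p.1 * t ∈ Ioo (-ε) ε) :
    HasMFDerivAt 𝓘(ℝ, ℝ) (cotangentModel n) (fun r => flowLine σ₀ L p (Real.exp p.1 * r)) t
      ((1 : ℝ →L[ℝ] ℝ).smulRight (g.hamiltonianField (flowLine σ₀ L p (Real.exp p.1 * t)))) := by
  have hs : ((Real.exp p.1 * t, 0, p) : ℝ × ℝ × ℝ × Y) ∈ L.source :=
    hL.mem_source_iff.2 ⟨ht, hL.zero_mem⟩
  refine g.hasMFDerivAt_of_hasDerivAt (ζ := fun r => L (Real.exp p.1 * r, 0, p))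
    (hLt (L.map_source hs)) ?_
  have h1 := (hL.hasDerivAt _ hs).scomp t ((hasDerivAt_id t).const_mul (Real.exp p.1))
  refine h1.congr_deriv ?_
  change (Real.exp p.1 * 1) • (Real.exp p.1)⁻¹ • hamVec _ _ = _
  rw [smul_smul, mul_one, mul_inv_cancel₀ (Real.exp_pos p.1).ne', one_smul]

/-- Two null covectors in the tube lie on one orbit exactly if their flow lines have the same
label. -/
theorem flowLabel_eq_iff_flowEquiv {σ τ : CotangentBundle n M}
    (hσ : σ ∈ g.nullCone ∩ tube σ₀ L) (hτ : τ ∈ g.nullCone ∩ tube σ₀ L) :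
    flowLabel σ₀ L σ = flowLabel σ₀ L τ ↔ g.FlowEquiv (g.nullCone ∩ tube σ₀ L) σ τ := by
  constructor
  · intro h
    obtain ⟨h1, h2⟩ := flowLine_flowLabel hL hσ
    obtain ⟨h3, h4⟩ := flowLine_flowLabel hL hτ
    rw [← h] at h4
    set p := flowLabel σ₀ L σ
    have he := Real.exp_pos p.1
    have hm : ∀ t, t ∈ Ioo (-(ε / Real.exp p.1)) (ε / Real.exp p.1) ↔
        Real.exp p.1 * t ∈ Ioo (-ε) ε := by
      intro t
      rw [mem_Ioo, ← abs_lt, mem_Ioo, ← abs_lt, abs_mul, abs_of_pos he, lt_div_iff₀' he]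
    have hx : ∀ x : ℝ, Real.exp p.1 * (x / Real.exp p.1) = x := fun x => mul_div_cancel₀ x he.ne'
    refine ⟨fun t => flowLine σ₀ L p (Real.exp p.1 * t), -(ε / Real.exp p.1), ε / Real.exp p.1,
      fun t ht => (hasMFDerivAt_flowLine hL hLt p ((hm t).1 ht)).hasMFDerivWithinAt,
      fun t ht => flowLine_mem hL hLt p ((hm t).1 ht),
      (L.symm (cotangentChart σ₀ σ)).1 / Real.exp p.1, (hm _).2 (by rwa [hx]),
      (L.symm (cotangentChart σ₀ τ)).1 / Real.exp p.1, (hm _).2 (by rwa [hx]), ?_, ?_⟩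
    · simp only [hx]; exact h2
    · simp only [hx]; exact h4
  · rintro ⟨c, a, b, hc, hU, s, hs, t, ht, rfl, rfl⟩
    exact flowLabel_eq_of_integralCurve hL hc hU hs ht

/-- Two null covectors in the tube are tangent to one unparametrized geodesic exactly if the labels
of their flow lines agree up to the scale. -/
theorem flowLabel_snd_eq_iff {σ τ : CotangentBundle n M}
    (hσ : σ ∈ g.nullCone ∩ tube σ₀ L) (hτ : τ ∈ g.nullCone ∩ tube σ₀ L) :
    (flowLabel σ₀ L σ).2 = (flowLabel σ₀ L τ).2 ↔
      g.SameUnparametrizedNullGeodesic (g.nullCone ∩ tube σ₀ L) σ τ := by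
  constructor
  · intro h
    -- the projection of the flow line of scale one is an affinely parametrized geodesic
    set p : ℝ × Y := (0, (flowLabel σ₀ L σ).2) with hp
    have hder : ∀ t ∈ Ioo (-ε) ε, HasMFDerivAt 𝓘(ℝ, ℝ) (cotangentModel n) (flowLine σ₀ L p) t
        ((1 : ℝ →L[ℝ] ℝ).smulRight (g.hamiltonianField (flowLine σ₀ L p t))) := by
      intro t ht
      have he : Real.exp p.1 = 1 := Real.exp_zero
      have h1 := hasMFDerivAt_flowLine hL hLt p (t := t) (by rwa [he, one_mul])
      exact g.hasMFDerivAt_hamiltonianField_congr h1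
        (Filter.Eventually.of_forall fun r => by simp only [he, one_mul])
    set γ : ℝ → M := fun t => (flowLine σ₀ L p t).proj with hγ
    have hcov : ∀ t ∈ Ioo (-ε) ε, g.covelocity γ t = flowLine σ₀ L p t := fun t ht =>
      g.covelocity_proj (hder t ht)
    have hsm : ContMDiffOn 𝓘(ℝ, ℝ) (𝓡 (n + 2)) ∞ γ (Ioo (-ε) ε) := by
      have h1 : ContDiffOn ℝ ∞ (fun t => L (t, 0, p)) (Ioo (-ε) ε) :=
        hL.contDiffOn.comp (by fun_prop) fun t ht => hL.mem_source_iff.2 ⟨ht, hL.zero_mem⟩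
      have h2 : ContMDiffOn 𝓘(ℝ, ℝ) (cotangentModel n) ∞ (flowLine σ₀ L p) (Ioo (-ε) ε) :=
        (contMDiffOn_extChartAt_symm σ₀).comp h1.contMDiffOn
          fun t ht => hLt (L.map_source (hL.mem_source_iff.2 ⟨ht, hL.zero_mem⟩))
      exact (Bundle.contMDiff_proj _).comp_contMDiffOn h2
    have hgeo : g.IsGeodesicOn γ (Ioo (-ε) ε) := by
      refine (g.isGeodesicOn_iff isOpen_Ioo hsm).2 fun t ht => HasMFDerivAt.hasMFDerivWithinAt ?_
      have h1 : g.covelocity γ =ᶠ[𝓝 t] flowLine σ₀ L p := by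
        filter_upwards [isOpen_Ioo.mem_nhds ht] with s hs using hcov s hs
      exact g.hasMFDerivAt_hamiltonianField_congr (hder t ht) h1
    have hscale : ∀ τ ∈ g.nullCone ∩ tube σ₀ L, (flowLabel σ₀ L τ).2 = p.2 →
        ∃ t ∈ Ioo (-ε) ε, ∃ c : ℝ, 0 < c ∧ g.covelocity γ t = dilate c τ := by
      intro τ hτ hτp
      obtain ⟨h1, h2⟩ := flowLine_flowLabel hL hτ
      refine ⟨_, h1, Real.exp (-(flowLabel σ₀ L τ).1), Real.exp_pos _, ?_⟩
      rw [hcov _ h1]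
      have hsrc := L.map_target hτ.2.2
      have h3 := hL.scale _ hsrc (-(flowLabel σ₀ L τ).1)
      rw [L.right_inv hτ.2.2, ← cotangentChart_dilate, (mem_nullCone_iff hL hτ.2).1 hτ.1] at h3
      rw [← (cotangentChart σ₀).left_inv (dilate_mem_cotangentChart_source hτ.2.1 _), h3, flowLine]
      congr 4
      refine Prod.ext ?_ hτp.symm
      exact (add_neg_cancel (flowLabel σ₀ L τ).1).symm
    obtain ⟨s, hs, c, hc, hsc⟩ := hscale σ hσ rfl
    obtain ⟨t, ht, c', hc', htc⟩ := hscale τ hτ h.symm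
    exact ⟨γ, -ε, ε, hgeo, fun t ht => by rw [hcov t ht]; exact flowLine_mem hL hLt p ht, s, hs, t,
      ht, c, hc, c', hc', hsc, htc⟩
  · rintro ⟨γ, a, b, hgeo, hU, s, hs, t, ht, c, hc, c', hc', hsc, htc⟩
    have h1 := (g.isGeodesicOn_iff isOpen_Ioo hgeo.1).1 hgeo
    have h2 := flowLabel_eq_of_integralCurve hL h1 hU hs ht
    rw [hsc, htc, flowLabel_dilate hL hσ.2 hc, flowLabel_dilate hL hτ.2 hc'] at h2
    exact (Prod.ext_iff.1 h2).2

end FlowBox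

end LorentzianMetric

end Tubes

/-! ### The derivative of the flow label -/

section LabelDerivative

variable {n : ℕ} {M : Type*} [TopologicalSpace M] [ChartedSpace (Model n) M]
  [IsManifold (𝓡 (n + 2)) ∞ M]
  {Y : Type*} [NormedAddCommGroup Y] [InnerProductSpace ℝ Y]

/-- The derivative of `flowLabel`. -/
noncomputable def flowLabelDiff (σ₀ : CotangentBundle n M)
    (L : OpenPartialHomeomorph (ℝ × ℝ × ℝ × Y) (Model n × (Model n →L[ℝ] ℝ)))
    (σ : CotangentBundle n M) : TangentSpace (cotangentModel n) σ →L[ℝ] ℝ × Y :=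
  (((ContinuousLinearMap.snd ℝ ℝ (ℝ × Y)).comp (ContinuousLinearMap.snd ℝ ℝ (ℝ × ℝ × Y))).comp
    (fderiv ℝ L.symm (cotangentChart σ₀ σ))).comp (cotangentDiff σ₀ σ)

namespace LorentzianMetric

variable {g : LorentzianMetric n M} {σ₀ : CotangentBundle n M} {ε : ℝ}
  {L : OpenPartialHomeomorph (ℝ × ℝ × ℝ × Y) (Model n × (Model n →L[ℝ] ℝ))}
  (hL : IsFlowBox (g.coordHamiltonian σ₀) ε L)
include hL

theorem hasMFDerivAt_flowLabel {σ : CotangentBundle n M} (hσ : σ ∈ tube σ₀ L) :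
    HasMFDerivAt (cotangentModel n) 𝓘(ℝ, ℝ × Y) (flowLabel σ₀ L) σ (flowLabelDiff σ₀ L σ) := by
  have h1 : HasFDerivAt (fun z => (L.symm z).2.2)
      (((ContinuousLinearMap.snd ℝ ℝ (ℝ × Y)).comp (ContinuousLinearMap.snd ℝ ℝ (ℝ × ℝ × Y))).comp
        (fderiv ℝ L.symm (cotangentChart σ₀ σ))) (cotangentChart σ₀ σ) :=
    HasFDerivAt.comp (g := fun q : ℝ × ℝ × ℝ × Y => q.2.2) _
      (((ContinuousLinearMap.snd ℝ ℝ (ℝ × Y)).comp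
        (ContinuousLinearMap.snd ℝ ℝ (ℝ × ℝ × Y))).hasFDerivAt) (hL.hasFDerivAt_symm hσ.2)
  exact HasMFDerivAt.comp (g := fun z => (L.symm z).2.2) (f := cotangentChart σ₀) σ
    h1.hasMFDerivAt (hasMFDerivAt_cotangentChart hσ.1)

theorem contMDiffOn_flowLabel :
    ContMDiffOn (cotangentModel n) 𝓘(ℝ, ℝ × Y) ∞ (flowLabel σ₀ L) (tube σ₀ L) := by
  have h1 : ContDiffOn ℝ ∞ (fun z => (L.symm z).2.2) L.target :=
    (contDiff_snd.comp contDiff_snd).comp_contDiffOn hL.contDiffOn_symm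
  have h2 : ContMDiffOn (cotangentModel n) 𝓘(ℝ, Model n × (Model n →L[ℝ] ℝ)) ∞
      (cotangentChart σ₀) (tube σ₀ L) :=
    contMDiffOn_extChartAt.mono fun σ hσ => by
      rw [← extChartAt_source (I := cotangentModel n)]; exact hσ.1
  exact h1.contMDiffOn.comp h2 fun σ hσ => hσ.2

/-- Tangent vectors of the null cone, in the coordinates `(t, s, y)` of the flow box. -/
theorem exists_levelMap_cotangentDiff (hLt : L.target ⊆ (cotangentChart σ₀).target)
    {σ : CotangentBundle n M} (hσ : σ ∈ g.nullCone ∩ tube σ₀ L)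
    {v : TangentSpace (cotangentModel n) σ} (hv : v ∈ g.nullConeTangent σ) :
    ∃ t ∈ Ioo (-ε) ε, ∃ a : ℝ, cotangentChart σ₀ σ = levelMap L (t, flowLabel σ₀ L σ) ∧
      cotangentDiff σ₀ σ v
        = fderiv ℝ (levelMap L) (t, flowLabel σ₀ L σ) (a, flowLabelDiff σ₀ L σ v) := by
  obtain ⟨h1, h2, h3⟩ := hL.exists_levelMap_tangent
    (g.isHomogeneousHamiltonian_coordHamiltonian σ₀) hLt hσ.2.2
    ((g.hamiltonian_eq hσ.2.1).symm.trans hσ.1.1)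
    ((g.dHamiltonian_eq hσ.2.1 v).symm.trans hv)
  exact ⟨_, h1, _, h2.symm, h3.symm⟩

variable (hLt : L.target ⊆ (cotangentChart σ₀).target)
include hLt

theorem tautologicalForm_eq_reducedForm {σ : CotangentBundle n M}
    (hσ : σ ∈ g.nullCone ∩ tube σ₀ L) {v : TangentSpace (cotangentModel n) σ}
    (hv : v ∈ g.nullConeTangent σ) :
    tautologicalForm n M σ ![v] = reducedForm L (flowLabel σ₀ L σ) ![flowLabelDiff σ₀ L σ v] := by
  obtain ⟨t, ht, a, h1, h2⟩ := exists_levelMap_cotangentDiff hL hLt hσ hv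
  rw [tautologicalForm_eq hσ.2.1, h2, h1]
  exact hL.liouvilleForm_levelMap (g.isHomogeneousHamiltonian_coordHamiltonian σ₀) hLt
    (q := (t, flowLabel σ₀ L σ)) ht _

/-- On the null cone, the canonical symplectic form is pulled back from the space of flow lines. -/
theorem canonicalForm_eq_extDeriv_reducedForm {σ : CotangentBundle n M}
    (hσ : σ ∈ g.nullCone ∩ tube σ₀ L) {v w : TangentSpace (cotangentModel n) σ}
    (hv : v ∈ g.nullConeTangent σ) (hw : w ∈ g.nullConeTangent σ) :
    canonicalForm n M σ ![v, w] = extDeriv (reducedForm L) (flowLabel σ₀ L σ)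
      ![flowLabelDiff σ₀ L σ v, flowLabelDiff σ₀ L σ w] := by
  obtain ⟨h1, h2, h3⟩ := hL.exists_levelMap_tangent
    (g.isHomogeneousHamiltonian_coordHamiltonian σ₀) hLt hσ.2.2
    ((g.hamiltonian_eq hσ.2.1).symm.trans hσ.1.1)
    ((g.dHamiltonian_eq hσ.2.1 v).symm.trans hv)
  obtain ⟨-, -, h4⟩ := hL.exists_levelMap_tangent
    (g.isHomogeneousHamiltonian_coordHamiltonian σ₀) hLt hσ.2.2
    ((g.hamiltonian_eq hσ.2.1).symm.trans hσ.1.1)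
    ((g.dHamiltonian_eq hσ.2.1 w).symm.trans hw)
  rw [canonicalForm_eq hσ.2.1, ← h3, ← h4]
  exact hL.symplecticFlat_levelMap (g.isHomogeneousHamiltonian_coordHamiltonian σ₀) hLt
    (q := ((L.symm (cotangentChart σ₀ σ)).1, flowLabel σ₀ L σ)) h1 _ _

/-- The flow label is a submersion on the null cone. -/
theorem exists_flowLabelDiff_eq {σ : CotangentBundle n M}
    (hσ : σ ∈ g.nullCone ∩ tube σ₀ L) (u : ℝ × Y) :
    ∃ v ∈ g.nullConeTangent σ, flowLabelDiff σ₀ L σ v = u := by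
  have hsrc := L.map_target hσ.2.2
  have h0 := (mem_nullCone_iff hL hσ.2).1 hσ.1
  have hr := L.right_inv hσ.2.2
  obtain ⟨v, hv⟩ := (bijective_cotangentDiff hσ.2.1).2
    (fderiv ℝ L (L.symm (cotangentChart σ₀ σ)) (0, 0, u))
  refine ⟨v, ?_, ?_⟩
  · have h1 := hL.fderiv_hamiltonian (g.isHomogeneousHamiltonian_coordHamiltonian σ₀) hLt hsrc h0
      (0, 0, u)
    rw [hr, ← hv, ← g.dHamiltonian_eq hσ.2.1, mul_zero] at h1
    exact h1
  · have h1 := hL.fderiv_symm_fderiv hsrc (0, 0, u)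
    rw [hr, ← hv] at h1
    exact congrArg (fun q : ℝ × ℝ × ℝ × Y => q.2.2) h1

end LorentzianMetric

end LabelDerivative

/-! ### Differential forms on a vector space, as a manifold -/

section VectorSpaceForms

variable {F : Type*} [NormedAddCommGroup F] [NormedSpace ℝ F] {k : ℕ}

theorem DiffForm.chartRep_vectorSpace (η : DiffForm 𝓘(ℝ, F) F k) (x₀ : F) :
    DiffForm.chartRep 𝓘(ℝ, F) η x₀ = η := by
  funext y
  have h : mfderivWithin 𝓘(ℝ, F) 𝓘(ℝ, F) (extChartAt 𝓘(ℝ, F) x₀).symm (range 𝓘(ℝ, F)) y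
      = ContinuousLinearMap.id ℝ F := by
    rw [ModelWithCorners.range_eq_univ, mfderivWithin_univ, extChartAt_model_space_eq_id]
    exact mfderiv_id
  rw [DiffForm.chartRep, h]
  rfl

theorem DiffForm.smoothOn_vectorSpace_iff (η : DiffForm 𝓘(ℝ, F) F k) (V : Set F) :
    DiffForm.SmoothOn 𝓘(ℝ, F) η V ↔
      ContDiffOn ℝ ∞ (show F → F [⋀^Fin k]→L[ℝ] ℝ from η) V := by
  have h : ∀ x₀ : F, (extChartAt 𝓘(ℝ, F) x₀).target ∩ (extChartAt 𝓘(ℝ, F) x₀).symm ⁻¹' V = V := by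
    intro x₀
    rw [extChartAt_model_space_eq_id]
    exact univ_inter _
  simp only [DiffForm.SmoothOn, h, DiffForm.chartRep_vectorSpace]
  exact ⟨fun h => h 0, fun h _ => h⟩

theorem DiffForm.d_vectorSpace (η : DiffForm 𝓘(ℝ, F) F k) (x : F) :
    DiffForm.d 𝓘(ℝ, F) η x = extDeriv (show F → F [⋀^Fin k]→L[ℝ] ℝ from η) x := by
  have h : mfderiv 𝓘(ℝ, F) 𝓘(ℝ, F) (extChartAt 𝓘(ℝ, F) x) x = ContinuousLinearMap.id ℝ F := by
    rw [extChartAt_model_space_eq_id]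
    exact mfderiv_id
  rw [DiffForm.d, h, DiffForm.chartRep_vectorSpace, ModelWithCorners.range_eq_univ,
    extChartAt_model_space_eq_id]
  change (extDerivWithin (show F → F [⋀^Fin k]→L[ℝ] ℝ from η) univ x).compContinuousLinearMap
    (ContinuousLinearMap.id ℝ F) = _
  rw [extDerivWithin_univ]
  rfl

theorem hasMFDerivAt_prod_of_hasFDerivAt {G : Type*} [NormedAddCommGroup G] [NormedSpace ℝ G]
    {f : G → ℝ × F} {f' : G →L[ℝ] ℝ × F} {a : G} (h : HasFDerivAt f f' a) :
    HasMFDerivAt 𝓘(ℝ, G) (𝓘(ℝ, ℝ).prod 𝓘(ℝ, F)) f a f' :=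
  HasMFDerivAt.prodMk h.fst.hasMFDerivAt h.snd.hasMFDerivAt

theorem extChartAt_real_prod (z : ℝ × F) :
    extChartAt (𝓘(ℝ, ℝ).prod 𝓘(ℝ, F)) z = PartialEquiv.refl (ℝ × F) := by
  rw [extChartAt_prod, extChartAt_model_space_eq_id, extChartAt_model_space_eq_id]
  exact PartialEquiv.refl_prod_refl

theorem DiffForm.d_real_prod (η : DiffForm (𝓘(ℝ, ℝ).prod 𝓘(ℝ, F)) (ℝ × F) k) (z : ℝ × F) :
    DiffForm.d (𝓘(ℝ, ℝ).prod 𝓘(ℝ, F)) η z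
      = extDeriv (show ℝ × F → (ℝ × F) [⋀^Fin k]→L[ℝ] ℝ from η) z := by
  have h1 : mfderiv (𝓘(ℝ, ℝ).prod 𝓘(ℝ, F)) 𝓘(ℝ, ℝ × F)
      (extChartAt (𝓘(ℝ, ℝ).prod 𝓘(ℝ, F)) z) z = ContinuousLinearMap.id ℝ (ℝ × F) := by
    rw [extChartAt_real_prod]
    have hm : MDifferentiableAt (𝓘(ℝ, ℝ).prod 𝓘(ℝ, F)) 𝓘(ℝ, ℝ × F)
        (fun z : ℝ × F => (z.1, z.2)) z :=
      (((contMDiff_fst (n := 1)).prodMk_space contMDiff_snd) z).mdifferentiableAt one_ne_zero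
    exact hasMFDerivAt_unique (HasMFDerivAt.comp z hm.hasMFDerivAt
      (hasMFDerivAt_prod_of_hasFDerivAt (hasFDerivAt_id z)))
      (hasMFDerivAt_id (I := 𝓘(ℝ, ℝ × F)) z)
  have h2 : DiffForm.chartRep (𝓘(ℝ, ℝ).prod 𝓘(ℝ, F)) η z = η := by
    funext y
    have h : mfderivWithin 𝓘(ℝ, ℝ × F) (𝓘(ℝ, ℝ).prod 𝓘(ℝ, F))
        (extChartAt (𝓘(ℝ, ℝ).prod 𝓘(ℝ, F)) z).symm (range (𝓘(ℝ, ℝ).prod 𝓘(ℝ, F))) y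
        = ContinuousLinearMap.id ℝ (ℝ × F) := by
      rw [ModelWithCorners.range_eq_univ, mfderivWithin_univ, extChartAt_real_prod]
      exact (hasMFDerivAt_prod_of_hasFDerivAt (hasFDerivAt_id y)).mfderiv
    rw [DiffForm.chartRep, h, extChartAt_real_prod]
    rfl
  rw [DiffForm.d, h1, h2, ModelWithCorners.range_eq_univ, extChartAt_real_prod]
  change (extDerivWithin (show ℝ × F → (ℝ × F) [⋀^Fin k]→L[ℝ] ℝ from η) univ
    z).compContinuousLinearMap (ContinuousLinearMap.id ℝ (ℝ × F)) = _
  rw [extDerivWithin_univ]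
  rfl

theorem symplectizationPrimitive_vectorSpace (θ : DiffForm 𝓘(ℝ, F) F 1) :
    symplectizationPrimitive 𝓘(ℝ, F) θ = fun z : ℝ × F =>
      z.1 • (show F [⋀^Fin 1]→L[ℝ] ℝ from θ z.2).compContinuousLinearMap
        (ContinuousLinearMap.snd ℝ ℝ F) := by
  funext z
  rw [symplectizationPrimitive, DiffForm.pullback, mfderiv_snd]
  rfl

theorem contMDiffOn_prod_of_contDiffOn {G : Type*} [NormedAddCommGroup G] [NormedSpace ℝ G]
    {f : G → ℝ × F} {S : Set G} (h : ContDiffOn ℝ ∞ f S) :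
    ContMDiffOn 𝓘(ℝ, G) (𝓘(ℝ, ℝ).prod 𝓘(ℝ, F)) ∞ f S :=
  (contDiff_fst.comp_contDiffOn h).contMDiffOn.prodMk (contDiff_snd.comp_contDiffOn h).contMDiffOn

theorem contMDiffOn_of_contDiffOn_prod {G : Type*} [NormedAddCommGroup G] [NormedSpace ℝ G]
    {f : ℝ × F → G} {S : Set (ℝ × F)} (h : ContDiffOn ℝ ∞ f S) :
    ContMDiffOn (𝓘(ℝ, ℝ).prod 𝓘(ℝ, F)) 𝓘(ℝ, G) ∞ f S :=
  h.contMDiffOn.comp (contMDiffOn_fst.prodMk_space contMDiffOn_snd) fun _ hz => hz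

end VectorSpaceForms

/-! ### Existence of tubes -/

section TubeExistence

variable {n : ℕ} {M : Type*} [TopologicalSpace M] [ChartedSpace (Model n) M]
  [IsManifold (𝓡 (n + 2)) ∞ M]

theorem cotangentChart_snd_ne_zero {σ₀ σ : CotangentBundle n M}
    (hσ : σ ∈ (cotangentChart σ₀).source) (h : σ.snd ≠ 0) : (cotangentChart σ₀ σ).2 ≠ 0 := by
  rw [cotangentChart_apply]
  intro h0
  refine h (ContinuousLinearMap.ext fun v => ?_)
  rw [← coordFrame_coordDiff (mem_cotangentChart_source.1 hσ) v]
  exact congrArg (fun f : Model n →L[ℝ] ℝ => f (coordDiff σ₀.proj σ.proj v)) h0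

/-- Every null covector lies in arbitrarily small tubes: the kinetic Hamiltonian, restricted to a
conic neighbourhood, satisfies the hypotheses of the existence theorem for flow boxes. -/
theorem LorentzianMetric.exists_tube (g : LorentzianMetric n M) {σ₀ : CotangentBundle n M}
    (hσ₀ : σ₀ ∈ g.nullCone) {O : Set (CotangentBundle n M)} (hO : IsOpen O) (hOc : IsConic O)
    (hσ₀O : σ₀ ∈ O) :
    ∃ (ε : ℝ) (L : OpenPartialHomeomorph (ℝ × ℝ × ℝ × EuclideanSpace ℝ (Fin (2 * n + 1)))
        (Model n × (Model n →L[ℝ] ℝ))),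
      IsFlowBox (g.coordHamiltonian σ₀) ε L ∧ L.target ⊆ (cotangentChart σ₀).target ∧
        σ₀ ∈ tube σ₀ L ∧ tube σ₀ L ⊆ O := by
  have H := g.isHomogeneousHamiltonian_coordHamiltonian σ₀
  have hs : σ₀ ∈ (cotangentChart σ₀).source := mem_extChartAt_source σ₀
  have ht : cotangentChart σ₀ σ₀ ∈ (cotangentChart σ₀).target := (cotangentChart σ₀).map_source hs
  have H' : IsHomogeneousHamiltonian (g.coordHamiltonian σ₀)
      ((cotangentChart σ₀).target ∩ (cotangentChart σ₀).symm ⁻¹' O) :=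
    { isOpen := (continuousOn_extChartAt_symm σ₀).isOpen_inter_preimage
        (isOpen_extChartAt_target σ₀) hO
      scale_mem := by
        intro z hz c hc
        refine ⟨H.scale_mem z hz.1 c hc, ?_⟩
        have h1 : (cotangentChart σ₀).symm (fiberScale c z)
            = dilate c ((cotangentChart σ₀).symm z) := by
          have h2 := (cotangentChart σ₀).map_target hz.1
          rw [← (cotangentChart σ₀).left_inv (dilate_mem_cotangentChart_source h2 c),
            cotangentChart_dilate, (cotangentChart σ₀).right_inv hz.1]
        rw [mem_preimage, h1]
        exact hOc _ hz.2 c hc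
      contDiffOn := H.contDiffOn.mono inter_subset_left
      map_scale := fun z hz c hc => H.map_scale z hz.1 c hc }
  have hp := cotangentChart_snd_ne_zero hs hσ₀.2
  have hX : (hamVec (g.coordHamiltonian σ₀) (cotangentChart σ₀ σ₀)).1 ≠ 0 :=
    (g.isMetricField_coordForm σ₀.proj).hamVec_fst_ne_zero
      (by rw [cotangentChart_apply]; exact mem_extChartAt_target _) hp
  obtain ⟨ε, L, hL, h1, h2⟩ := H'.exists_flowBox (Y := EuclideanSpace ℝ (Fin (2 * n + 1)))
    ⟨ht, by rw [mem_preimage, (cotangentChart σ₀).left_inv hs]; exact hσ₀O⟩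
    ((g.hamiltonian_eq hs).symm.trans hσ₀.1) hp hX
    (by rw [Module.finrank_prod, finrank_continuousDual, finrank_euclideanSpace_fin,
          finrank_euclideanSpace_fin]; ring)
  refine ⟨ε, L, hL, fun z hz => (h2 hz).1, ⟨hs, h1⟩, fun σ hσ => ?_⟩
  have h3 := (h2 hσ.2).2
  rwa [mem_preimage, (cotangentChart σ₀).left_inv hσ.1] at h3

end TubeExistence

/-! ### Symplectic and contact forms on vector spaces, as manifolds -/

/-- A nowhere vanishing continuous function on a preconnected set has constant sign. -/
theorem exists_sign_of_isPreconnected {Y : Type*} [TopologicalSpace Y] {V : Set Y}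
    (hV : IsPreconnected V) {f : Y → ℝ}
    (hf : ContinuousOn f V) (h0 : ∀ y ∈ V, f y ≠ 0) :
    ∃ ε : ℝ, (ε = 1 ∨ ε = -1) ∧ ∀ y ∈ V, 0 < ε * f y := by
  by_cases hpos : ∀ y ∈ V, 0 < f y
  · exact ⟨1, Or.inl rfl, fun y hy => by rw [one_mul]; exact hpos y hy⟩
  · push Not at hpos
    obtain ⟨a, ha, hfa⟩ := hpos
    refine ⟨-1, Or.inr rfl, fun b hb => ?_⟩
    by_contra hfb
    obtain ⟨c, hc, hc0⟩ := hV.intermediate_value ha hb hf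
      (show (0 : ℝ) ∈ Icc (f a) (f b) from ⟨hfa, by linarith⟩)
    exact h0 c hc hc0

section Structures

variable {G Y : Type*} [NormedAddCommGroup G] [NormedSpace ℝ G] [NormedAddCommGroup Y]
  [NormedSpace ℝ Y]

theorem isSymplecticForm_comp_extDeriv (e : G ≃L[ℝ] Y) {β : Y → Y [⋀^Fin 1]→L[ℝ] ℝ}
    (hβ : ContDiff ℝ ∞ β) (hnd : ∀ g v : Y, (∀ w, extDeriv β g ![v, w] = 0) → v = 0) :
    IsSymplecticForm 𝓘(ℝ, G)
      (fun a : G => (extDeriv β (e a)).compContinuousLinearMap (e : G →L[ℝ] Y)) := by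
  set α : G → G [⋀^Fin 1]→L[ℝ] ℝ := fun a => (β (e a)).compContinuousLinearMap (fderiv ℝ e a)
    with hα
  have hαs : ContDiff ℝ ∞ α := contDiffOn_univ.1 (contDiffOn_pullback isOpen_univ hβ.contDiffOn
    e.contDiff.contDiffOn (mapsTo_univ _ _))
  have h1 : (fun a : G => (extDeriv β (e a)).compContinuousLinearMap (e : G →L[ℝ] Y))
      = extDeriv α := by
    funext a
    rw [hα, extDeriv_pullback_smooth (hβ.differentiable (by simp) _) e.contDiff.contDiffAt,
      e.fderiv]
  refine ⟨?_, fun a => ?_, fun a v hv => ?_⟩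
  · rw [DiffForm.smoothOn_vectorSpace_iff]
    change ContDiffOn ℝ ∞ (fun a : G => (extDeriv β (e a)).compContinuousLinearMap
      (e : G →L[ℝ] Y)) univ
    rw [h1]
    exact contDiffOn_extDeriv isOpen_univ hαs.contDiffOn
  · rw [DiffForm.d_vectorSpace]
    change extDeriv (fun a : G => (extDeriv β (e a)).compContinuousLinearMap (e : G →L[ℝ] Y)) a = 0
    rw [h1, extDeriv_extDeriv hαs (by simpa using WithTop.coe_le_coe.2 (le_top : (2 : ℕ∞) ≤ ⊤))]
    rfl
  · have h2 : e v = 0 := by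
      refine hnd (e a) (e v) fun w => ?_
      have h3 := hv (e.symm w)
      have h4 := (compContinuousLinearMap_two (η := extDeriv β (e a)) (e : G →L[ℝ] Y) v
        (e.symm w)).symm.trans h3
      simpa using h4
    exact e.map_eq_zero_iff.1 h2

/-- The field of kernels of a one-form on a vector space. -/
noncomputable def kernelField (θ : Y → Y [⋀^Fin 1]→L[ℝ] ℝ) (y : Y) : Submodule ℝ Y :=
  (ofOneForm (θ y)).ker

theorem mem_kernelField {θ : Y → Y [⋀^Fin 1]→L[ℝ] ℝ} {y v : Y} :
    v ∈ kernelField θ y ↔ θ y ![v] = 0 := by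
  rw [kernelField, LinearMap.mem_ker]
  exact Eq.congr_left (ofOneForm_apply _ _)

theorem isContactDistribution_kernelField {θ : Y → Y [⋀^Fin 1]→L[ℝ] ℝ} (hθ : ContDiff ℝ ∞ θ)
    (hnd : ∀ g v : ℝ × Y, (∀ w, extDeriv (expForm θ) g ![v, w] = 0) → v = 0) :
    IsContactDistribution 𝓘(ℝ, Y) (kernelField θ) := by
  refine fun x => ⟨univ, isOpen_univ, mem_univ x, θ, ?_, fun y _ => ⟨?_, ?_, ?_⟩⟩
  · exact (DiffForm.smoothOn_vectorSpace_iff θ univ).2 hθ.contDiffOn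
  · exact ne_zero_of_nondegenerate hθ hnd y
  · exact fun v => mem_kernelField (Y := Y)
  · intro v hv hw
    refine eq_zero_of_nondegenerate (Y := Y) hθ hnd (mem_kernelField.1 hv) fun w hw0 => ?_
    have h := hw w ((mem_kernelField (Y := Y)).2 hw0)
    exact (congrArg (fun η : Y [⋀^Fin 2]→L[ℝ] ℝ => η ![v, w])
      (DiffForm.d_vectorSpace (F := Y) θ y)).symm.trans h

/-- A contact form with the same kernels as `θ₁` is a multiple of `θ₁`. -/
theorem exists_factor_of_isContactFormOn {θ₁ : Y → Y [⋀^Fin 1]→L[ℝ] ℝ} (hθ₁ : ContDiff ℝ ∞ θ₁)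
    {V : Set Y} (hV : IsOpen V) {θ : DiffForm 𝓘(ℝ, Y) Y 1}
    (hθ : IsContactFormOn 𝓘(ℝ, Y) (kernelField θ₁) θ V) :
    ∃ f : Y → ℝ, ContDiffOn ℝ ∞ f V ∧ (∀ y ∈ V, f y ≠ 0) ∧
      ∀ y ∈ V, ∀ v : Y, (show Y [⋀^Fin 1]→L[ℝ] ℝ from θ y) ![v] = f y * θ₁ y ![v] :=
  exists_smooth_factor (θ := fun y => (show Y [⋀^Fin 1]→L[ℝ] ℝ from θ y)) hV hθ₁.contDiffOn
    ((DiffForm.smoothOn_vectorSpace_iff θ V).1 hθ.1) (fun y hy => (hθ.2 y hy).1)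
    (fun y hy v => mem_kernelField.symm.trans ((hθ.2 y hy).2.1 v))

end Structures

/-! ### The spaces of null geodesics of a tube -/

set_option maxHeartbeats 2000000 in
theorem mainTheorem9 (n : ℕ) {M : Type*} [TopologicalSpace M]
    [ChartedSpace (EuclideanSpace ℝ (Fin (n + 2))) M] [IsManifold (𝓡 (n + 2)) ∞ M]
    (g : LorentzianMetric n M)
    (σ₀ : CotangentBundle n M) (hσ₀ : σ₀ ∈ g.nullCone)
    (O : Set (CotangentBundle n M)) (hO : IsOpen O) (hOconic : IsConic O) (hσ₀O : σ₀ ∈ O) :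
    -- a conic open neighbourhood `W ⊂ O` of `σ₀`; write `U = Σ ∩ W`
    ∃ W : Set (CotangentBundle n M), IsOpen W ∧ IsConic W ∧ σ₀ ∈ W ∧ W ⊆ O ∧
    -- smooth manifolds `𝒢` of dimension `2n+2` and `𝒩` of dimension `2n+1`
    ∃ (𝒢 : Type) (_ : TopologicalSpace 𝒢) (_ : T2Space 𝒢) (_ : SecondCountableTopology 𝒢)
      (_ : ChartedSpace (EuclideanSpace ℝ (Fin (2 * n + 2))) 𝒢)
      (_ : IsManifold (𝓡 (2 * n + 2)) ∞ 𝒢)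
      (𝒩 : Type) (_ : TopologicalSpace 𝒩) (_ : T2Space 𝒩) (_ : SecondCountableTopology 𝒩)
      (_ : ChartedSpace (EuclideanSpace ℝ (Fin (2 * n + 1))) 𝒩)
      (_ : IsManifold (𝓡 (2 * n + 1)) ∞ 𝒩)
      (π : CotangentBundle n M → 𝒢) (q : 𝒢 → 𝒩)
      (ωG : DiffForm (𝓡 (2 * n + 2)) 𝒢 2)
      (C : (y : 𝒩) → Submodule ℝ (TangentSpace (𝓡 (2 * n + 1)) y)),
      -- `𝒢` is the quotient manifold of `U` by the lifted null-geodesic flow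
      (ContMDiffOn (cotangentModel n) (𝓡 (2 * n + 2)) ∞ π W ∧
        (∀ a : 𝒢, ∃ σ ∈ g.nullCone ∩ W, π σ = a) ∧
        (∀ σ ∈ g.nullCone ∩ W, ∀ τ ∈ g.nullCone ∩ W,
          (π σ = π τ ↔ g.FlowEquiv (g.nullCone ∩ W) σ τ)) ∧
        (∀ σ ∈ g.nullCone ∩ W, ∀ u : TangentSpace (𝓡 (2 * n + 2)) (π σ),
          ∃ v ∈ g.nullConeTangent σ,
            mfderiv (cotangentModel n) (𝓡 (2 * n + 2)) π σ v = u)) ∧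
      -- `𝒢` is symplectic, with the form induced by `ω = dα`
      (IsSymplecticForm (𝓡 (2 * n + 2)) ωG ∧
        ∀ σ ∈ g.nullCone ∩ W, ∀ v ∈ g.nullConeTangent σ, ∀ w ∈ g.nullConeTangent σ,
          DiffForm.pullback (cotangentModel n) (𝓡 (2 * n + 2)) π ωG σ ![v, w]
            = canonicalForm n M σ ![v, w]) ∧
      -- `𝒩` is the quotient manifold of `𝒢` by the fiberwise scaling, which descends to `𝒢`
      (ContMDiff (𝓡 (2 * n + 2)) (𝓡 (2 * n + 1)) ∞ q ∧ Function.Surjective q ∧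
        (∀ a : 𝒢, Function.Surjective (mfderiv (𝓡 (2 * n + 2)) (𝓡 (2 * n + 1)) q a)) ∧
        (∀ σ ∈ g.nullCone ∩ W, ∀ τ ∈ g.nullCone ∩ W, π σ = π τ →
          ∀ c : ℝ, 0 < c → π (dilate c σ) = π (dilate c τ)) ∧
        (∀ σ ∈ g.nullCone ∩ W, ∀ τ ∈ g.nullCone ∩ W,
          (q (π σ) = q (π τ) ↔ ∃ c : ℝ, 0 < c ∧ π (dilate c σ) = π τ))) ∧
      -- the points of `𝒩` are the unparametrized null geodesics
      (∀ σ ∈ g.nullCone ∩ W, ∀ τ ∈ g.nullCone ∩ W,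
        (q (π σ) = q (π τ) ↔ g.SameUnparametrizedNullGeodesic (g.nullCone ∩ W) σ τ)) ∧
      -- `𝒩` is a contact manifold; the contact hyperplane at `[γ]` consists of the classes of the
      -- variations `v` of `γ` with `α(v) = g(J, k) = 0`, `J` being the projection of `v` to `TM`
      (IsContactDistribution (𝓡 (2 * n + 1)) C ∧
        ∀ σ ∈ g.nullCone ∩ W, ∀ u : TangentSpace (𝓡 (2 * n + 1)) (q (π σ)),
          (u ∈ C (q (π σ)) ↔ ∃ v ∈ g.nullConeTangent σ, tautologicalForm n M σ ![v] = 0 ∧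
            mfderiv (cotangentModel n) (𝓡 (2 * n + 1)) (q ∘ π) σ v = u)) ∧
      -- for every contact form `θ` for `C` on an open set `V` of `𝒩`:
      (∀ (V : Set 𝒩) (θ : DiffForm (𝓡 (2 * n + 1)) 𝒩 1), IsOpen V →
        IsContactFormOn (𝓡 (2 * n + 1)) C θ V →
        -- if `V` is connected, then for some sign `ε` the form `ε θ` is positive, i.e. coorients `C`
        -- as `α` does
        (IsPreconnected V → ∃ ε : ℝ, (ε = 1 ∨ ε = -1) ∧
          ∀ σ ∈ g.nullCone ∩ W, q (π σ) ∈ V → ∀ v ∈ g.nullConeTangent σ,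
            0 < tautologicalForm n M σ ![v] →
            0 < ε * DiffForm.pullback (cotangentModel n) (𝓡 (2 * n + 1)) (q ∘ π) θ σ ![v]) ∧
        -- if `θ` is positive, then `𝒢` over `V` is the symplectization `(ℝ_{>0} × V, d(r θ))`
        ((∀ σ ∈ g.nullCone ∩ W, q (π σ) ∈ V → ∀ v ∈ g.nullConeTangent σ,
            0 < tautologicalForm n M σ ![v] →
            0 < DiffForm.pullback (cotangentModel n) (𝓡 (2 * n + 1)) (q ∘ π) θ σ ![v]) →
          ∃ Φ : OpenPartialHomeomorph 𝒢 (ℝ × 𝒩),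
            Φ.source = q ⁻¹' V ∧ Φ.target = Ioi (0 : ℝ) ×ˢ V ∧
            ContMDiffOn (𝓡 (2 * n + 2)) (𝓘(ℝ, ℝ).prod (𝓡 (2 * n + 1))) ∞ Φ Φ.source ∧
            ContMDiffOn (𝓘(ℝ, ℝ).prod (𝓡 (2 * n + 1))) (𝓡 (2 * n + 2)) ∞ Φ.symm Φ.target ∧
            (∀ a ∈ Φ.source,
              DiffForm.pullback (𝓡 (2 * n + 2)) (𝓘(ℝ, ℝ).prod (𝓡 (2 * n + 1))) Φ
                (DiffForm.d (𝓘(ℝ, ℝ).prod (𝓡 (2 * n + 1)))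
                  (symplectizationPrimitive (𝓡 (2 * n + 1)) θ)) a = ωG a) ∧
            -- the projection to `𝒩` forgets the scale, and `r` records it
            (∀ a ∈ Φ.source, (Φ a).2 = q a) ∧
            (∀ σ ∈ g.nullCone ∩ W, q (π σ) ∈ V →
              (∀ c : ℝ, 0 < c → (Φ (π (dilate c σ))).1 = c * (Φ (π σ)).1) ∧
              ∀ v ∈ g.nullConeTangent σ, tautologicalForm n M σ ![v]
                = (Φ (π σ)).1 *
                  DiffForm.pullback (cotangentModel n) (𝓡 (2 * n + 1)) (q ∘ π) θ σ ![v]))) := by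
  obtain ⟨ε, L, hL, hLt, hσ₀W, hWO⟩ := g.exists_tube hσ₀ hO hOconic hσ₀O
  have H := g.isHomogeneousHamiltonian_coordHamiltonian σ₀
  -- in terms of the flow label `(s, y)`, `𝒢` is the space of all `(s, y)` and `𝒩` that of all `y`
  set F := EuclideanSpace ℝ (Fin (2 * n + 1))
  set G := EuclideanSpace ℝ (Fin (2 * n + 2))
  let e : G ≃L[ℝ] ℝ × F := ContinuousLinearEquiv.ofFinrankEq (by
    rw [Module.finrank_prod, finrank_euclideanSpace_fin, finrank_euclideanSpace_fin,
      Module.finrank_self]; ring)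
  set θ₁ := reducedContactForm L
  have hθ₁s : ContDiff ℝ ∞ θ₁ := hL.contDiff_reducedContactForm
  have hβ : reducedForm L = expForm θ₁ := hL.reducedForm_eq
  have hnd : ∀ a v : ℝ × F, (∀ w, extDeriv (expForm θ₁) a ![v, w] = 0) → v = 0 := by
    intro a v hv
    rw [← hβ] at hv
    exact hL.extDeriv_reducedForm_nondegenerate H hLt hv
  let π : CotangentBundle n M → G := fun σ => e.symm (flowLabel σ₀ L σ)
  let q : G → F := fun a => (e a).2
  let U := g.nullCone ∩ tube σ₀ L
  have hqπ : q ∘ π = fun σ => (flowLabel σ₀ L σ).2 := by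
    funext σ; simp [q, π]
  have hq : ∀ σ, q (π σ) = (flowLabel σ₀ L σ).2 := fun σ => congrFun hqπ σ
  have hπinj : ∀ σ τ, π σ = π τ ↔ flowLabel σ₀ L σ = flowLabel σ₀ L τ := fun σ τ =>
    e.symm.injective.eq_iff
  have hdπ : ∀ σ ∈ tube σ₀ L, ∀ v : TangentSpace (cotangentModel n) σ,
      mfderiv (cotangentModel n) (𝓡 (2 * n + 2)) π σ v = e.symm (flowLabelDiff σ₀ L σ v) := by
    intro σ hσ v
    have h1 : HasMFDerivAt (cotangentModel n) (𝓡 (2 * n + 2)) π σ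
        ((e.symm : (ℝ × F) →L[ℝ] G).comp (flowLabelDiff σ₀ L σ)) :=
      HasMFDerivAt.comp (g := e.symm) (f := flowLabel σ₀ L) σ
        e.symm.hasFDerivAt.hasMFDerivAt (LorentzianMetric.hasMFDerivAt_flowLabel hL hσ)
    rw [h1.mfderiv]; rfl
  have hdqπ : ∀ σ ∈ tube σ₀ L, ∀ v : TangentSpace (cotangentModel n) σ,
      mfderiv (cotangentModel n) (𝓡 (2 * n + 1)) (q ∘ π) σ v = (flowLabelDiff σ₀ L σ v).2 := by
    intro σ hσ v
    have h1 : HasMFDerivAt (cotangentModel n) (𝓡 (2 * n + 1)) (q ∘ π) σ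
        ((ContinuousLinearMap.snd ℝ ℝ F).comp (flowLabelDiff σ₀ L σ)) := by
      rw [hqπ]
      exact HasMFDerivAt.comp (g := (Prod.snd : ℝ × F → F)) (f := flowLabel σ₀ L) σ
        hasFDerivAt_snd.hasMFDerivAt (LorentzianMetric.hasMFDerivAt_flowLabel hL hσ)
    rw [h1.mfderiv]; rfl
  have htaut : ∀ σ ∈ U, ∀ v ∈ g.nullConeTangent σ, tautologicalForm n M σ ![v]
      = Real.exp (flowLabel σ₀ L σ).1 * θ₁ (flowLabel σ₀ L σ).2 ![(flowLabelDiff σ₀ L σ v).2] := by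
    intro σ hσ v hv
    rw [LorentzianMetric.tautologicalForm_eq_reducedForm hL hLt hσ hv, hβ, expForm_apply]
  have hpull : ∀ (θ : DiffForm (𝓡 (2 * n + 1)) F 1), ∀ σ ∈ tube σ₀ L,
      ∀ v : TangentSpace (cotangentModel n) σ,
      DiffForm.pullback (cotangentModel n) (𝓡 (2 * n + 1)) (q ∘ π) θ σ ![v]
        = (show F [⋀^Fin 1]→L[ℝ] ℝ from θ (flowLabel σ₀ L σ).2) ![(flowLabelDiff σ₀ L σ v).2] := by
    intro θ σ hσ v
    refine (compContinuousLinearMap_one _ _).trans ?_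
    rw [hdqπ σ hσ v, Function.comp_apply, hq]
    rfl
  have hqs : ContDiff ℝ ∞ q := contDiff_snd.comp e.contDiff
  refine ⟨tube σ₀ L, isOpen_tube σ₀ L, LorentzianMetric.isConic_tube hL, hσ₀W, hWO,
    G, inferInstance, inferInstance, inferInstance, inferInstance, inferInstance,
    F, inferInstance, inferInstance, inferInstance, inferInstance, inferInstance,
    π, q, fun a => (extDeriv (reducedForm L) (e a)).compContinuousLinearMap (e : G →L[ℝ] ℝ × F),
    kernelField θ₁, ⟨?_, ?_, ?_, ?_⟩, ⟨?_, ?_⟩, ⟨?_, ?_, ?_, ?_, ?_⟩, ?_, ⟨?_, ?_⟩, ?_⟩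
  · exact e.symm.contDiff.contMDiff.comp_contMDiffOn (LorentzianMetric.contMDiffOn_flowLabel hL)
  · intro a
    refine ⟨flowLine σ₀ L (e a) 0, LorentzianMetric.flowLine_mem hL hLt _ hL.zero_mem, ?_⟩
    simp only [π, LorentzianMetric.flowLabel_flowLine hL hLt _ hL.zero_mem,
      ContinuousLinearEquiv.symm_apply_apply]
  · intro σ hσ τ hτ
    rw [hπinj, LorentzianMetric.flowLabel_eq_iff_flowEquiv hL hLt hσ hτ]
  · intro σ hσ u
    obtain ⟨v, hv, hvu⟩ := LorentzianMetric.exists_flowLabelDiff_eq hL hLt hσ (e u)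
    refine ⟨v, hv, ?_⟩
    rw [hdπ σ hσ.2, hvu]
    exact e.symm_apply_apply u
  · exact isSymplecticForm_comp_extDeriv e hL.contDiff_reducedForm
      fun a v hv => hL.extDeriv_reducedForm_nondegenerate H hLt hv
  · intro σ hσ v hv w hw
    rw [LorentzianMetric.canonicalForm_eq_extDeriv_reducedForm hL hLt hσ hv hw]
    refine (compContinuousLinearMap_two _ _ _).trans ((compContinuousLinearMap_two _ _ _).trans ?_)
    rw [hdπ σ hσ.2, hdπ σ hσ.2]
    change extDeriv (reducedForm L) (e (e.symm _))
      ![e (e.symm (flowLabelDiff σ₀ L σ v)), e (e.symm (flowLabelDiff σ₀ L σ w))] = _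
    rw [e.apply_symm_apply, e.apply_symm_apply, e.apply_symm_apply]
  · exact hqs.contMDiff
  · intro y
    exact ⟨e.symm (0, y), by simp [q]⟩
  · intro a y
    have h1 : HasFDerivAt q ((ContinuousLinearMap.snd ℝ ℝ F).comp (e : G →L[ℝ] ℝ × F)) a :=
      HasFDerivAt.comp (g := (Prod.snd : ℝ × F → F)) a hasFDerivAt_snd e.hasFDerivAt
    refine ⟨e.symm (0, y), ?_⟩
    rw [h1.hasMFDerivAt.mfderiv]
    change (e (e.symm (0, y))).2 = y
    rw [e.apply_symm_apply]
  · intro σ hσ τ hτ h c hc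
    rw [hπinj] at h ⊢
    rw [LorentzianMetric.flowLabel_dilate hL hσ.2 hc, LorentzianMetric.flowLabel_dilate hL hτ.2 hc,
      h]
  · intro σ hσ τ hτ
    rw [hq, hq]
    constructor
    · intro h
      refine ⟨Real.exp ((flowLabel σ₀ L τ).1 - (flowLabel σ₀ L σ).1), Real.exp_pos _, ?_⟩
      rw [hπinj, LorentzianMetric.flowLabel_dilate hL hσ.2 (Real.exp_pos _), Real.log_exp]
      exact Prod.ext (by simp) h
    · rintro ⟨c, hc, h⟩
      rw [hπinj, LorentzianMetric.flowLabel_dilate hL hσ.2 hc] at h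
      exact (Prod.ext_iff.1 h).2
  · intro σ hσ τ hτ
    rw [hq, hq]
    exact LorentzianMetric.flowLabel_snd_eq_iff hL hLt hσ hτ
  · exact isContactDistribution_kernelField hθ₁s hnd
  · intro σ hσ u
    have hker : ∀ v : F, v ∈ kernelField θ₁ (q (π σ)) ↔ θ₁ (flowLabel σ₀ L σ).2 ![v] = 0 := by
      intro v
      rw [mem_kernelField, hq]
    have hexp := Real.exp_pos (flowLabel σ₀ L σ).1
    refine (hker u).trans ?_
    constructor
    · intro h
      obtain ⟨v, hv, hvu⟩ := LorentzianMetric.exists_flowLabelDiff_eq hL hLt hσ (0, u)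
      refine ⟨v, hv, ?_, ?_⟩
      · rw [htaut σ hσ v hv, hvu]
        exact mul_eq_zero_of_right _ h
      · rw [hdqπ σ hσ.2, hvu]
    · rintro ⟨v, hv, hv0, hvu⟩
      rw [htaut σ hσ v hv] at hv0
      rw [← hvu, hdqπ σ hσ.2]
      exact (mul_eq_zero.1 hv0).resolve_left hexp.ne'
  · intro V θ hV hθ
    -- `θ = f θ₁` over `V`, whereas `α` is the pullback of `e^s θ₁`
    obtain ⟨f, hfs, hf0, hfθ⟩ := exists_factor_of_isContactFormOn hθ₁s hV hθ
    have hpullf : ∀ σ ∈ U, q (π σ) ∈ V → ∀ v ∈ g.nullConeTangent σ,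
        DiffForm.pullback (cotangentModel n) (𝓡 (2 * n + 1)) (q ∘ π) θ σ ![v]
          = f (q (π σ)) * (Real.exp (-(flowLabel σ₀ L σ).1) * tautologicalForm n M σ ![v]) := by
      intro σ hσ hσV v hv
      rw [hpull θ σ hσ.2 v, htaut σ hσ v hv, ← mul_assoc (Real.exp _), ← Real.exp_add,
        neg_add_cancel, Real.exp_zero, one_mul, hq]
      rw [hq] at hσV
      exact hfθ _ hσV _
    refine ⟨fun hVc => ?_, fun hpos => ?_⟩
    · obtain ⟨δ, hδ, hδf⟩ := exists_sign_of_isPreconnected hVc hfs.continuousOn hf0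
      refine ⟨δ, hδ, fun σ hσ hσV v hv hvα => ?_⟩
      rw [hpullf σ hσ hσV v hv, ← mul_assoc]
      exact mul_pos (hδf _ hσV) (mul_pos (Real.exp_pos _) hvα)
    · have hfpos : ∀ y ∈ V, 0 < f y := by
        intro y hy
        -- test positivity of `θ` on a vector that projects to a positive vector `w` for `θ₁`
        obtain ⟨w, hw⟩ : ∃ w, 0 < θ₁ y ![w] := by
          obtain ⟨w, hw⟩ := exists_apply_ne_zero (ne_zero_of_nondegenerate hθ₁s hnd y)
          rcases lt_or_gt_of_ne hw with h | h
          · refine ⟨(-1 : ℝ) • w, ?_⟩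
            rw [one_form_map_smul]
            linarith
          · exact ⟨w, h⟩
        have hσ := LorentzianMetric.flowLine_mem hL hLt (0, y) hL.zero_mem
        have hlab := LorentzianMetric.flowLabel_flowLine hL hLt (0, y) hL.zero_mem
        set σ := flowLine σ₀ L (0, y) 0
        obtain ⟨v, hv, hvw⟩ := LorentzianMetric.exists_flowLabelDiff_eq hL hLt hσ (0, w)
        have hσy : q (π σ) = y := by rw [hq, hlab]
        have hα : 0 < tautologicalForm n M σ ![v] := by
          rw [htaut σ hσ v hv, hlab, hvw]
          exact mul_pos (Real.exp_pos _) hw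
        have h1 := hpos σ hσ (by rwa [hσy]) v hv hα
        rw [hpullf σ hσ (by rwa [hσy]) v hv, hσy] at h1
        exact pos_of_mul_pos_left h1 (mul_pos (Real.exp_pos _) hα).le
      obtain ⟨Φ, hΦs, hΦt, hΦ, hΦc, hΦc'⟩ := exists_symplectizationChart e hV hfs hfpos
      refine ⟨Φ, hΦs, hΦt, contMDiffOn_prod_of_contDiffOn hΦc, contMDiffOn_of_contDiffOn_prod hΦc',
        fun a ha => ?_, fun a _ => by rw [hΦ], fun σ hσ hσV => ⟨fun c hc => ?_, fun v hv => ?_⟩⟩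
      · have haV : (e a).2 ∈ V := by rw [hΦs] at ha; exact ha
        have hΦa : ContDiffAt ℝ ∞ Φ a := hΦc.contDiffAt (Φ.open_source.mem_nhds ha)
        have h1 := symplectizationChart_pullback e hV hfpos hθ₁s
          ((DiffForm.smoothOn_vectorSpace_iff θ V).1 hθ.1) hfθ hΦ haV hΦa
        rw [DiffForm.pullback, DiffForm.d_real_prod, symplectizationPrimitive_vectorSpace,
          (hasMFDerivAt_prod_of_hasFDerivAt
            (hΦa.differentiableAt (by simp)).hasFDerivAt).mfderiv, hβ]
        exact h1
      · rw [hΦ, hΦ]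
        have h1 : ∀ τ, e (π τ) = flowLabel σ₀ L τ := fun τ => e.apply_symm_apply _
        rw [h1, h1, LorentzianMetric.flowLabel_dilate hL hσ.2 hc, Real.exp_add, Real.exp_log hc]
        ring
      · have h1 : e (π σ) = flowLabel σ₀ L σ := e.apply_symm_apply _
        have key : ∀ s t u : ℝ, u ≠ 0 → t = Real.exp s / u * (u * (Real.exp (-s) * t)) := by
          intro s t u hu
          rw [div_mul_eq_mul_div, mul_left_comm, mul_div_cancel_left₀ _ hu, ← mul_assoc,
            ← Real.exp_add, add_neg_cancel, Real.exp_zero, one_mul]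
        rw [hpullf σ hσ hσV v hv, hΦ, h1, ← hq]
        exact key _ _ _ (hf0 _ hσV)
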